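/- **Setting.** Consider $n\ge 1$ bosonic modes with ladder operators $\hat a_j,\hat a_j^\dagger$ on the Fock space, and Majorana operators $\hat w_{j+}=(\hat a_j+\hat a_j^\dagger)/\sqrt2$, $\hat w_{j-}=i(\hat a_j-\hat a_j^\dagger)/\sqrt2$, ordered as $(1+,\dots,n+,1-,\dots,n-)$. Let $$\mathcal L(\hat R)=-i[\hat H,\hat R]+\sum_r\Big(\hat L_r\hat R\hat L_r^\dagger-\tfrac12\{\hat L_r^\dagger\hat L_r,\hat R\}\Big),\qquad \hat H=\sum_{\mu,\nu}H_{\mu\nu}\hat w_\mu\hat w_\nu,\quad \hat L_r=\sum_\mu L_{r,\mu}\hat w_\mu ,$$ with $H$ a real symmetric $2n\times 2n$ matrix and finitely many $\mathbf L_r\in\mathbb C^{2n}$. Operators are identified with their matrices in the occupation-number basis, on which left and right multiplication by ladder operators, and hence $\mathcal L$, act entrywise. Put $B=\sum_r\mathbf L_r\mathbf L_r^\dagger=B_{\rm r}+iB_{\rm i}$ (entrywise real and imaginary parts), $\tau=\sigma_y\otimes\mathbb 1_n$, $X_0=-2i\tau H+i\tau B_{\rm i}$ and $Y=\tau B_{\rm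 r}\tau$. Let $\Gamma_{\rm ss}$ be a physical covariance matrix, i.e. real symmetric positive definite with all symplectic eigenvalues (the moduli of the eigenvalues of $\tau\Gamma_{\rm ss}$) in $[\frac12,\infty)$, that solves $X_0\Gamma_{\rm ss}+\Gamma_{\rm ss}X_0^T=-Y$. Let $S^{-1}X_0S=\xi$ be in Jordan normal form, with blocks $k=1,\dots,N_{\rm J}$ of eigenvalue $\xi_k$ and dimension $D_k\ge 1$. Define the super-operators $$b_{j\pm}(\hat R)=\tfrac1{\sqrt2}(\hat w_{j\pm}\hat R+\hat R\hat w_{j\pm}),\qquad b'_{j\pm}(\hat R)=\tfrac{\pm i}{\sqrt2}(\hat w_{j\mp}\hat R-\hat R\hat w_{j\mp}),\qquad \mathbf d=S^{-1}(\mathbf b-2\Gamma_{\rm ss}\mathbf b'),\quad \mathbf d'=S^T\mathbf b',$$ with components $d_{k,\ell},d'_{k,\ell}$ ($1\le\ell\le D_k$). Polynomials in the $\hat w_\mu$ are called polynomial observables. **Claim.** The $d_{k,\ell}$ commute with each other, and so do the $d'_{k,\ell}$. One has $\operatorname{Tr} d'_{k,\ell}(\hat R)=0$ for every operator $\hat R$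 with rapidly decreasing matrix elements. There is exactly one operator $|\mathbf 0\rangle\!\rangle_d$ with trace $1$ and $d_{k,\ell}|\mathbf 0\rangle\!\rangle_d=0$ for all $k,\ell$; it is a density operator with covariance matrix $\frac12\operatorname{Tr}\big((\hat w_\mu\hat w_\nu+\hat w_\nu\hat w_\mu)\,|\mathbf 0\rangle\!\rangle_d\big)=(\Gamma_{\rm ss})_{\mu\nu}$, it satisfies $\mathcal L|\mathbf 0\rangle\!\rangle_d=0$, and every operator obtained from it by left and right multiplications with ladder operators and linear combinations is rapidly decreasing. For $\mathbf n=(n_{k,\ell})$ with $n_{k,\ell}\in\mathbb N=\{0,1,2,\dots\}$ put $$|\mathbf n\rangle\!\rangle=\prod_{k,\ell}\frac{(d'_{k,\ell})^{n_{k,\ell}}}{\sqrt{n_{k,\ell}!}}\,|\mathbf 0\rangle\!\rangle_d,\qquad \langle\!\langle\mathbf n|\hat R\rangle\!\rangle=\operatorname{Tr}\Big(\prod_{k,\ell}\frac{(d_{k,\ell})^{n_{k,\ell}}}{\sqrt{n_{k,\ell}!}}(\hat R)\Big).$$ 1. The $|\mathbf n\rangle\!\rangle$ form a (Hamel) basis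 of the space of all operators generated from $|\mathbf 0\rangle\!\rangle_d$ by left and right multiplications with ladder operators and linear combinations. The $\langle\!\langle\mathbf n|$ form a (Hamel) basis of the functionals $\hat R\mapsto\operatorname{Tr}(\hat P\hat R)$, $\hat P$ a polynomial observable, on rapidly decreasing operators. The two bases are biorthogonal: $\langle\!\langle\mathbf n|\mathbf n'\rangle\!\rangle=\delta_{\mathbf n,\mathbf n'}$. 2. Let $I_{\mathbf n}=\sum_{k,\ell}\ell\,n_{k,\ell}$. The matrix $\mathcal L_{\mathbf n,\mathbf n'}=\langle\!\langle\mathbf n|\mathcal L|\mathbf n'\rangle\!\rangle$ is well defined, and upper triangular in every order of the bases by non-decreasing $I_{\mathbf n}$ (that is, $\mathcal L_{\mathbf n,\mathbf n'}=0$ if $\mathbf n\ne\mathbf n'$ and $I_{\mathbf n}\ge I_{\mathbf n'}$). Its diagonal entries are $\lambda_{\mathbf n}=\sum_{k,\ell}\xi_kn_{k,\ell}$. Each $|\mathbf n\rangle\!\rangle$ is a generalized eigenvector of $\mathcal L$ for $\lambda_{\mathbf n}$, and the set of eigenvalues of $\mathcal L$ on the span of the $|\mathbf n\rangle\!\rangle$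 is $\{\lambda_{\mathbf n}\}$. 3. If $\operatorname{Re}\xi_k\le0$ for all $k$, then $\operatorname{Re}\lambda_{\mathbf n}\le 0$ for all $\mathbf n$, and the system is stable: every solution $\Gamma(t)$, $t\ge0$, of the covariance equation of motion $\partial_t\Gamma=X_0\Gamma+\Gamma X_0^T+Y$ is bounded. 4. If $\operatorname{Re}\xi_k<0$ for all $k$, then the system is relaxing: every such solution converges to $\Gamma_{\rm ss}$ as $t\to\infty$. Moreover $|\mathbf 0\rangle\!\rangle_d$ is the unique steady state, i.e. the only density operator $\hat\rho$ with $\mathcal L(\hat\rho)=0$. The dissipative gap is $\Delta=-\max_{\mathbf n\ne\mathbf 0}\operatorname{Re}\lambda_{\mathbf n}=-\max_k\operatorname{Re}\xi_k>0$, and the maximum is attained by an $\mathbf n$ with a single excitation. -/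

import Mathlib

open scoped Matrix

noncomputable section

namespace QuasiFreeBoson

/-! ### Fock space and operators -/

/-- Majorana modes `(1+, …, n+, 1-, …, n-)`: `inl j` is `j+` and `inr j` is `j-`. -/
abbrev Mode (n : ℕ) := Fin n ⊕ Fin n

/-- Occupation numbers of `n` bosonic modes; they label the number basis of the Fock space. -/
abbrev Occ (n : ℕ) := Fin n → ℕ

/-- Operators on the `n`-mode Fock space, given by their matrix elements in the number basis:
`R α β` is `⟨α| R |β⟩`. -/
abbrev Op (n : ℕ) := Matrix (Occ n) (Occ n) ℂ

/-- Super-operators. -/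
abbrev SuperOp (n : ℕ) := Module.End ℂ (Op n)

variable {n : ℕ}

/-- `R ↦ â_j R`, where `â_j |γ⟩ = √γ_j |γ - e_j⟩`. -/
def annihL (j : Fin n) : SuperOp n where
  toFun R := Matrix.of fun α β => (Real.sqrt (α j + 1) : ℂ) * R (α + Pi.single j 1) β
  map_add' R R' := by ext α β; simp [mul_add]
  map_smul' c R := by ext α β; simp [mul_left_comm]

/-- `R ↦ â_j† R`, where `â_j† |γ⟩ = √(γ_j + 1) |γ + e_j⟩`. If `α j = 0`, the prefactor vanishes. -/
def createL (j : Fin n) : SuperOp n where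
  toFun R := Matrix.of fun α β => (Real.sqrt (α j) : ℂ) * R (α - Pi.single j 1) β
  map_add' R R' := by ext α β; simp [mul_add]
  map_smul' c R := by ext α β; simp [mul_left_comm]

/-- `R ↦ R â_j`. If `β j = 0`, the prefactor vanishes. -/
def annihR (j : Fin n) : SuperOp n where
  toFun R := Matrix.of fun α β => (Real.sqrt (β j) : ℂ) * R α (β - Pi.single j 1)
  map_add' R R' := by ext α β; simp [mul_add]
  map_smul' c R := by ext α β; simp [mul_left_comm]

/-- `R ↦ R â_j†`. -/
def createR (j : Fin n) : SuperOp n where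
  toFun R := Matrix.of fun α β => (Real.sqrt (β j + 1) : ℂ) * R α (β + Pi.single j 1)
  map_add' R R' := by ext α β; simp [mul_add]
  map_smul' c R := by ext α β; simp [mul_left_comm]

/-- Left multiplication `R ↦ ŵ_μ R` by the Majorana operators
`ŵ_{j+} = (â_j + â_j†)/√2` and `ŵ_{j-} = i(â_j - â_j†)/√2`. -/
def wL : Mode n → SuperOp n
  | Sum.inl j => (1 / (Real.sqrt 2 : ℂ)) • (annihL j + createL j)
  | Sum.inr j => (Complex.I / (Real.sqrt 2 : ℂ)) • (annihL j - createL j)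

/-- Right multiplication `R ↦ R ŵ_μ`. -/
def wR : Mode n → SuperOp n
  | Sum.inl j => (1 / (Real.sqrt 2 : ℂ)) • (annihR j + createR j)
  | Sum.inr j => (Complex.I / (Real.sqrt 2 : ℂ)) • (annihR j - createR j)

/-- `b_{j±}(R) = (ŵ_{j±} R + R ŵ_{j±})/√2`. -/
def bOp (μ : Mode n) : SuperOp n := (1 / (Real.sqrt 2 : ℂ)) • (wL μ + wR μ)

/-- `b'_{j±}(R) = ± i (ŵ_{j∓} R - R ŵ_{j∓})/√2`. -/
def bOp' : Mode n → SuperOp n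
  | Sum.inl j => (Complex.I / (Real.sqrt 2 : ℂ)) • (wL (Sum.inr j) - wR (Sum.inr j))
  | Sum.inr j => (-Complex.I / (Real.sqrt 2 : ℂ)) • (wL (Sum.inl j) - wR (Sum.inl j))

/-- The trace of an operator, `Tr R = ∑ α, ⟨α| R |α⟩`. -/
def tr (R : Op n) : ℂ := ∑' α, R α α

/-- The series for `Tr R` converges (absolutely) and its sum is `z`. -/
def HasTrace (R : Op n) (z : ℂ) : Prop := HasSum (fun α => R α α) z

/-- Rapidly decreasing matrix elements. -/
def IsRapidlyDecreasing (R : Op n) : Prop :=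
  ∀ k : ℕ, ∃ C : ℝ, ∀ α β : Occ n,
    (1 + (∑ j, (α j : ℝ)) + ∑ j, (β j : ℝ)) ^ k * ‖R α β‖ ≤ C

open scoped ComplexOrder in
/-- Density operators: positive semidefinite with trace one. -/
def IsDensityOperator (ρ : Op n) : Prop := ρ.PosSemidef ∧ HasTrace ρ 1

/-! ### Quasi-free systems -/

/-- A quasi-free system of `n` bosonic modes: the Hamiltonian `Ĥ = ∑ ŵ_μ H_{μν} ŵ_ν` with `H` real
symmetric, and finitely many linear Lindblad operators `L̂_r = ∑ L_{r,μ} ŵ_μ`. -/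
structure System (n : ℕ) where
  H : Matrix (Mode n) (Mode n) ℝ
  H_symm : H.IsSymm
  numLindblad : ℕ
  L : Fin numLindblad → Mode n → ℂ

/-- `R ↦ (∑ c_μ ŵ_μ) R`. -/
def linL (c : Mode n → ℂ) : SuperOp n := ∑ μ, c μ • wL μ

/-- `R ↦ R (∑ c_μ ŵ_μ)`. -/
def linR (c : Mode n → ℂ) : SuperOp n := ∑ μ, c μ • wR μ

/-- The matrix `τ = σ_y ⊗ 1_n`. -/
def tau (n : ℕ) : Matrix (Mode n) (Mode n) ℂ :=
  Matrix.fromBlocks 0 (-(Complex.I • (1 : Matrix (Fin n) (Fin n) ℂ))) (Complex.I • 1) 0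

/-- A real matrix regarded as a complex one. -/
def toC {ι κ : Type*} (A : Matrix ι κ ℝ) : Matrix ι κ ℂ := A.map Complex.ofReal

namespace System

variable (sys : System n)

/-- `R ↦ Ĥ R = ∑ H_{μν} ŵ_μ ŵ_ν R`. -/
def hamL : SuperOp n := ∑ μ, ∑ ν, (sys.H μ ν : ℂ) • (wL μ * wL ν)

/-- `R ↦ R Ĥ = ∑ H_{μν} R ŵ_μ ŵ_ν`. -/
def hamR : SuperOp n := ∑ μ, ∑ ν, (sys.H μ ν : ℂ) • (wR ν * wR μ)

/-- The Lindblad generator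
`R ↦ -i[Ĥ, R] + ∑_r (L̂_r R L̂_r† - (L̂_r† L̂_r R + R L̂_r† L̂_r)/2)`. -/
def liouvillian : SuperOp n :=
  -Complex.I • (sys.hamL - sys.hamR)
    + ∑ r, (linL (sys.L r) * linR (star (sys.L r))
        - (1 / 2 : ℂ) • (linL (star (sys.L r)) * linL (sys.L r)
            + linR (sys.L r) * linR (star (sys.L r))))

/-- `B = ∑_r L_r L_r†`, i.e. `B_{μν} = ∑_r L_{r,μ} conj L_{r,ν}`. -/
def B : Matrix (Mode n) (Mode n) ℂ := ∑ r, Matrix.vecMulVec (sys.L r) (star (sys.L r))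

/-- The real part of `B`. -/
def Br : Matrix (Mode n) (Mode n) ℝ := sys.B.map Complex.re

/-- The imaginary part of `B`. -/
def Bi : Matrix (Mode n) (Mode n) ℝ := sys.B.map Complex.im

/-- `X₀ = -2iτH + iτB_i`. -/
def X₀ : Matrix (Mode n) (Mode n) ℂ :=
  (-2 * Complex.I) • (tau n * toC sys.H) + Complex.I • (tau n * toC sys.Bi)

/-- `Y = τ B_r τ`. -/
def Y : Matrix (Mode n) (Mode n) ℂ := tau n * toC sys.Br * tau n

/-- `Γ` solves the continuous Lyapunov equation `X₀ Γ + Γ X₀ᵀ = -Y`. -/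
def SolvesLyapunov (Γ : Matrix (Mode n) (Mode n) ℝ) : Prop :=
  sys.X₀ * toC Γ + toC Γ * sys.X₀ᵀ = -sys.Y

/-- `G` solves the covariance-matrix equation of motion `∂ₜ G = X₀ G + G X₀ᵀ + Y` for `t ≥ 0`. -/
def IsCovarianceEvolution (G : ℝ → Matrix (Mode n) (Mode n) ℝ) : Prop :=
  ∀ t : ℝ, 0 ≤ t → ∀ μ ν, HasDerivWithinAt (fun s : ℝ => (G s μ ν : ℂ))
    ((sys.X₀ * toC (G t) + toC (G t) * sys.X₀ᵀ + sys.Y) μ ν) (Set.Ici 0) t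

/-- Stability: no covariance-matrix element can diverge. -/
def IsStable : Prop :=
  ∀ G : ℝ → Matrix (Mode n) (Mode n) ℝ, sys.IsCovarianceEvolution G →
    ∃ C : ℝ, ∀ t : ℝ, 0 ≤ t → ∀ μ ν, |G t μ ν| ≤ C

/-- The covariance matrix converges to `Γ` for every initial condition. -/
def IsRelaxingTo (Γ : Matrix (Mode n) (Mode n) ℝ) : Prop :=
  ∀ G : ℝ → Matrix (Mode n) (Mode n) ℝ, sys.IsCovarianceEvolution G →
    ∀ μ ν, Filter.Tendsto (fun t => G t μ ν) Filter.atTop (nhds (Γ μ ν))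

/-- Steady states: density operators annihilated by the Liouvillian. -/
def IsSteadyState (ρ : Op n) : Prop := IsDensityOperator ρ ∧ sys.liouvillian ρ = 0

end System

/-- The symplectic eigenvalues of a positive definite `Γ`: the spectrum of `τΓ` consists of the
numbers `±ν` with `ν` a symplectic eigenvalue. -/
def symplecticEigenvalues (Γ : Matrix (Mode n) (Mode n) ℝ) : Set ℝ :=
  {ν | 0 ≤ ν ∧ Module.End.HasEigenvalue (Matrix.toLin' (tau n * toC Γ)) (ν : ℂ)}

/-- Physical covariance matrices: real, symmetric, positive definite, and with all symplectic
eigenvalues in `[1/2, ∞)`. -/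
def IsPhysical (Γ : Matrix (Mode n) (Mode n) ℝ) : Prop :=
  Γ.PosDef ∧ symplecticEigenvalues Γ ⊆ Set.Ici (1 / 2)

/-! ### Jordan form, ladder super-operators and operator bases -/

/-- A transformation `S⁻¹ X S = ξ` of a complex matrix `X` to Jordan normal form, with `numBlocks`
blocks; block `k` has dimension `size k ≥ 1` and eigenvalue `eig k`. -/
structure JordanForm (X : Matrix (Mode n) (Mode n) ℂ) where
  numBlocks : ℕ
  size : Fin numBlocks → ℕ
  size_pos : ∀ k, 0 < size k
  eig : Fin numBlocks → ℂ
  S : Matrix (Mode n) (Σ k, Fin (size k)) ℂ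
  Sinv : Matrix (Σ k, Fin (size k)) (Mode n) ℂ
  S_mul_Sinv : S * Sinv = 1
  Sinv_mul_S : Sinv * S = 1
  jordan : Sinv * X * S = Matrix.of fun p q =>
    if p = q then eig p.1
    else if p.1 = q.1 ∧ (p.2 : ℕ) + 1 = (q.2 : ℕ) then 1
    else 0

namespace JordanForm

variable {X : Matrix (Mode n) (Mode n) ℂ} (J : JordanForm X)

/-- The labels `(k, ℓ)`, where the rank `ℓ` is counted from `0`. -/
abbrev Idx := Σ k, Fin (J.size k)

/-- Super-boson occupation numbers `n_{k,ℓ} ∈ ℕ`. -/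
abbrev Exc := J.Idx → ℕ

/-- The annihilation super-operators: the components of `d = S⁻¹ (b - 2 Γ b')`. -/
def d (Γ : Matrix (Mode n) (Mode n) ℝ) (p : J.Idx) : SuperOp n :=
  ∑ μ, J.Sinv p μ • (bOp μ - (2 : ℂ) • ∑ ν, (Γ μ ν : ℂ) • bOp' ν)

/-- The creation super-operators: the components of `d' = Sᵀ b'`. -/
def d' (p : J.Idx) : SuperOp n := ∑ μ, J.S μ p • bOp' μ

/-- The product of `f (k, ℓ)` over all `k, ℓ` in lexicographic order. -/
def orderedProd (f : J.Idx → SuperOp n) : SuperOp n :=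
  ((List.finRange J.numBlocks).map fun k =>
    ((List.finRange (J.size k)).map fun l => f ⟨k, l⟩).prod).prod

/-- `∏_{k,ℓ} (d'_{k,ℓ})^{n_{k,ℓ}} / √(n_{k,ℓ}!)`. -/
def ketOp (N : J.Exc) : SuperOp n :=
  J.orderedProd fun p => (1 / (Real.sqrt (N p).factorial : ℂ)) • J.d' p ^ N p

/-- `∏_{k,ℓ} (d_{k,ℓ})^{n_{k,ℓ}} / √(n_{k,ℓ}!)`. -/
def braOp (Γ : Matrix (Mode n) (Mode n) ℝ) (N : J.Exc) : SuperOp n :=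
  J.orderedProd fun p => (1 / (Real.sqrt (N p).factorial : ℂ)) • J.d Γ p ^ N p

/-- The right vacuum: annihilated by all `d_{k,ℓ}`, and of trace one. -/
def IsRightVacuum (Γ : Matrix (Mode n) (Mode n) ℝ) (ρ : Op n) : Prop :=
  (∀ p, J.d Γ p ρ = 0) ∧ HasTrace ρ 1

/-- `|N⟩⟩`, built on the right vacuum `ρ`. -/
def ket (ρ : Op n) (N : J.Exc) : Op n := J.ketOp N ρ

/-- `⟨⟨N|R⟩⟩ = ⟨⟨1| ∏ (d_{k,ℓ})^{n_{k,ℓ}} / √(n_{k,ℓ}!) |R⟩⟩`, where `⟨⟨1|R⟩⟩ = Tr R`. -/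
def bra (Γ : Matrix (Mode n) (Mode n) ℝ) (N : J.Exc) (R : Op n) : ℂ := tr (J.braOp Γ N R)

/-- `I_N = ∑_{k,ℓ} ℓ n_{k,ℓ}` with `ℓ = 1, …, D_k`. -/
def level (N : J.Exc) : ℕ := ∑ p : J.Idx, ((p.2 : ℕ) + 1) * N p

/-- `λ_N = ∑_{k,ℓ} ξ_k n_{k,ℓ}`. -/
def lam (N : J.Exc) : ℂ := ∑ p : J.Idx, J.eig p.1 * (N p : ℂ)

end JordanForm

end QuasiFreeBoson

end

open scoped Matrix

noncomputable section

namespace QuasiFreeBoson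

variable {n : ℕ}

/-! ### Ladder super-operators as partial derivatives and multiplications -/

/-! A matrix `R` is read as the generating function Σ_p R_p z^p/√(p!) in 2n variables, one for each
row index and one for each column index. Left and right multiplications by ladder operators are then
∂_i and multiplication by z_i, entry by entry. In real phase-space coordinates X with derivatives D
one has b = (X + D)/√2 and b' = (X - D)/√2, hence [b_μ, b'_ν] = δ_μν, and the Liouvillian is the
quadratic form X₀ b' b + Y b' b'. The shift e = b - 2Γb' keeps the commutators, and the Lyapunov
equation is exactly the vanishing of the b' b' term that remains (`System.liouvillian_eq_eOp`). The
Jordan basis gives Σ ξ_pq d'_p d_q (`System.liouvillian_eq_d`): number operators weighted by ξ_k,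
plus terms that move an excitation down one rank inside a block. Triangularity, the diagonal λ and
the generalized eigenvectors follow. Biorthogonality is Fock-space algebra (`lowering_of_raising`),
used once for kets, with d' raising, and once for functionals, with d raising and the trace as
vacuum.

The condition eR = 0 is a linear differential equation ∂_i f = (Az)_i f, so f = f(0) exp(zᵀAz/2) is
forced. Positivity of Γ makes A a strict contraction, whence rapid decrease
(`vacuumForm_contraction`, `SolvesGauss.mem_rapid`). The uncertainty relation 2Γ ≥ τ makes the block
of A that couples rows to columns a Gram matrix, whence positivity of the operator
(`vacuumForm_cross`, `gaussOp_posSemidef`).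

For stability, Γ itself provides the norm in which X₀ is dissipative. For relaxation, a rescaled
Jordan basis provides it.

Uniqueness of the steady state concerns arbitrary density operators, which need not decrease
rapidly. Their Husimi function is integrable (`IsDensityOperator.integrable_husimi`), and its
Fourier transform χ obeys a transport equation along k' = X₀ᵀk, whose solution is a Gaussian times a
constant because k(t) → 0. Moments of the Husimi function may diverge, so the equation is derived
with a cut-off exp(-ε‖x‖²/2), and the error is shown to vanish with ε (`System.exists_evolution_le`,
`tendsto_cutoffMoment`). Two steady states thus have proportional χ; Fourier inversion and the trace
identify them. -/

/-- The matrix element of `R`, indexed by a joint multi-index. -/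
def entry (R : Op n) (p : Mode n → ℕ) : ℂ := R (fun j => p (Sum.inl j)) (fun j => p (Sum.inr j))

lemma entry_ext {R R' : Op n} (h : ∀ p, entry R p = entry R' p) : R = R' := by
  ext α β
  exact h (Sum.elim α β)

lemma SuperOp.smul_sub (c : ℂ) (A B : SuperOp n) : c • (A - B) = c • A - c • B :=
  _root_.smul_sub c A B

lemma SuperOp.mul_neg (A B : SuperOp n) : A * -B = -(A * B) := _root_.mul_neg A B

lemma SuperOp.neg_mul (A B : SuperOp n) : -A * B = -(A * B) := _root_.neg_mul A B

lemma SuperOp.neg_neg (A : SuperOp n) : - -A = A := _root_.neg_neg A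

/-- The lowering super-operators: partial derivatives in the Bargmann picture. -/
def dz : Mode n → SuperOp n
  | Sum.inl j => annihL j
  | Sum.inr j => createR j

/-- The raising super-operators: multiplications by variables in the Bargmann picture. -/
def zz : Mode n → SuperOp n
  | Sum.inl j => createL j
  | Sum.inr j => annihR j

lemma entry_dz (i : Mode n) (R : Op n) (p : Mode n → ℕ) :
    entry (dz i R) p = (Real.sqrt (p i + 1) : ℂ) * entry R (p + Pi.single i 1) := by
  rcases i with j | j
  · have h1 : (fun k => (p + Pi.single (Sum.inl j) 1 : Mode n → ℕ) (Sum.inl k)) =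
        (fun k => p (Sum.inl k)) + Pi.single j 1 := by
      ext k; simp [Pi.single_apply]
    have h2 : (fun k => (p + Pi.single (Sum.inl j) 1 : Mode n → ℕ) (Sum.inr k)) =
        (fun k => p (Sum.inr k)) := by
      ext k; simp
    rw [entry, entry, h1, h2]; rfl
  · have h1 : (fun k => (p + Pi.single (Sum.inr j) 1 : Mode n → ℕ) (Sum.inr k)) =
        (fun k => p (Sum.inr k)) + Pi.single j 1 := by
      ext k; simp [Pi.single_apply]
    have h2 : (fun k => (p + Pi.single (Sum.inr j) 1 : Mode n → ℕ) (Sum.inl k)) =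
        (fun k => p (Sum.inl k)) := by
      ext k; simp
    rw [entry, entry, h1, h2]; rfl

lemma entry_zz (i : Mode n) (R : Op n) (p : Mode n → ℕ) :
    entry (zz i R) p = (Real.sqrt (p i) : ℂ) * entry R (p - Pi.single i 1) := by
  rcases i with j | j
  · have h1 : (fun k => (p - Pi.single (Sum.inl j) 1 : Mode n → ℕ) (Sum.inl k)) =
        (fun k => p (Sum.inl k)) - Pi.single j 1 := by
      ext k; simp [Pi.single_apply]
    have h2 : (fun k => (p - Pi.single (Sum.inl j) 1 : Mode n → ℕ) (Sum.inr k)) =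
        (fun k => p (Sum.inr k)) := by
      ext k; simp
    rw [entry, entry, h1, h2]; rfl
  · have h1 : (fun k => (p - Pi.single (Sum.inr j) 1 : Mode n → ℕ) (Sum.inr k)) =
        (fun k => p (Sum.inr k)) - Pi.single j 1 := by
      ext k; simp [Pi.single_apply]
    have h2 : (fun k => (p - Pi.single (Sum.inr j) 1 : Mode n → ℕ) (Sum.inl k)) =
        (fun k => p (Sum.inl k)) := by
      ext k; simp
    rw [entry, entry, h1, h2]; rfl

@[simp] lemma entry_add (R R' : Op n) (p : Mode n → ℕ) :
    entry (R + R') p = entry R p + entry R' p := rfl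

@[simp] lemma entry_sub (R R' : Op n) (p : Mode n → ℕ) :
    entry (R - R') p = entry R p - entry R' p := rfl

@[simp] lemma entry_smul (c : ℂ) (R : Op n) (p : Mode n → ℕ) :
    entry (c • R) p = c * entry R p := rfl

@[simp] lemma entry_zero (p : Mode n → ℕ) : entry (0 : Op n) p = 0 := rfl

lemma entry_sum {ι : Type*} (s : Finset ι) (R : ι → Op n) (p : Mode n → ℕ) :
    entry (∑ i ∈ s, R i) p = ∑ i ∈ s, entry (R i) p := by
  simp [entry, Matrix.sum_apply]

/-- Each ladder super-operator reads a single matrix element, so the canonical commutation relations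
hold on all matrices, with no convergence assumption. -/
lemma dz_mul_dz (i k : Mode n) : dz i * dz k = dz k * dz i := by
  ext1 R
  apply entry_ext
  intro p
  simp only [Module.End.mul_apply, entry_dz]
  by_cases h : i = k
  · rw [h]
  · rw [add_right_comm]
    simp [h, Ne.symm h]
    ring

lemma zz_mul_zz (i k : Mode n) : zz i * zz k = zz k * zz i := by
  ext1 R
  apply entry_ext
  intro p
  simp only [Module.End.mul_apply, entry_zz]
  by_cases h : i = k
  · rw [h]
  · rw [tsub_right_comm]
    simp [h, Ne.symm h]
    ring

lemma dz_mul_zz (i k : Mode n) :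
    dz i * zz k = zz k * dz i + (if i = k then (1 : ℂ) else 0) • 1 := by
  ext1 R
  apply entry_ext
  intro p
  simp only [Module.End.mul_apply, LinearMap.add_apply, LinearMap.smul_apply, entry_add,
    entry_smul, entry_dz, entry_zz, Module.End.one_apply]
  by_cases h : i = k
  · subst h
    simp only [if_true, one_mul, Pi.add_apply, Pi.single_eq_same, add_tsub_cancel_right,
      Pi.sub_apply]
    -- For `p i = 0` the subtraction in `zz` is truncated, but there the prefactor √(p i) vanishes.
    rcases Nat.eq_zero_or_pos (p i) with h0 | h0
    · simp [h0]
    · have h1 : p - Pi.single i 1 + Pi.single i 1 = p := by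
        apply tsub_add_cancel_of_le
        intro k
        by_cases hk : k = i
        · subst hk; simpa using Nat.succ_le_of_lt h0
        · simp [hk]
      have h2 : ((p i - 1 : ℕ) : ℝ) + 1 = p i := by
        rw [Nat.cast_sub h0]; simp
      rw [h1, h2]
      have e1 : (Real.sqrt (p i + 1) : ℂ) * Real.sqrt (p i + 1) = (p i : ℂ) + 1 := by
        rw [← Complex.ofReal_mul, Real.mul_self_sqrt (by positivity)]; simp
      have e2 : (Real.sqrt (p i) : ℂ) * Real.sqrt (p i) = (p i : ℂ) := by
        rw [← Complex.ofReal_mul, Real.mul_self_sqrt (by positivity)]; simp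
      push_cast
      linear_combination (entry R p) * e1 - (entry R p) * e2
  · have h1 : p + Pi.single i 1 - Pi.single k 1 = p - Pi.single k 1 + Pi.single i 1 := by
      ext m
      by_cases hm : m = i
      · subst hm; simp [h]
      · simp [Pi.single_apply, hm]
    rw [h1]
    simp [h, Ne.symm h]
    ring

/-- The derivatives with respect to the phase-space coordinates. -/
def DD : Mode n → SuperOp n
  | Sum.inl j => (1 / (Real.sqrt 2 : ℂ)) • (dz (Sum.inl j) + dz (Sum.inr j))
  | Sum.inr j => (Complex.I / (Real.sqrt 2 : ℂ)) • (dz (Sum.inl j) - dz (Sum.inr j))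

/-- The multiplications by the phase-space coordinates. -/
def XX : Mode n → SuperOp n
  | Sum.inl j => (1 / (Real.sqrt 2 : ℂ)) • (zz (Sum.inl j) + zz (Sum.inr j))
  | Sum.inr j => (Complex.I / (Real.sqrt 2 : ℂ)) • (zz (Sum.inr j) - zz (Sum.inl j))

lemma sqrt_two_mul_self_complex : (Real.sqrt 2 : ℂ) * (Real.sqrt 2 : ℂ) = 2 := by
  rw [← Complex.ofReal_mul, Real.mul_self_sqrt (by norm_num)]; simp

lemma sqrt_two_ne_zero_complex : (Real.sqrt 2 : ℂ) ≠ 0 := by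
  intro h
  have := sqrt_two_mul_self_complex
  rw [h] at this
  norm_num at this

lemma one_div_sqrt_two_mul_self : (1 / (Real.sqrt 2 : ℂ)) * (1 / (Real.sqrt 2 : ℂ)) = 1 / 2 := by
  rw [div_mul_div_comm, sqrt_two_mul_self_complex, one_mul]

lemma DD_mul_DD (μ ν : Mode n) : DD μ * DD ν = DD ν * DD μ := by
  rcases μ with i | i <;> rcases ν with k | k <;>
  · simp only [DD, smul_mul_smul_comm, mul_add, add_mul, mul_sub, sub_mul]
    rw [dz_mul_dz (Sum.inl i) (Sum.inl k), dz_mul_dz (Sum.inl i) (Sum.inr k),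
      dz_mul_dz (Sum.inr i) (Sum.inl k), dz_mul_dz (Sum.inr i) (Sum.inr k)]
    module

lemma XX_mul_XX (μ ν : Mode n) : XX μ * XX ν = XX ν * XX μ := by
  rcases μ with i | i <;> rcases ν with k | k <;>
  · simp only [XX, smul_mul_smul_comm, mul_add, add_mul, mul_sub, sub_mul]
    rw [zz_mul_zz (Sum.inl i) (Sum.inl k), zz_mul_zz (Sum.inl i) (Sum.inr k),
      zz_mul_zz (Sum.inr i) (Sum.inl k), zz_mul_zz (Sum.inr i) (Sum.inr k)]
    module

/-- The `Sum.inr` components of `DD` and `XX` carry opposite signs. This compensates I * I = -1, so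
that coordinates and derivatives are dual. -/
lemma DD_mul_XX (μ ν : Mode n) :
    DD μ * XX ν = XX ν * DD μ + (if μ = ν then (1 : ℂ) else 0) • 1 := by
  have hI := Complex.I_mul_I
  rcases μ with i | i <;> rcases ν with k | k <;>
  · simp only [DD, XX, smul_mul_smul_comm, mul_add, add_mul, mul_sub,
      sub_mul]
    rw [dz_mul_zz (Sum.inl i) (Sum.inl k), dz_mul_zz (Sum.inl i) (Sum.inr k),
      dz_mul_zz (Sum.inr i) (Sum.inl k), dz_mul_zz (Sum.inr i) (Sum.inr k)]
    simp only [div_mul_div_comm, sqrt_two_mul_self_complex, one_mul, mul_one, hI]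
    by_cases h : i = k
    · simp only [h, reduceCtorEq, if_true, if_false]; module
    · simp only [Sum.inl.injEq, Sum.inr.injEq, h, reduceCtorEq, if_false]; module

/-- Together with `bOp'_eq` this reduces all commutators of b and b' to `DD_mul_XX`: in [b, b] and
[b', b'] the two Kronecker terms cancel, in [b, b'] they add up. -/
lemma bOp_eq (μ : Mode n) : bOp μ = (1 / (Real.sqrt 2 : ℂ)) • (DD μ + XX μ) := by
  rcases μ with i | i
  · simp only [bOp, wL, wR, DD, XX, dz, zz, ← smul_add, smul_smul]
    congr 1
    abel
  · simp only [bOp, wL, wR, DD, XX, dz, zz, ← smul_add, smul_smul]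
    congr 1
    abel

lemma I_div_sqrt_two : Complex.I / (Real.sqrt 2 : ℂ) = Complex.I * (1 / (Real.sqrt 2 : ℂ)) := by
  rw [mul_one_div]

lemma bOp'_eq (μ : Mode n) : bOp' μ = (1 / (Real.sqrt 2 : ℂ)) • (XX μ - DD μ) := by
  rcases μ with i | i <;>
  · simp only [bOp', wL, wR, DD, XX, dz, zz, neg_div, I_div_sqrt_two]
    generalize 1 / (Real.sqrt 2 : ℂ) = s
    match_scalars <;> ring_nf <;> simp only [Complex.I_sq] <;> ring

lemma bOp_mul_bOp (μ ν : Mode n) : bOp μ * bOp ν = bOp ν * bOp μ := by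
  simp only [bOp_eq, smul_mul_assoc, mul_smul_comm, mul_add, add_mul]
  rw [DD_mul_DD μ ν, XX_mul_XX μ ν, DD_mul_XX μ ν, DD_mul_XX ν μ]
  simp only [eq_comm (a := ν) (b := μ)]
  module

lemma bOp'_mul_bOp' (μ ν : Mode n) : bOp' μ * bOp' ν = bOp' ν * bOp' μ := by
  simp only [bOp'_eq, smul_mul_assoc, mul_smul_comm, mul_sub, sub_mul]
  rw [DD_mul_DD μ ν, XX_mul_XX μ ν, DD_mul_XX μ ν, DD_mul_XX ν μ]
  simp only [eq_comm (a := ν) (b := μ)]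
  module

lemma bOp_mul_bOp' (μ ν : Mode n) :
    bOp μ * bOp' ν = bOp' ν * bOp μ + (if μ = ν then (1 : ℂ) else 0) • 1 := by
  simp only [bOp_eq, bOp'_eq, smul_mul_smul_comm, one_div_sqrt_two_mul_self, mul_sub, sub_mul,
    mul_add, add_mul]
  rw [DD_mul_DD μ ν, XX_mul_XX μ ν, DD_mul_XX μ ν, DD_mul_XX ν μ]
  simp only [eq_comm (a := ν) (b := μ)]
  module

/-! ### The Liouvillian in terms of the ladder super-operators -/

/-- `(w_μ R - R w_μ)/√2`. -/
def cOp (μ : Mode n) : SuperOp n := (1 / (Real.sqrt 2 : ℂ)) • (wL μ - wR μ)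

/-- The exchange of ± with the factors ±i in `bOp'` is the action of τ, so every commutator with a
Majorana operator is linear in `bOp'`. -/
lemma cOp_eq (μ : Mode n) : cOp μ = -∑ ν, tau n μ ν • bOp' ν := by
  have hI := Complex.I_mul_I
  rcases μ with i | i
  · simp [tau, cOp, bOp', Fintype.sum_sum_type, Matrix.one_apply, smul_smul, div_eq_mul_inv,
      ← mul_assoc, hI]
  · simp [tau, cOp, bOp', Fintype.sum_sum_type, Matrix.one_apply, smul_smul, div_eq_mul_inv,
      ← mul_assoc, hI]

lemma wL_eq (μ : Mode n) : wL μ = (1 / (Real.sqrt 2 : ℂ)) • (bOp μ + cOp μ) := by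
  rw [bOp, cOp, ← smul_add, smul_smul, one_div_sqrt_two_mul_self]
  module

lemma wR_eq (μ : Mode n) : wR μ = (1 / (Real.sqrt 2 : ℂ)) • (bOp μ - cOp μ) := by
  rw [bOp, cOp, ← SuperOp.smul_sub, smul_smul, one_div_sqrt_two_mul_self]
  module

lemma tau_antisymm (μ ν : Mode n) : tau n ν μ = -tau n μ ν := by
  rcases μ with i | i <;> rcases ν with k | k <;> simp [tau, Matrix.one_apply, eq_comm]

lemma bOp_mul_cOp (μ ν : Mode n) : bOp μ * cOp ν = cOp ν * bOp μ + tau n μ ν • 1 := by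
  have h : ∀ κ, bOp μ * (tau n ν κ • bOp' κ) =
      (tau n ν κ • bOp' κ) * bOp μ + (if μ = κ then tau n ν κ else 0) • 1 := by
    intro κ
    rw [mul_smul_comm, bOp_mul_bOp', smul_add, smul_smul, smul_mul_assoc]
    simp
  rw [cOp_eq, SuperOp.mul_neg, SuperOp.neg_mul, Finset.mul_sum, Finset.sum_mul, Finset.sum_congr rfl fun κ _ => h κ,
    Finset.sum_add_distrib, ← Finset.sum_smul, neg_add]
  simp [tau_antisymm μ ν]

lemma cOp_mul_cOp (μ ν : Mode n) : cOp μ * cOp ν = cOp ν * cOp μ := by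
  simp only [cOp_eq, SuperOp.mul_neg, SuperOp.neg_mul, SuperOp.neg_neg, Finset.sum_mul_sum, smul_mul_smul_comm]
  rw [Finset.sum_comm]
  refine Finset.sum_congr rfl fun κ _ => Finset.sum_congr rfl fun κ' _ => ?_
  rw [bOp'_mul_bOp', mul_comm]

/-- The b commute and the c commute, so only mixed products survive. Moving c to the left costs τ_μν
and τ_νμ, which cancel. -/
lemma wL_wL_sub_wR_wR (μ ν : Mode n) :
    wL μ * wL ν - wR ν * wR μ = cOp μ * bOp ν + cOp ν * bOp μ := by
  simp only [wL_eq, wR_eq, smul_mul_smul_comm, one_div_sqrt_two_mul_self, mul_add, add_mul,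
    mul_sub, sub_mul]
  rw [bOp_mul_bOp μ ν, bOp_mul_cOp μ ν, bOp_mul_cOp ν μ, cOp_mul_cOp μ ν, tau_antisymm μ ν]
  module

/-- Every term has a `cOp` on the left, which expresses trace preservation. -/
lemma dissipator_term (μ ν : Mode n) :
    wL μ * wR ν - (1 / 2 : ℂ) • (wL ν * wL μ + wR μ * wR ν) =
      (1 / 2 : ℂ) • (cOp μ * bOp ν - cOp ν * bOp μ) - cOp μ * cOp ν := by
  simp only [wL_eq, wR_eq, smul_mul_smul_comm, one_div_sqrt_two_mul_self, mul_add, add_mul,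
    mul_sub, sub_mul]
  rw [bOp_mul_bOp μ ν, bOp_mul_cOp μ ν, bOp_mul_cOp ν μ, cOp_mul_cOp μ ν, tau_antisymm μ ν]
  module

lemma System.B_apply (sys : System n) (μ ν : Mode n) :
    sys.B μ ν = ∑ r, sys.L r μ * star (sys.L r ν) := by
  simp [System.B, Matrix.sum_apply, Matrix.vecMulVec_apply]

lemma System.B_star (sys : System n) (μ ν : Mode n) : star (sys.B μ ν) = sys.B ν μ := by
  simp [System.B_apply, mul_comm]

/-- The symmetry of `H` merges the two orders of c and b into a factor 2. In the dissipator, the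
antisymmetric c b part selects the imaginary part of the Hermitian matrix `B`, and the symmetric c c
part its real part. -/
lemma System.liouvillian_eq_cOp (sys : System n) :
    sys.liouvillian = ∑ μ, ∑ ν, ((-2 * Complex.I * sys.H μ ν + Complex.I * sys.Bi μ ν) •
      (cOp μ * bOp ν) - (sys.Br μ ν : ℂ) • (cOp μ * cOp ν)) := by
  have hH : sys.hamL - sys.hamR = ∑ μ, ∑ ν, (2 * sys.H μ ν : ℂ) • (cOp μ * bOp ν) := by
    have h1 : sys.hamL - sys.hamR =
        ∑ μ, ∑ ν, (sys.H μ ν : ℂ) • (cOp μ * bOp ν + cOp ν * bOp μ) := by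
      simp only [System.hamL, System.hamR, ← Finset.sum_sub_distrib,
        ← SuperOp.smul_sub, wL_wL_sub_wR_wR]
    have h2 : ∑ μ, ∑ ν, (sys.H μ ν : ℂ) • (cOp ν * bOp μ) =
        ∑ μ, ∑ ν, (sys.H μ ν : ℂ) • (cOp (n := n) μ * bOp ν) := by
      rw [Finset.sum_comm]
      refine Finset.sum_congr rfl fun κ _ => Finset.sum_congr rfl fun κ' _ => ?_
      rw [sys.H_symm.apply]
    simp only [h1, smul_add, Finset.sum_add_distrib, h2]
    simp only [← Finset.sum_add_distrib]
    refine Finset.sum_congr rfl fun κ _ => Finset.sum_congr rfl fun κ' _ => ?_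
    module
  have hD : ∑ r, (linL (sys.L r) * linR (star (sys.L r))
        - (1 / 2 : ℂ) • (linL (star (sys.L r)) * linL (sys.L r)
            + linR (sys.L r) * linR (star (sys.L r)))) =
      ∑ μ, ∑ ν, sys.B μ ν •
        ((1 / 2 : ℂ) • (cOp μ * bOp ν - cOp ν * bOp μ) - cOp μ * cOp ν) := by
    have h1 : ∀ r, (linL (sys.L r) * linR (star (sys.L r))
        - (1 / 2 : ℂ) • (linL (star (sys.L r)) * linL (sys.L r)
            + linR (sys.L r) * linR (star (sys.L r)))) =
        ∑ μ, ∑ ν, (sys.L r μ * star (sys.L r ν)) •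
        ((1 / 2 : ℂ) • (cOp μ * bOp ν - cOp ν * bOp μ) - cOp μ * cOp ν) := by
      intro r
      have e : linL (star (sys.L r)) * linL (sys.L r) = ∑ μ, ∑ ν,
          (sys.L r μ * star (sys.L r ν)) • (wL ν * wL μ) := by
        simp only [linL, Finset.sum_mul_sum, smul_mul_smul_comm, Pi.star_apply]
        rw [Finset.sum_comm]
        simp only [mul_comm]
      rw [e]
      simp only [linL, linR, Finset.sum_mul_sum, smul_mul_smul_comm, Pi.star_apply,
        ← Finset.sum_add_distrib, Finset.smul_sum, ← Finset.sum_sub_distrib, ← dissipator_term]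
      refine Finset.sum_congr rfl fun κ _ => Finset.sum_congr rfl fun κ' _ => ?_
      module
    simp only [h1, System.B_apply, Finset.sum_smul]
    rw [Finset.sum_comm]
    refine Finset.sum_congr rfl fun κ _ => ?_
    rw [Finset.sum_comm]
  rw [System.liouvillian, hH, hD]
  have hB : ∑ μ, ∑ ν, sys.B μ ν •
        ((1 / 2 : ℂ) • (cOp μ * bOp ν - cOp ν * bOp μ) - cOp (n := n) μ * cOp ν) =
      ∑ μ, ∑ ν, ((Complex.I * sys.Bi μ ν) • (cOp μ * bOp ν) -
        (sys.Br μ ν : ℂ) • (cOp μ * cOp ν)) := by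
    -- Exchanging the summation indices conjugates `B`, because `B` is Hermitian.
    have e1 : ∑ μ, ∑ ν, sys.B μ ν • (cOp (n := n) ν * bOp μ) =
        ∑ μ, ∑ ν, star (sys.B μ ν) • (cOp (n := n) μ * bOp ν) := by
      rw [Finset.sum_comm]
      simp only [System.B_star]
    have e2 : ∑ μ, ∑ ν, sys.B μ ν • (cOp (n := n) μ * cOp ν) =
        ∑ μ, ∑ ν, star (sys.B μ ν) • (cOp (n := n) μ * cOp ν) := by
      rw [Finset.sum_comm]
      simp only [System.B_star]
      refine Finset.sum_congr rfl fun κ _ => Finset.sum_congr rfl fun κ' _ => ?_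
      rw [cOp_mul_cOp]
    have e3 : ∑ μ, ∑ ν, sys.B μ ν • (cOp (n := n) μ * cOp ν) =
        ∑ μ, ∑ ν, (sys.Br μ ν : ℂ) • (cOp (n := n) μ * cOp ν) := by
      have : ∀ μ ν, (sys.Br μ ν : ℂ) = (1 / 2 : ℂ) * (sys.B μ ν + star (sys.B μ ν)) := by
        intro μ ν
        simp only [System.Br, Matrix.map_apply, Complex.re_eq_add_conj, Complex.star_def]
        ring
      simp only [this, mul_smul, add_smul, ← Finset.smul_sum, Finset.sum_add_distrib, ← e2]
      module
    have e4 : ∀ μ ν, Complex.I * (sys.Bi μ ν : ℂ) =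
        (1 / 2 : ℂ) * (sys.B μ ν - star (sys.B μ ν)) := by
      intro μ ν
      simp only [System.Bi, Matrix.map_apply, Complex.im_eq_sub_conj, Complex.star_def]
      field_simp
    simp only [smul_sub, Finset.sum_sub_distrib, e3, e4, smul_comm (sys.B _ _),
      ← Finset.smul_sum, e1, mul_smul, sub_smul]
  rw [hB, Finset.smul_sum, ← Finset.sum_add_distrib]
  refine Finset.sum_congr rfl fun κ _ => ?_
  rw [Finset.smul_sum, ← Finset.sum_add_distrib]
  refine Finset.sum_congr rfl fun κ' _ => ?_
  module

lemma tau_mul_tau : tau n * tau n = 1 := by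
  simp [tau, Matrix.fromBlocks_multiply, smul_smul, Matrix.fromBlocks_one]

/-- The quadratic super-operator `fᵀ M g`. -/
def bil {ι κ : Type*} [Fintype ι] [Fintype κ] (M : Matrix ι κ ℂ) (f : ι → SuperOp n)
    (g : κ → SuperOp n) : SuperOp n := ∑ i, ∑ k, M i k • (f i * g k)

section bil
variable {ι κ ι' : Type*} [Fintype ι] [Fintype κ] [Fintype ι']

lemma bil_left (M : Matrix ι κ ℂ) (A : Matrix ι ι' ℂ) (f : ι' → SuperOp n) (g : κ → SuperOp n) :
    bil M (fun i => ∑ j, A i j • f j) g = bil (Aᵀ * M) f g := by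
  simp only [bil, Finset.sum_mul, Finset.smul_sum, Matrix.mul_apply, Finset.sum_smul,
    smul_mul_assoc, smul_smul, Matrix.transpose_apply]
  calc _ = ∑ i, ∑ j, ∑ k, (M i k * A i j) • (f j * g k) :=
        Finset.sum_congr rfl fun i _ => Finset.sum_comm
    _ = ∑ j, ∑ i, ∑ k, (M i k * A i j) • (f j * g k) := Finset.sum_comm
    _ = ∑ j, ∑ k, ∑ i, (M i k * A i j) • (f j * g k) :=
        Finset.sum_congr rfl fun i _ => Finset.sum_comm
    _ = _ := by simp only [mul_comm]

lemma bil_right (M : Matrix ι κ ℂ) (A : Matrix κ ι' ℂ) (f : ι → SuperOp n) (g : ι' → SuperOp n) :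
    bil M f (fun i => ∑ j, A i j • g j) = bil (M * A) f g := by
  simp only [bil, Finset.mul_sum, Finset.smul_sum, Matrix.mul_apply, Finset.sum_smul,
    mul_smul_comm, smul_smul]
  exact Finset.sum_congr rfl fun i _ => Finset.sum_comm

lemma bil_add (M N : Matrix ι κ ℂ) (f : ι → SuperOp n) (g : κ → SuperOp n) :
    bil (M + N) f g = bil M f g + bil N f g := by
  simp only [bil, ← Finset.sum_add_distrib, Matrix.add_apply, add_smul]

lemma bil_add_right (M : Matrix ι κ ℂ) (f : ι → SuperOp n) (g g' : κ → SuperOp n) :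
    bil M f (fun k => g k + g' k) = bil M f g + bil M f g' := by
  simp only [bil, ← Finset.sum_add_distrib, mul_add, smul_add]

/-- A quadratic form in commuting operators sees only the symmetric part of its matrix. -/
lemma bil_transpose (M : Matrix ι ι ℂ) (f : ι → SuperOp n) (hf : ∀ i k, f i * f k = f k * f i) :
    bil Mᵀ f f = bil M f f := by
  simp only [bil, Matrix.transpose_apply]
  rw [Finset.sum_comm]
  exact Finset.sum_congr rfl fun i _ => Finset.sum_congr rfl fun k _ => by rw [hf]

end bil

lemma tau_transpose : (tau n)ᵀ = -tau n := by
  ext μ ν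
  simp [tau_antisymm μ ν]

lemma cOp_eq_sum : cOp (n := n) = fun μ => ∑ ν, (-tau n) μ ν • bOp' ν := by
  funext μ
  rw [cOp_eq, ← Finset.sum_neg_distrib]
  exact Finset.sum_congr rfl fun ν _ => (neg_smul (tau n μ ν) (bOp' ν)).symm

/-- Substituting c = -τb' multiplies the coefficient matrices by (-τ)ᵀ = τ on the left, and for c c
also by -τ on the right. This produces `X₀` and `Y`. -/
lemma System.liouvillian_eq_bOp (sys : System n) :
    sys.liouvillian = bil sys.X₀ bOp' bOp + bil sys.Y bOp' bOp' := by
  have h1 : sys.liouvillian = bil ((-2 * Complex.I) • toC sys.H + Complex.I • toC sys.Bi) cOp bOp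
      + bil (-toC sys.Br) cOp cOp := by
    rw [sys.liouvillian_eq_cOp, bil, bil]
    simp only [← Finset.sum_add_distrib]
    refine Finset.sum_congr rfl fun μ _ => Finset.sum_congr rfl fun ν _ => ?_
    simp only [toC, Matrix.add_apply, Matrix.smul_apply, Matrix.map_apply, Matrix.neg_apply,
      smul_eq_mul]
    module
  rw [h1]
  nth_rw 1 [cOp_eq_sum]
  rw [bil_left, cOp_eq_sum, bil_left, bil_right]
  congr 2
  · simp [tau_transpose, System.X₀, mul_add]
  · simp [tau_transpose, System.Y]

lemma JordanForm.d'_eq {X : Matrix (Mode n) (Mode n) ℂ} (J : JordanForm X) :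
    J.d' = fun p => ∑ μ, J.Sᵀ p μ • bOp' μ := rfl

lemma JordanForm.bOp'_eq_d' {X : Matrix (Mode n) (Mode n) ℂ} (J : JordanForm X) :
    bOp' = fun μ => ∑ p, J.Sinvᵀ μ p • J.d' p := by
  funext μ
  have h : J.Sinvᵀ * J.Sᵀ = 1 := by rw [← Matrix.transpose_mul, J.S_mul_Sinv, Matrix.transpose_one]
  simp only [JordanForm.d'_eq, Finset.smul_sum, smul_smul]
  rw [Finset.sum_comm]
  simp only [← Finset.sum_smul, ← Matrix.mul_apply, h]
  simp [Matrix.one_apply]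

/-- `b - 2 Γ b'`. -/
def eOp (Γ : Matrix (Mode n) (Mode n) ℝ) (μ : Mode n) : SuperOp n :=
  bOp μ - (2 : ℂ) • ∑ ν, (Γ μ ν : ℂ) • bOp' ν

lemma JordanForm.d_eq {X : Matrix (Mode n) (Mode n) ℂ} (J : JordanForm X)
    (Γ : Matrix (Mode n) (Mode n) ℝ) : J.d Γ = fun p => ∑ μ, J.Sinv p μ • eOp Γ μ := rfl

lemma JordanForm.eOp_eq_d {X : Matrix (Mode n) (Mode n) ℂ} (J : JordanForm X)
    (Γ : Matrix (Mode n) (Mode n) ℝ) : eOp Γ = fun μ => ∑ p, J.S μ p • J.d Γ p := by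
  funext μ
  simp only [JordanForm.d_eq, Finset.smul_sum, smul_smul]
  rw [Finset.sum_comm]
  simp only [← Finset.sum_smul, ← Matrix.mul_apply, J.S_mul_Sinv]
  simp [Matrix.one_apply]

lemma bOp_eq_eOp (Γ : Matrix (Mode n) (Mode n) ℝ) :
    bOp = fun μ => eOp Γ μ + ∑ ν, ((2 : ℂ) • toC Γ) μ ν • bOp' ν := by
  funext μ
  simp only [eOp, toC, Matrix.smul_apply, Matrix.map_apply, smul_eq_mul, mul_smul,
    Finset.smul_sum, sub_add_cancel]

lemma toC_transpose_of_isSymm {Γ : Matrix (Mode n) (Mode n) ℝ} (hΓ : Γ.IsSymm) :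
    (toC Γ)ᵀ = toC Γ := by
  ext μ ν
  simp [toC, hΓ.apply]

/-- Inserting b = e + 2Γb' creates a b' b' term with matrix 2X₀Γ + Y. Its symmetric part X₀Γ + ΓX₀ᵀ
+ Y vanishes by the Lyapunov equation, and the b' commute, so the whole term drops out. -/
lemma System.liouvillian_eq_eOp (sys : System n) {Γ : Matrix (Mode n) (Mode n) ℝ}
    (hΓ : Γ.IsSymm) (hL : sys.SolvesLyapunov Γ) :
    sys.liouvillian = bil sys.X₀ bOp' (eOp Γ) := by
  rw [sys.liouvillian_eq_bOp, bOp_eq_eOp Γ, bil_add_right, bil_right, add_assoc, ← bil_add]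
  suffices h : bil (sys.X₀ * (2 : ℂ) • toC Γ + sys.Y) bOp' bOp' = 0 by rw [h, add_zero]
  have h1 := bil_transpose (sys.X₀ * toC Γ) bOp' bOp'_mul_bOp'
  rw [Matrix.transpose_mul, toC_transpose_of_isSymm hΓ] at h1
  have h2 : sys.X₀ * (2 : ℂ) • toC Γ + sys.Y =
      sys.X₀ * toC Γ + (sys.X₀ * toC Γ + sys.Y) := by
    rw [Matrix.mul_smul, two_smul, add_assoc]
  rw [h2, bil_add, ← h1, ← bil_add]
  have h3 : toC Γ * sys.X₀ᵀ + (sys.X₀ * toC Γ + sys.Y) = 0 := by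
    have := hL
    unfold System.SolvesLyapunov at this
    rw [← add_assoc, add_comm (toC Γ * _), this, neg_add_cancel]
  rw [h3]
  simp [bil]

/-- e and b' transform contragrediently, so the coefficient matrix undergoes the similarity
transformation to its Jordan form. -/
lemma System.liouvillian_eq_d (sys : System n) {Γ : Matrix (Mode n) (Mode n) ℝ}
    (hΓ : Γ.IsSymm) (hL : sys.SolvesLyapunov Γ) (J : JordanForm sys.X₀) :
    sys.liouvillian = bil (J.Sinv * sys.X₀ * J.S) J.d' (J.d Γ) := by
  rw [sys.liouvillian_eq_eOp hΓ hL, J.bOp'_eq_d', J.eOp_eq_d, bil_right, bil_left,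
    Matrix.transpose_transpose, ← Matrix.mul_assoc]

lemma eOp_mul_bOp' (Γ : Matrix (Mode n) (Mode n) ℝ) (μ ν : Mode n) :
    eOp Γ μ * bOp' ν = bOp' ν * eOp Γ μ + (if μ = ν then (1 : ℂ) else 0) • 1 := by
  simp only [eOp, sub_mul, mul_sub, smul_mul_assoc, mul_smul_comm, Finset.sum_mul, Finset.mul_sum,
    bOp_mul_bOp' μ ν, bOp'_mul_bOp' ν]
  module

/-- The two cross commutators are -2Γ_νμ and 2Γ_μν; they cancel for symmetric Γ. -/
lemma eOp_mul_eOp {Γ : Matrix (Mode n) (Mode n) ℝ} (hΓ : Γ.IsSymm) (μ ν : Mode n) :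
    eOp Γ μ * eOp Γ ν = eOp Γ ν * eOp Γ μ := by
  have h : ∀ μ ν, bOp μ * ∑ κ, (Γ ν κ : ℂ) • bOp' κ =
      (∑ κ, (Γ ν κ : ℂ) • bOp' κ) * bOp μ + (Γ ν μ : ℂ) • 1 := by
    intro μ ν
    simp only [Finset.mul_sum, Finset.sum_mul, mul_smul_comm, smul_mul_assoc, bOp_mul_bOp',
      smul_add, Finset.sum_add_distrib]
    simp only [ite_smul, one_smul, zero_smul, smul_ite, smul_zero, Finset.sum_ite_eq,
      Finset.mem_univ, if_true]
  have h' : (∑ κ, (Γ μ κ : ℂ) • bOp' κ) * (∑ κ, (Γ ν κ : ℂ) • bOp' κ) =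
      (∑ κ, (Γ ν κ : ℂ) • bOp' κ) * (∑ κ, (Γ μ κ : ℂ) • bOp' (n := n) κ) := by
    simp only [Finset.sum_mul_sum, smul_mul_smul_comm]
    rw [Finset.sum_comm]
    refine Finset.sum_congr rfl fun i _ => Finset.sum_congr rfl fun k _ => ?_
    rw [bOp'_mul_bOp', mul_comm]
  simp only [eOp, sub_mul, mul_sub, smul_mul_assoc, mul_smul_comm]
  rw [h μ ν, h ν μ, h', bOp_mul_bOp μ ν, hΓ.apply]
  module

namespace JordanForm
variable {X : Matrix (Mode n) (Mode n) ℂ} (J : JordanForm X) {Γ : Matrix (Mode n) (Mode n) ℝ}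

lemma d_mul_d (hΓ : Γ.IsSymm) (p q : J.Idx) : J.d Γ p * J.d Γ q = J.d Γ q * J.d Γ p := by
  simp only [d_eq, Finset.sum_mul_sum, smul_mul_smul_comm]
  rw [Finset.sum_comm]
  refine Finset.sum_congr rfl fun i _ => Finset.sum_congr rfl fun k _ => ?_
  rw [eOp_mul_eOp hΓ, mul_comm]

lemma d'_mul_d' (p q : J.Idx) : J.d' p * J.d' q = J.d' q * J.d' p := by
  simp only [d'_eq, Finset.sum_mul_sum, smul_mul_smul_comm]
  rw [Finset.sum_comm]
  refine Finset.sum_congr rfl fun i _ => Finset.sum_congr rfl fun k _ => ?_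
  rw [bOp'_mul_bOp', mul_comm]

lemma d_mul_d' (Γ : Matrix (Mode n) (Mode n) ℝ) (p q : J.Idx) :
    J.d Γ p * J.d' q = J.d' q * J.d Γ p + (if p = q then (1 : ℂ) else 0) • 1 := by
  simp only [d_eq, d'_eq, Finset.sum_mul_sum, smul_mul_smul_comm, eOp_mul_bOp', smul_add,
    Finset.sum_add_distrib]
  congr 1
  · rw [Finset.sum_comm]
    simp only [mul_comm]
  · simp only [smul_smul, ← Finset.sum_smul, mul_ite, mul_one, mul_zero, Finset.sum_ite_eq,
      Finset.mem_univ, if_true, Matrix.transpose_apply, ← Matrix.mul_apply, J.Sinv_mul_S,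
      Matrix.one_apply]

end JordanForm

/-! ### Rapidly decreasing operators and their traces -/

/-- Every finite set of multi-indices lies in a product of finite sets, on which the sum factorizes.
-/
lemma summable_pi_prod {ι κ : Type*} [Fintype ι] {g : ι → κ → ℝ}
    (h0 : ∀ i k, 0 ≤ g i k) (hg : ∀ i, Summable (g i)) :
    Summable (fun p : ι → κ => ∏ i, g i (p i)) ∧
      ∑' p : ι → κ, ∏ i, g i (p i) ≤ ∏ i, ∑' k, g i k := by
  classical
  have hb : ∀ F : Finset (ι → κ), ∑ p ∈ F, ∏ i, g i (p i) ≤ ∏ i, ∑' k, g i k := by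
    intro F
    calc ∑ p ∈ F, ∏ i, g i (p i)
        ≤ ∑ p ∈ Fintype.piFinset (fun i => F.image (fun p => p i)), ∏ i, g i (p i) := by
          refine Finset.sum_le_sum_of_subset_of_nonneg ?_ fun p _ _ =>
            Finset.prod_nonneg fun i _ => h0 i _
          intro p hp
          rw [Fintype.mem_piFinset]
          exact fun i => Finset.mem_image_of_mem _ hp
      _ = ∏ i, ∑ k ∈ F.image (fun p => p i), g i k := by rw [Finset.prod_univ_sum]
      _ ≤ _ := Finset.prod_le_prod (fun i _ => Finset.sum_nonneg fun k _ => h0 i k)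
          fun i _ => (hg i).sum_le_tsum _ fun k _ => h0 i k
  have hs := summable_of_sum_le (f := fun p : ι → κ => ∏ i, g i (p i))
    (fun p => Finset.prod_nonneg fun i _ => h0 i _) hb
  exact ⟨hs, hs.tsum_le_of_sum_le hb⟩

/-- The total degree of a multi-index. -/
def deg {ι : Type*} [Fintype ι] (p : ι → ℕ) : ℕ := ∑ i, p i

lemma deg_add_single {ι : Type*} [Fintype ι] [DecidableEq ι] (p : ι → ℕ) (i : ι) :
    deg (p + Pi.single i 1) = deg p + 1 := by
  simp [deg, Finset.sum_add_distrib]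

lemma sub_single_add_single {ι : Type*} [DecidableEq ι] {p : ι → ℕ} {i : ι} (h : p i ≠ 0) :
    p - Pi.single i 1 + Pi.single i 1 = p := by
  apply tsub_add_cancel_of_le
  intro k
  by_cases hk : k = i
  · subst hk; simpa using Nat.one_le_iff_ne_zero.mpr h
  · simp [hk]

lemma le_deg {ι : Type*} [Fintype ι] (p : ι → ℕ) (i : ι) : p i ≤ deg p :=
  Finset.single_le_sum (f := p) (fun _ _ => Nat.zero_le _) (Finset.mem_univ i)

lemma isRapidlyDecreasing_iff (R : Op n) :
    IsRapidlyDecreasing R ↔ ∀ k : ℕ, ∃ C : ℝ, ∀ p, (1 + (deg p : ℝ)) ^ k * ‖entry R p‖ ≤ C := by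
  refine forall_congr' fun k => exists_congr fun C => ⟨fun h p => ?_, fun h α β => ?_⟩
  · have := h (fun j => p (Sum.inl j)) (fun j => p (Sum.inr j))
    simpa [entry, deg, Fintype.sum_sum_type, add_assoc] using this
  · have := h (Sum.elim α β)
    simpa [entry, deg, Fintype.sum_sum_type, add_assoc] using this

variable (n) in
/-- The space of rapidly decreasing operators. -/
def rapid : Submodule ℂ (Op n) where
  carrier := {R | IsRapidlyDecreasing R}
  zero_mem' := fun k => ⟨0, fun α β => by simp⟩
  add_mem' := by
    intro R R' h h'
    rw [Set.mem_ofPred_eq, isRapidlyDecreasing_iff] at *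
    intro k
    obtain ⟨C, hC⟩ := h k
    obtain ⟨C', hC'⟩ := h' k
    refine ⟨C + C', fun p => ?_⟩
    calc (1 + (deg p : ℝ)) ^ k * ‖entry (R + R') p‖
        ≤ (1 + (deg p : ℝ)) ^ k * (‖entry R p‖ + ‖entry R' p‖) := by
          gcongr
          exact norm_add_le _ _
      _ ≤ _ := by rw [mul_add]; exact add_le_add (hC p) (hC' p)
  smul_mem' := by
    intro c R h
    rw [Set.mem_ofPred_eq, isRapidlyDecreasing_iff] at *
    intro k
    obtain ⟨C, hC⟩ := h k
    refine ⟨‖c‖ * C, fun p => ?_⟩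
    rw [entry_smul, norm_mul, mul_left_comm]
    exact mul_le_mul_of_nonneg_left (hC p) (norm_nonneg _)

lemma mem_rapid {R : Op n} : R ∈ rapid n ↔ IsRapidlyDecreasing R := Iff.rfl

lemma norm_sqrt_natCast_le (m : ℕ) : ‖(Real.sqrt m : ℂ)‖ ≤ m := by
  rw [Complex.norm_real, Real.norm_of_nonneg (Real.sqrt_nonneg _)]
  rcases Nat.eq_zero_or_pos m with h | h
  · simp [h]
  · rw [Real.sqrt_le_left (by positivity)]
    have : (1 : ℝ) ≤ m := by exact_mod_cast h
    nlinarith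

lemma norm_entry_dz_le (i : Mode n) (R : Op n) (p : Mode n → ℕ) :
    ‖entry (dz i R) p‖ ≤ (1 + deg p) * ‖entry R (p + Pi.single i 1)‖ := by
  rw [entry_dz, norm_mul]
  gcongr
  have h1 := norm_sqrt_natCast_le (p i + 1)
  have h2 : (p i : ℝ) ≤ deg p := by exact_mod_cast le_deg p i
  push_cast at h1
  linarith

lemma norm_entry_zz_le (i : Mode n) (R : Op n) (p : Mode n → ℕ) :
    ‖entry (zz i R) p‖ ≤ deg p * ‖entry R (p - Pi.single i 1)‖ := by
  rw [entry_zz, norm_mul]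
  gcongr
  have h1 := norm_sqrt_natCast_le (p i)
  have h2 : (p i : ℝ) ≤ deg p := by exact_mod_cast le_deg p i
  linarith

lemma dz_mem_rapid (i : Mode n) {R : Op n} (hR : R ∈ rapid n) : dz i R ∈ rapid n := by
  rw [mem_rapid, isRapidlyDecreasing_iff] at *
  intro k
  obtain ⟨C, hC⟩ := hR (k + 1)
  refine ⟨C, fun p => ?_⟩
  calc (1 + (deg p : ℝ)) ^ k * ‖entry (dz i R) p‖
      ≤ (1 + (deg p : ℝ)) ^ k * ((1 + deg p) * ‖entry R (p + Pi.single i 1)‖) := by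
        gcongr
        exact norm_entry_dz_le i R p
    _ = (1 + (deg p : ℝ)) ^ (k + 1) * ‖entry R (p + Pi.single i 1)‖ := by ring
    _ ≤ (1 + (deg (p + Pi.single i 1) : ℝ)) ^ (k + 1) * ‖entry R (p + Pi.single i 1)‖ := by
        gcongr
        rw [deg_add_single]; simp
    _ ≤ C := hC _

lemma zz_mem_rapid (i : Mode n) {R : Op n} (hR : R ∈ rapid n) : zz i R ∈ rapid n := by
  rw [mem_rapid, isRapidlyDecreasing_iff] at *
  intro k
  obtain ⟨C, hC⟩ := hR (k + 1)
  have hC0 : 0 ≤ C := le_trans (by positivity) (hC 0)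
  -- The constant comes from 1 + deg p ≤ 2 (1 + deg (p - e_i)); the extra power pays for the factor
  -- √(p i).
  refine ⟨2 ^ (k + 1) * C, fun p => ?_⟩
  by_cases h : p i = 0
  · rw [entry_zz, h]
    simp only [Nat.cast_zero, Real.sqrt_zero, Complex.ofReal_zero, zero_mul, norm_zero, mul_zero]
    positivity
  · have hd := deg_add_single (p - Pi.single i 1) i
    rw [sub_single_add_single h] at hd
    calc (1 + (deg p : ℝ)) ^ k * ‖entry (zz i R) p‖
        ≤ (1 + (deg p : ℝ)) ^ k * ((1 + deg p) * ‖entry R (p - Pi.single i 1)‖) := by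
          gcongr
          refine (norm_entry_zz_le i R p).trans ?_
          gcongr
          linarith
      _ = (1 + (deg p : ℝ)) ^ (k + 1) * ‖entry R (p - Pi.single i 1)‖ := by ring
      _ ≤ (2 * (1 + (deg (p - Pi.single i 1) : ℝ))) ^ (k + 1) *
            ‖entry R (p - Pi.single i 1)‖ := by
          gcongr
          rw [hd]; push_cast; linarith [Nat.cast_nonneg (α := ℝ) (deg (p - Pi.single i 1))]
      _ = 2 ^ (k + 1) * ((1 + (deg (p - Pi.single i 1) : ℝ)) ^ (k + 1) *
            ‖entry R (p - Pi.single i 1)‖) := by rw [mul_pow]; ring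
      _ ≤ _ := by gcongr; exact hC _

lemma wL_mem_rapid (μ : Mode n) {R : Op n} (hR : R ∈ rapid n) : wL μ R ∈ rapid n := by
  rcases μ with j | j
  · exact Submodule.smul_mem _ _ (Submodule.add_mem _ (dz_mem_rapid (Sum.inl j) hR)
      (zz_mem_rapid (Sum.inl j) hR))
  · exact Submodule.smul_mem _ _ (Submodule.sub_mem _ (dz_mem_rapid (Sum.inl j) hR)
      (zz_mem_rapid (Sum.inl j) hR))

lemma wR_mem_rapid (μ : Mode n) {R : Op n} (hR : R ∈ rapid n) : wR μ R ∈ rapid n := by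
  rcases μ with j | j
  · exact Submodule.smul_mem _ _ (Submodule.add_mem _ (zz_mem_rapid (Sum.inr j) hR)
      (dz_mem_rapid (Sum.inr j) hR))
  · exact Submodule.smul_mem _ _ (Submodule.sub_mem _ (zz_mem_rapid (Sum.inr j) hR)
      (dz_mem_rapid (Sum.inr j) hR))

variable (n) in
/-- The algebra of super-operators generated by left and right multiplications. -/
abbrev ladderAlg : Subalgebra ℂ (SuperOp n) :=
  Algebra.adjoin ℂ (Set.range (wL (n := n)) ∪ Set.range (wR (n := n)))

variable (n) in
/-- The algebra of left multiplications by polynomial observables. -/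
abbrev leftAlg : Subalgebra ℂ (SuperOp n) := Algebra.adjoin ℂ (Set.range (wL (n := n)))

lemma leftAlg_le : leftAlg n ≤ ladderAlg n := Algebra.adjoin_mono Set.subset_union_left

lemma wL_mem_ladderAlg (μ : Mode n) : wL μ ∈ ladderAlg n :=
  Algebra.subset_adjoin (Or.inl ⟨μ, rfl⟩)

lemma wR_mem_ladderAlg (μ : Mode n) : wR μ ∈ ladderAlg n :=
  Algebra.subset_adjoin (Or.inr ⟨μ, rfl⟩)

lemma ladderAlg_map_mem {P : SuperOp n} (hP : P ∈ ladderAlg n) {V : Submodule ℂ (Op n)}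
    (hL : ∀ μ, ∀ R ∈ V, wL μ R ∈ V) (hR : ∀ μ, ∀ R ∈ V, wR μ R ∈ V) :
    ∀ R ∈ V, P R ∈ V := by
  induction hP using Algebra.adjoin_induction with
  | mem x hx =>
    rcases hx with ⟨μ, rfl⟩ | ⟨μ, rfl⟩
    · exact hL μ
    · exact hR μ
  | algebraMap r => exact fun R h => V.smul_mem r h
  | add x y _ _ hx hy => exact fun R h => V.add_mem (hx R h) (hy R h)
  | mul x y _ _ hx hy => exact fun R h => hx _ (hy R h)

lemma ladderAlg_mem_rapid {P : SuperOp n} (hP : P ∈ ladderAlg n) {R : Op n} (hR : R ∈ rapid n) :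
    P R ∈ rapid n :=
  ladderAlg_map_mem hP (fun μ _ h => wL_mem_rapid μ h) (fun μ _ h => wR_mem_rapid μ h) R hR

lemma summable_diag {R : Op n} (hR : R ∈ rapid n) : Summable fun α => R α α := by
  -- Two powers for each of the `n` modes dominate the diagonal by a product of summable factors
  -- 1/(α_i + 1)².
  obtain ⟨C, hC⟩ := hR (2 * n)
  have h1 := (summable_pi_prod (ι := Fin n) (g := fun _ (a : ℕ) => 1 / ((a : ℝ) + 1) ^ 2)
    (fun _ _ => by positivity) (fun _ => by
      have := (summable_nat_add_iff 1).mpr (Real.summable_one_div_nat_pow.mpr one_lt_two)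
      simpa using this)).1
  refine Summable.of_norm_bounded (h1.mul_left C) fun α => ?_
  rw [Finset.prod_div_distrib, Finset.prod_const_one, mul_one_div,
    le_div_iff₀ (Finset.prod_pos fun i _ => by positivity), mul_comm]
  refine le_trans ?_ (hC α α)
  gcongr
  calc ∏ i, ((α i : ℝ) + 1) ^ 2 ≤ ∏ i : Fin n, (1 + ∑ j, (α j : ℝ) + ∑ j, (α j : ℝ)) ^ 2 := by
        refine Finset.prod_le_prod (fun i _ => by positivity) fun i _ => ?_
        have h2 : (α i : ℝ) ≤ ∑ j, (α j : ℝ) :=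
          Finset.single_le_sum (f := fun j => (α j : ℝ)) (fun _ _ => by positivity)
            (Finset.mem_univ i)
        have h3 : (0 : ℝ) ≤ α i := by positivity
        exact pow_le_pow_left₀ (by positivity) (by linarith) 2
    _ = _ := by rw [Finset.prod_const, Finset.card_fin, ← pow_mul]

lemma hasTrace_tr {R : Op n} (hR : R ∈ rapid n) : HasTrace R (tr R) := (summable_diag hR).hasSum

lemma tr_add {R R' : Op n} (hR : R ∈ rapid n) (hR' : R' ∈ rapid n) :
    tr (R + R') = tr R + tr R' :=
  (summable_diag hR).tsum_add (summable_diag hR')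

lemma tr_sub {R R' : Op n} (hR : R ∈ rapid n) (hR' : R' ∈ rapid n) :
    tr (R - R') = tr R - tr R' :=
  (summable_diag hR).tsum_sub (summable_diag hR')

lemma tr_smul (c : ℂ) (R : Op n) : tr (c • R) = c * tr R := tsum_mul_left

lemma add_single_injective (j : Fin n) :
    Function.Injective (fun α : Occ n => α + Pi.single j 1) := add_left_injective _

lemma mem_range_add_single {α : Occ n} {j : Fin n} (h : α j ≠ 0) :
    α ∈ Set.range (fun α : Occ n => α + Pi.single j 1) :=
  ⟨α - Pi.single j 1, sub_single_add_single h⟩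

/-- The two series are the same up to the shift α ↦ α + e_j, and the terms outside its range vanish.
Hence the identity of `tsum`s needs no summability. -/
lemma tr_annihL (j : Fin n) (R : Op n) : tr (annihL j R) = tr (annihR j R) := by
  have := (add_single_injective j).tsum_eq (f := fun α => annihR j R α α) (by
    intro α hα
    apply mem_range_add_single
    intro h
    exact hα (by simp [annihR, h]))
  rw [tr, tr, ← this]
  simp [annihL, annihR]

lemma tr_createL (j : Fin n) (R : Op n) : tr (createL j R) = tr (createR j R) := by
  have := (add_single_injective j).tsum_eq (f := fun α => createL j R α α) (by
    intro α hα
    apply mem_range_add_single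
    intro h
    exact hα (by simp [createL, h]))
  rw [tr, tr, ← this]
  simp [createL, createR]

lemma tr_wL (μ : Mode n) {R : Op n} (hR : R ∈ rapid n) : tr (wL μ R) = tr (wR μ R) := by
  rcases μ with j | j <;>
  · have h1 := dz_mem_rapid (Sum.inl j) hR
    have h2 := zz_mem_rapid (Sum.inl j) hR
    have h3 := dz_mem_rapid (Sum.inr j) hR
    have h4 := zz_mem_rapid (Sum.inr j) hR
    simp only [dz, zz] at h1 h2 h3 h4
    simp only [wL, wR, LinearMap.smul_apply, LinearMap.add_apply, LinearMap.sub_apply, tr_smul,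
      tr_add h1 h2, tr_add h4 h3, tr_sub h1 h2, tr_sub h4 h3, tr_annihL, tr_createL]

lemma bOp'_mem_ladderAlg (μ : Mode n) : bOp' μ ∈ ladderAlg n := by
  rcases μ with j | j <;>
  exact Subalgebra.smul_mem _ (Subalgebra.sub_mem _ (wL_mem_ladderAlg _) (wR_mem_ladderAlg _)) _

lemma bOp_mem_ladderAlg (μ : Mode n) : bOp μ ∈ ladderAlg n :=
  Subalgebra.smul_mem _ (Subalgebra.add_mem _ (wL_mem_ladderAlg _) (wR_mem_ladderAlg _)) _

lemma tr_bOp' (μ : Mode n) {R : Op n} (hR : R ∈ rapid n) : tr (bOp' μ R) = 0 := by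
  rcases μ with j | j <;>
  · simp only [bOp', LinearMap.smul_apply, LinearMap.sub_apply, tr_smul]
    rw [tr_sub (wL_mem_rapid _ hR) (wR_mem_rapid _ hR), tr_wL _ hR, sub_self, mul_zero]

lemma tr_bOp (μ : Mode n) {R : Op n} (hR : R ∈ rapid n) :
    tr (bOp μ R) = (Real.sqrt 2 : ℂ) * tr (wL μ R) := by
  simp only [bOp, LinearMap.smul_apply, LinearMap.add_apply, tr_smul]
  rw [tr_add (wL_mem_rapid _ hR) (wR_mem_rapid _ hR), ← tr_wL _ hR, ← two_mul, ← mul_assoc,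
    ← sqrt_two_mul_self_complex]
  field_simp [sqrt_two_ne_zero_complex]

lemma tr_sum {ι : Type*} (s : Finset ι) {R : ι → Op n} (hR : ∀ i ∈ s, R i ∈ rapid n) :
    tr (∑ i ∈ s, R i) = ∑ i ∈ s, tr (R i) := by
  have := hasSum_sum (f := fun i α => R i α α) (a := fun i => tr (R i)) (s := s)
    fun i hi => hasTrace_tr (hR i hi)
  rw [tr, ← this.tsum_eq]
  simp [Matrix.sum_apply]

/-! ### Abstract ladder relations -/

section Ladder
variable {ι : Type*} [DecidableEq ι]

lemma sqrt_mul_self_complex (m : ℕ) : (Real.sqrt m : ℂ) * Real.sqrt m = m := by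
  rw [← Complex.ofReal_mul, Real.mul_self_sqrt (by positivity)]; simp

lemma sqrt_succ_ne_zero_complex (m : ℕ) : (Real.sqrt (m + 1 : ℕ) : ℂ) ≠ 0 := by
  rw [Complex.ofReal_ne_zero, Real.sqrt_ne_zero']
  positivity

lemma exists_eq_add_single {N : ι → ℕ} (h : N ≠ 0) :
    ∃ M : ι → ℕ, ∃ p, N = M + Pi.single p 1 := by
  obtain ⟨p, hp⟩ := Function.ne_iff.mp h
  exact ⟨N - Pi.single p 1, p, (sub_single_add_single hp).symm⟩

lemma multiIndex_induction [Fintype ι] {motive : (ι → ℕ) → Prop} (zero : motive 0)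
    (add : ∀ N p, motive N → motive (N + Pi.single p 1)) (N : ι → ℕ) : motive N := by
  induction h : deg N generalizing N with
  | zero =>
    have : N = 0 := by
      ext p
      have := le_deg N p
      simp only [Pi.zero_apply]
      lia
    rw [this]; exact zero
  | succ m ih =>
    have h0 : N ≠ 0 := by
      rintro rfl
      simp [deg] at h
    obtain ⟨M, p, rfl⟩ := exists_eq_add_single h0
    rw [deg_add_single] at h
    exact add M p (ih M (by lia))

lemma add_single_sub_single_comm {N : ι → ℕ} {p q : ι} (h : p ≠ q) :
    N + Pi.single p 1 - Pi.single q 1 = N - Pi.single q 1 + Pi.single p 1 := by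
  ext m
  by_cases hm : m = p
  · subst hm; simp [h]
  · simp [hm]

/-- Raising, a vacuum and the canonical commutator along the family φ already force the lowering
formula. It serves both kets (A = d', B = d) and functionals (precomposition with d raises, with d'
lowers). -/
lemma lowering_of_raising [Fintype ι] {V : Type*} [AddCommGroup V] [Module ℂ V] {A B : ι → Module.End ℂ V}
    {φ : (ι → ℕ) → V} (hA : ∀ p N, A p (φ N) = (Real.sqrt (N p + 1 : ℕ) : ℂ) • φ (N + Pi.single p 1))
    (hB : ∀ q, B q (φ 0) = 0)
    (hBA : ∀ p q N, B q (A p (φ N)) = A p (B q (φ N)) + (if q = p then (1 : ℂ) else 0) • φ N)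
    (q : ι) (N : ι → ℕ) : B q (φ N) = (Real.sqrt (N q) : ℂ) • φ (N - Pi.single q 1) := by
  induction N using multiIndex_induction with
  | zero => simp [hB]
  | add N p ih =>
    have h0 := sqrt_succ_ne_zero_complex (N p)
    -- As √(N p + 1) ≠ 0, the next vector is recovered from the raised one, which lets the induction
    -- use only the commutator.
    have h1 : φ (N + Pi.single p 1) = (Real.sqrt (N p + 1 : ℕ) : ℂ)⁻¹ • A p (φ N) := by
      rw [hA, smul_smul, inv_mul_cancel₀ h0, one_smul]
    rw [h1, map_smul, hBA, ih, map_smul, hA]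
    by_cases h : q = p
    · subst h
      have h2 : (Real.sqrt (N q) : ℂ) • (Real.sqrt ((N - Pi.single q 1 : ι → ℕ) q + 1 : ℕ) : ℂ) •
          φ (N - Pi.single q 1 + Pi.single q 1) = (N q : ℂ) • φ N := by
        by_cases hN : N q = 0
        · simp [hN]
        · rw [sub_single_add_single hN, smul_smul]
          have : (N - Pi.single q 1 : ι → ℕ) q + 1 = N q := by simp; lia
          rw [this, sqrt_mul_self_complex]
      rw [h2]
      simp only [if_true, add_tsub_cancel_right, Pi.add_apply, Pi.single_eq_same, ← add_smul,
        smul_smul]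
      congr 1
      rw [inv_mul_eq_iff_eq_mul₀ h0, sqrt_mul_self_complex]
      push_cast
      ring
    · simp only [h, if_false, zero_smul, add_zero]
      rw [add_single_sub_single_comm (Ne.symm h)]
      simp only [Pi.sub_apply, Pi.add_apply, Pi.single_apply, h, Ne.symm h, if_false, tsub_zero,
        add_zero]
      rw [smul_comm (Real.sqrt (N q) : ℂ), smul_smul, inv_mul_cancel₀ h0, one_smul]

/-- The factor a_q commutes through the list until it meets its own power. Since `l` has no
duplicates, this happens once and the other factors are unaffected. -/
lemma list_prod_shift {A : Type*} [Ring A] [Algebra ℂ A] {a : ι → A}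
    (ha : ∀ p q, a p * a q = a q * a p) (N : ι → ℕ) (q : ι) (l : List ι) (hl : l.Nodup)
    (hq : q ∈ l) :
    a q * (l.map fun p => (1 / (Real.sqrt (N p).factorial : ℂ)) • a p ^ N p).prod =
      (Real.sqrt (N q + 1 : ℕ) : ℂ) • (l.map fun p =>
        (1 / (Real.sqrt ((N + Pi.single q 1 : ι → ℕ) p).factorial : ℂ)) •
          a p ^ (N + Pi.single q 1 : ι → ℕ) p).prod := by
  induction l with
  | nil => simp at hq
  | cons p l ih =>
    rw [List.nodup_cons] at hl
    simp only [List.map_cons, List.prod_cons]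
    by_cases h : q = p
    · subst h
      have h1 : (l.map fun p => (1 / (Real.sqrt ((N + Pi.single q 1 : ι → ℕ) p).factorial : ℂ)) •
          a p ^ (N + Pi.single q 1 : ι → ℕ) p) =
          l.map fun p => (1 / (Real.sqrt (N p).factorial : ℂ)) • a p ^ N p := by
        refine List.map_congr_left fun p hp => ?_
        have : p ≠ q := fun h => hl.1 (h ▸ hp)
        simp [this]
      rw [h1, ← mul_assoc, ← smul_mul_assoc]
      congr 1
      simp only [Pi.add_apply, Pi.single_eq_same]
      rw [mul_smul_comm, ← pow_succ', smul_smul]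
      congr 1
      rw [Nat.factorial_succ, Nat.cast_mul, Real.sqrt_mul (by positivity), Complex.ofReal_mul]
      have h0 := sqrt_succ_ne_zero_complex (N q)
      field_simp
    · have hq' : q ∈ l := by simpa [h] using hq
      have h1 : a q * a p ^ N p = a p ^ N p * a q := (Commute.pow_right (ha q p) _).eq
      rw [← mul_assoc, mul_smul_comm, h1, ← smul_mul_assoc, mul_assoc, ih hl.2 hq', mul_smul_comm]
      simp [Ne.symm h]

end Ladder

/-! ### Right multiplications under the trace become left multiplications. -/

lemma wL_mul_wR (μ ν : Mode n) : wL μ * wR ν = wR ν * wL μ := by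
  simp only [wL_eq, wR_eq, smul_mul_smul_comm, one_div_sqrt_two_mul_self, mul_add, add_mul,
    mul_sub, sub_mul]
  rw [bOp_mul_bOp μ ν, bOp_mul_cOp μ ν, bOp_mul_cOp ν μ, cOp_mul_cOp μ ν, tau_antisymm μ ν]
  module

/-- A right multiplication commutes with the left multiplications gathered in `Q`, and cyclicity of
the trace then turns it into a left one. The statement is quantified over `Q` so that products can
be peeled off from the left. -/
lemma exists_leftAlg_tr_eq {T : SuperOp n} (hT : T ∈ ladderAlg n) :
    ∀ Q ∈ leftAlg n, ∃ P ∈ leftAlg n, ∀ R ∈ rapid n, tr (Q (T R)) = tr (P R) := by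
  induction hT using Algebra.adjoin_induction with
  | mem x hx =>
    intro Q hQ
    rcases hx with ⟨μ, rfl⟩ | ⟨μ, rfl⟩
    · exact ⟨Q * wL μ, Subalgebra.mul_mem _ hQ (Algebra.subset_adjoin ⟨μ, rfl⟩), fun R _ => rfl⟩
    · refine ⟨wL μ * Q, Subalgebra.mul_mem _ (Algebra.subset_adjoin ⟨μ, rfl⟩) hQ, fun R hR => ?_⟩
      have h1 : Q * wR μ = wR μ * Q := by
        induction hQ using Algebra.adjoin_induction with
        | mem x hx => obtain ⟨ν, rfl⟩ := hx; exact wL_mul_wR ν μ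
        | algebraMap r => exact Algebra.commutes r (wR μ)
        | add x y _ _ hx hy => rw [add_mul, mul_add, hx, hy]
        | mul x y _ _ hx hy => rw [mul_assoc, hy, ← mul_assoc, hx, mul_assoc]
      have h2 : Q (wR μ R) = wR μ (Q R) := congrArg (fun T : SuperOp n => T R) h1
      rw [h2]
      exact (tr_wL μ (ladderAlg_mem_rapid (leftAlg_le hQ) hR)).symm
  | algebraMap r =>
    intro Q hQ
    refine ⟨r • Q, Subalgebra.smul_mem _ hQ r, fun R _ => ?_⟩
    rw [Module.algebraMap_end_apply, map_smul, LinearMap.smul_apply]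
  | add x y hx' hy' hx hy =>
    intro Q hQ
    obtain ⟨P, hP, h1⟩ := hx Q hQ
    obtain ⟨P', hP', h2⟩ := hy Q hQ
    refine ⟨P + P', Subalgebra.add_mem _ hP hP', fun R hR => ?_⟩
    rw [LinearMap.add_apply, LinearMap.add_apply, map_add,
      tr_add (ladderAlg_mem_rapid (leftAlg_le hQ) (ladderAlg_mem_rapid hx' hR))
        (ladderAlg_mem_rapid (leftAlg_le hQ) (ladderAlg_mem_rapid hy' hR)),
      tr_add (ladderAlg_mem_rapid (leftAlg_le hP) hR) (ladderAlg_mem_rapid (leftAlg_le hP') hR),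
      h1 R hR, h2 R hR]
  | mul x y _ hy' hx hy =>
    intro Q hQ
    obtain ⟨P, hP, h1⟩ := hx Q hQ
    obtain ⟨P', hP', h2⟩ := hy P hP
    exact ⟨P', hP', fun R hR => by
      rw [Module.End.mul_apply, h1 _ (ladderAlg_mem_rapid hy' hR), h2 R hR]⟩

/-! ### Kets and bras as dual Fock families. -/

namespace JordanForm
variable {X : Matrix (Mode n) (Mode n) ℂ} (J : JordanForm X) {Γ : Matrix (Mode n) (Mode n) ℝ}

/-- The labels `(k, ℓ)` in lexicographic order. -/
def idxList : List J.Idx :=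
  (List.finRange J.numBlocks).flatMap fun k => (List.finRange (J.size k)).map fun l => ⟨k, l⟩

lemma orderedProd_eq (f : J.Idx → SuperOp n) : J.orderedProd f = (J.idxList.map f).prod := by
  rw [orderedProd, idxList, List.map_flatMap]
  generalize List.finRange J.numBlocks = l
  induction l with
  | nil => simp
  | cons k l ih => simp [ih, Function.comp_def]

lemma mem_idxList (p : J.Idx) : p ∈ J.idxList := by
  simp only [idxList, List.mem_flatMap, List.mem_map, List.mem_finRange, true_and]
  exact ⟨p.1, p.2, rfl⟩

lemma nodup_idxList : J.idxList.Nodup := by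
  rw [idxList, List.nodup_flatMap]
  refine ⟨fun k _ => (List.nodup_finRange _).map fun a b h => by simpa using h, ?_⟩
  refine (List.nodup_finRange J.numBlocks).imp fun {k k'} h => ?_
  intro p hp hp'
  simp only [List.mem_map] at hp hp'
  obtain ⟨l, _, rfl⟩ := hp
  obtain ⟨l', _, h'⟩ := hp'
  exact h (congrArg Sigma.fst h').symm

lemma d_mem_ladderAlg (p : J.Idx) : J.d Γ p ∈ ladderAlg n := by
  refine Subalgebra.sum_mem _ fun μ _ => Subalgebra.smul_mem _ (Subalgebra.sub_mem _
    (bOp_mem_ladderAlg μ) (Subalgebra.smul_mem _ (Subalgebra.sum_mem _ fun ν _ =>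
      Subalgebra.smul_mem _ (bOp'_mem_ladderAlg ν) _) _)) _

lemma d'_mem_ladderAlg (p : J.Idx) : J.d' p ∈ ladderAlg n :=
  Subalgebra.sum_mem _ fun μ _ => Subalgebra.smul_mem _ (bOp'_mem_ladderAlg μ) _

lemma orderedProd_mem {f : J.Idx → SuperOp n} (hf : ∀ p, f p ∈ ladderAlg n) :
    J.orderedProd f ∈ ladderAlg n := by
  rw [orderedProd_eq]
  refine Subalgebra.list_prod_mem _ fun x hx => ?_
  obtain ⟨p, _, rfl⟩ := List.mem_map.mp hx
  exact hf p

lemma braOp_mem_ladderAlg (N : J.Exc) : J.braOp Γ N ∈ ladderAlg n :=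
  J.orderedProd_mem fun p => Subalgebra.smul_mem _ (Subalgebra.pow_mem _ (J.d_mem_ladderAlg p) _) _

lemma ketOp_mem_ladderAlg (N : J.Exc) : J.ketOp N ∈ ladderAlg n :=
  J.orderedProd_mem fun p =>
    Subalgebra.smul_mem _ (Subalgebra.pow_mem _ (J.d'_mem_ladderAlg p) _) _

lemma orderedProd_one : J.orderedProd (fun _ => 1) = 1 := by
  rw [orderedProd_eq]
  exact List.prod_eq_one (by simp)

lemma d'_mul_ketOp (p : J.Idx) (N : J.Exc) :
    J.d' p * J.ketOp N = (Real.sqrt (N p + 1 : ℕ) : ℂ) • J.ketOp (N + Pi.single p 1) := by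
  rw [ketOp, ketOp, orderedProd_eq, orderedProd_eq]
  exact list_prod_shift J.d'_mul_d' N p _ J.nodup_idxList (J.mem_idxList p)

lemma d_mul_braOp (hΓ : Γ.IsSymm) (p : J.Idx) (N : J.Exc) :
    J.d Γ p * J.braOp Γ N = (Real.sqrt (N p + 1 : ℕ) : ℂ) • J.braOp Γ (N + Pi.single p 1) := by
  rw [braOp, braOp, orderedProd_eq, orderedProd_eq]
  exact list_prod_shift (J.d_mul_d hΓ) N p _ J.nodup_idxList (J.mem_idxList p)

lemma braOp_mul_d (hΓ : Γ.IsSymm) (p : J.Idx) (N : J.Exc) :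
    J.braOp Γ N * J.d Γ p = (Real.sqrt (N p + 1 : ℕ) : ℂ) • J.braOp Γ (N + Pi.single p 1) := by
  rw [← J.d_mul_braOp hΓ]
  rw [braOp, orderedProd_eq]
  exact (Commute.list_prod_right _ _ fun x hx => by
    obtain ⟨q, _, rfl⟩ := List.mem_map.mp hx
    exact (Commute.pow_right (J.d_mul_d hΓ p q) _).smul_right _).eq.symm

lemma ketOp_zero : J.ketOp 0 = 1 := by
  simp [ketOp, orderedProd_one]

lemma braOp_zero : J.braOp Γ 0 = 1 := by
  simp [braOp, orderedProd_one]

lemma d'_ket (ρ : Op n) (p : J.Idx) (N : J.Exc) :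
    J.d' p (J.ket ρ N) = (Real.sqrt (N p + 1 : ℕ) : ℂ) • J.ket ρ (N + Pi.single p 1) :=
  congrArg (fun T : SuperOp n => T ρ) (J.d'_mul_ketOp p N)

lemma ket_zero (ρ : Op n) : J.ket ρ 0 = ρ := by simp [ket, ketOp_zero]

lemma d_ket {ρ : Op n} (hρ : ∀ p, J.d Γ p ρ = 0) (p : J.Idx) (N : J.Exc) :
    J.d Γ p (J.ket ρ N) = (Real.sqrt (N p) : ℂ) • J.ket ρ (N - Pi.single p 1) := by
  refine lowering_of_raising (A := J.d') (B := J.d Γ) (fun p N => J.d'_ket ρ p N)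
    (fun q => by rw [ket_zero, hρ]) (fun p q N => ?_) p N
  exact congrArg (fun T : SuperOp n => T (J.ket ρ N)) (J.d_mul_d' Γ q p)

lemma ket_mem_rapid {ρ : Op n} (hρ : ρ ∈ rapid n) (N : J.Exc) : J.ket ρ N ∈ rapid n :=
  ladderAlg_mem_rapid (J.ketOp_mem_ladderAlg N) hρ

lemma tr_d' (p : J.Idx) {R : Op n} (hR : R ∈ rapid n) : tr (J.d' p R) = 0 := by
  have : J.d' p R = ∑ μ, J.S μ p • bOp' μ R := by simp [d']
  rw [this, tr_sum _ fun μ _ =>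
    Submodule.smul_mem _ _ (ladderAlg_mem_rapid (bOp'_mem_ladderAlg μ) hR)]
  exact Finset.sum_eq_zero fun μ _ => by rw [tr_smul, tr_bOp' μ hR, mul_zero]

/-- The left operators, as functions on the rapidly decreasing operators. -/
def braFun (Γ : Matrix (Mode n) (Mode n) ℝ) (N : J.Exc) (R : rapid n) : ℂ := J.bra Γ N R

lemma bra_add {N : J.Exc} {R R' : Op n} (hR : R ∈ rapid n) (hR' : R' ∈ rapid n) :
    J.bra Γ N (R + R') = J.bra Γ N R + J.bra Γ N R' := by
  rw [bra, map_add, tr_add (ladderAlg_mem_rapid (J.braOp_mem_ladderAlg N) hR)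
    (ladderAlg_mem_rapid (J.braOp_mem_ladderAlg N) hR')]
  rfl

lemma bra_smul {N : J.Exc} (c : ℂ) (R : Op n) : J.bra Γ N (c • R) = c * J.bra Γ N R := by
  rw [bra, map_smul, tr_smul]; rfl

lemma bra_sum {ι : Type*} (s : Finset ι) {N : J.Exc} {R : ι → Op n}
    (hR : ∀ i ∈ s, R i ∈ rapid n) : J.bra Γ N (∑ i ∈ s, R i) = ∑ i ∈ s, J.bra Γ N (R i) := by
  rw [bra, map_sum, tr_sum _ fun i hi =>
    ladderAlg_mem_rapid (J.braOp_mem_ladderAlg N) (hR i hi)]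
  rfl

lemma bra_d (hΓ : Γ.IsSymm) (p : J.Idx) (N : J.Exc) (R : Op n) :
    J.bra Γ N (J.d Γ p R) =
      (Real.sqrt (N p + 1 : ℕ) : ℂ) * J.bra Γ (N + Pi.single p 1) R := by
  rw [bra, bra, ← tr_smul]
  exact congrArg (fun T : SuperOp n => tr (T R)) (J.braOp_mul_d hΓ p N)

/-- Precomposition with a super-operator that preserves rapid decrease. -/
def precomp (T : SuperOp n) (hT : T ∈ ladderAlg n) : Module.End ℂ (rapid n → ℂ) :=
  LinearMap.funLeft ℂ ℂ fun R => ⟨T R, ladderAlg_mem_rapid hT R.2⟩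

/-- The trace is the vacuum of the dual ladder because Tr d'(R) = 0. Precomposition reverses
products and at the same time exchanges the roles of d and d', so the commutator keeps its sign. -/
lemma bra_d' (hΓ : Γ.IsSymm) (p : J.Idx) (N : J.Exc) {R : Op n} (hR : R ∈ rapid n) :
    J.bra Γ N (J.d' p R) = (Real.sqrt (N p) : ℂ) * J.bra Γ (N - Pi.single p 1) R := by
  have := lowering_of_raising (A := fun p => precomp (J.d Γ p) (J.d_mem_ladderAlg p))
    (B := fun p => precomp (J.d' p) (J.d'_mem_ladderAlg p)) (φ := J.braFun Γ)
    (fun p N => funext fun R => J.bra_d hΓ p N R)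
    (fun q => funext fun R => by
      change tr (J.braOp Γ 0 (J.d' q R)) = 0
      rw [J.braOp_zero]
      exact J.tr_d' q R.2)
    (fun p q N => funext fun R => by
      change J.bra Γ N (J.d Γ p (J.d' q R)) = J.bra Γ N (J.d' q (J.d Γ p R)) +
        (if q = p then (1 : ℂ) else 0) * J.bra Γ N R
      have h : J.d Γ p (J.d' q R) = J.d' q (J.d Γ p R) +
          (if p = q then (1 : ℂ) else 0) • (R : Op n) :=
        congrArg (fun T : SuperOp n => T R) (J.d_mul_d' Γ p q)
      rw [h, J.bra_add (ladderAlg_mem_rapid (J.d'_mem_ladderAlg q)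
        (ladderAlg_mem_rapid (J.d_mem_ladderAlg p) R.2)) (Submodule.smul_mem _ _ R.2),
        J.bra_smul]
      simp only [eq_comm (a := p) (b := q)]) p N
  exact congrFun this ⟨R, hR⟩

/-- Each d' of the ket is moved into the bra, where it lowers. Once the ket is the vacuum, any
remaining d in the bra annihilates it. -/
lemma bra_ket (hΓ : Γ.IsSymm) {ρ : Op n} (hρ : ∀ p, J.d Γ p ρ = 0) (hr : ρ ∈ rapid n)
    (ht : tr ρ = 1) (N N' : J.Exc) :
    J.bra Γ N (J.ket ρ N') = if N = N' then 1 else 0 := by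
  induction N' using multiIndex_induction generalizing N with
  | zero =>
    rw [ket_zero]
    by_cases h : N = 0
    · subst h
      simp [bra, braOp_zero, ht]
    · rw [if_neg h]
      obtain ⟨M, p, rfl⟩ := exists_eq_add_single h
      have h1 := J.bra_d hΓ p M ρ
      rw [hρ, bra, map_zero] at h1
      have h2 : tr (0 : Op n) = 0 := by simp [tr]
      rw [h2] at h1
      exact (mul_eq_zero.mp h1.symm).resolve_left (sqrt_succ_ne_zero_complex _)
  | add N' p ih =>
    have h0 := sqrt_succ_ne_zero_complex (N' p)
    have h1 := J.bra_d' hΓ p N (J.ket_mem_rapid hr N')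
    rw [J.d'_ket, J.bra_smul, ih] at h1
    have h2 : J.bra Γ N (J.ket ρ (N' + Pi.single p 1)) = (Real.sqrt (N' p + 1 : ℕ) : ℂ)⁻¹ *
        ((Real.sqrt (N p) : ℂ) * if N - Pi.single p 1 = N' then 1 else 0) := by
      rw [← h1, inv_mul_cancel_left₀ h0]
    rw [h2]
    by_cases hN : N p = 0
    · have : N ≠ N' + Pi.single p 1 := by
        rintro rfl
        simp at hN
      simp [hN, this]
    · by_cases hN' : N = N' + Pi.single p 1
      · subst hN'
        simp only [add_tsub_cancel_right, if_true, Pi.add_apply, Pi.single_eq_same, mul_one]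
        exact inv_mul_cancel₀ h0
      · have : N - Pi.single p 1 ≠ N' := by
          intro h
          apply hN'
          rw [← h, sub_single_add_single hN]
        simp [this, hN']

end JordanForm

/-! ### The operator bases and the Liouvillian in them -/

/-- The super-operators preserving a subspace. -/
def stabilizerAlg (V : Submodule ℂ (Op n)) : Subalgebra ℂ (SuperOp n) where
  carrier := {T | ∀ R ∈ V, T R ∈ V}
  mul_mem' := fun hS hT R hR => hS _ (hT R hR)
  add_mem' := fun hS hT R hR => V.add_mem (hS R hR) (hT R hR)
  algebraMap_mem' := fun c _ hR => V.smul_mem c hR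

/-- The super-operators preserving a space of super-operators by right multiplication. -/
def rightStabilizerAlg (G : Submodule ℂ (SuperOp n)) : Subalgebra ℂ (SuperOp n) where
  carrier := {T | ∀ S ∈ G, S * T ∈ G}
  mul_mem' := fun {T T'} hT hT' S hS => by rw [← mul_assoc]; exact hT' _ (hT S hS)
  add_mem' := fun {T T'} hT hT' S hS => by rw [mul_add]; exact G.add_mem (hT S hS) (hT' S hS)
  algebraMap_mem' := fun c S hS => by
    rw [← Algebra.commutes, ← Algebra.smul_def]; exact G.smul_mem c hS

namespace JordanForm
variable {X : Matrix (Mode n) (Mode n) ℂ} (J : JordanForm X) {Γ : Matrix (Mode n) (Mode n) ℝ}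

/-- The linear relations between left and right multiplications and the d, d' are invertible, so
closure of a space under ladder operators need only be tested on d and d'. -/
lemma ladderAlg_le (Γ : Matrix (Mode n) (Mode n) ℝ) {H : Subalgebra ℂ (SuperOp n)}
    (hd : ∀ p, J.d Γ p ∈ H) (hd' : ∀ p, J.d' p ∈ H) : ladderAlg n ≤ H := by
  have hb' : ∀ μ, bOp' μ ∈ H := by
    intro μ
    rw [J.bOp'_eq_d']
    exact H.sum_mem fun p _ => H.smul_mem (hd' p) _
  have hb : ∀ μ, bOp μ ∈ H := by
    intro μ
    rw [bOp_eq_eOp Γ, J.eOp_eq_d]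
    exact H.add_mem (H.sum_mem fun p _ => H.smul_mem (hd p) _)
      (H.sum_mem fun p _ => H.smul_mem (hb' p) _)
  have hc : ∀ μ, cOp μ ∈ H := by
    intro μ
    rw [cOp_eq]
    exact H.neg_mem (H.sum_mem fun p _ => H.smul_mem (hb' p) _)
  refine Algebra.adjoin_le ?_
  rintro _ (⟨μ, rfl⟩ | ⟨μ, rfl⟩)
  · rw [wL_eq]
    exact H.smul_mem (H.add_mem (hb μ) (hc μ)) _
  · rw [wR_eq]
    exact H.smul_mem (H.sub_mem (hb μ) (hc μ)) _

/-- A rapidly decreasing right vacuum. -/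
structure IsRapidVacuum (Γ : Matrix (Mode n) (Mode n) ℝ) (ρ : Op n) : Prop where
  symm : Γ.IsSymm
  ann : ∀ p, J.d Γ p ρ = 0
  mem_rapid : ρ ∈ rapid n
  tr_eq : tr ρ = 1

/-- The span of the right operators. -/
abbrev ketSpan (ρ : Op n) : Submodule ℂ (Op n) := Submodule.span ℂ (Set.range (J.ket ρ))

variable {J} {ρ : Op n}

namespace IsRapidVacuum
variable (h : J.IsRapidVacuum Γ ρ)

lemma ladderAlg_le_stabilizer (h : J.IsRapidVacuum Γ ρ) :
    ladderAlg n ≤ stabilizerAlg (J.ketSpan ρ) := by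
  have aux : ∀ (T : SuperOp n), (∀ N, T (J.ket ρ N) ∈ J.ketSpan ρ) →
      T ∈ stabilizerAlg (J.ketSpan ρ) := by
    intro T hT
    have : J.ketSpan ρ ≤ Submodule.comap T (J.ketSpan ρ) := by
      rw [Submodule.span_le]
      rintro _ ⟨N, rfl⟩
      exact hT N
    exact fun R hR => this hR
  refine J.ladderAlg_le Γ (fun p => aux _ fun N => ?_) fun p => aux _ fun N => ?_
  · rw [J.d_ket h.ann]
    exact Submodule.smul_mem _ _ (Submodule.subset_span ⟨_, rfl⟩)
  · rw [J.d'_ket]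
    exact Submodule.smul_mem _ _ (Submodule.subset_span ⟨_, rfl⟩)

lemma span_ket_eq (h : J.IsRapidVacuum Γ ρ) : (J.ketSpan ρ : Set (Op n)) =
    {R | ∃ P ∈ ladderAlg n, R = P ρ} := by
  ext R
  constructor
  · intro hR
    refine Submodule.span_induction (p := fun R _ => ∃ P ∈ ladderAlg n, R = P ρ) ?_ ?_ ?_ ?_ hR
    · rintro _ ⟨N, rfl⟩
      exact ⟨_, J.ketOp_mem_ladderAlg N, rfl⟩
    · exact ⟨0, Subalgebra.zero_mem _, rfl⟩
    · rintro _ _ _ _ ⟨P, hP, rfl⟩ ⟨Q, hQ, rfl⟩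
      exact ⟨P + Q, Subalgebra.add_mem _ hP hQ, rfl⟩
    · rintro c _ _ ⟨P, hP, rfl⟩
      exact ⟨c • P, Subalgebra.smul_mem _ hP c, rfl⟩
  · rintro ⟨P, hP, rfl⟩
    exact h.ladderAlg_le_stabilizer hP ρ (Submodule.subset_span ⟨0, J.ket_zero ρ⟩)

lemma ketSpan_le_rapid (h : J.IsRapidVacuum Γ ρ) : J.ketSpan ρ ≤ rapid n := by
  rw [Submodule.span_le]
  rintro _ ⟨N, rfl⟩
  exact J.ket_mem_rapid h.mem_rapid N

lemma bra_ket (h : J.IsRapidVacuum Γ ρ) (N N' : J.Exc) :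
    J.bra Γ N (J.ket ρ N') = if N = N' then 1 else 0 :=
  J.bra_ket h.symm h.ann h.mem_rapid h.tr_eq N N'

lemma bra_zero (N : J.Exc) : J.bra Γ N 0 = 0 := by simp [bra, tr]

lemma bra_finsupp_sum (h : J.IsRapidVacuum Γ ρ) (c : J.Exc →₀ ℂ) (N : J.Exc) :
    J.bra Γ N (c.sum fun M z => z • J.ket ρ M) = c N := by
  rw [Finsupp.sum, J.bra_sum _ fun M _ => Submodule.smul_mem _ _ (J.ket_mem_rapid h.mem_rapid M)]
  simp only [J.bra_smul, h.bra_ket, mul_ite, mul_one, mul_zero]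
  rw [Finset.sum_ite_eq]
  split_ifs with h
  · rfl
  · exact (Finsupp.notMem_support_iff.mp h).symm

/-- Pairing a linear combination with `bra N` returns its coefficient at `N`. -/
lemma linearIndependent_ket (h : J.IsRapidVacuum Γ ρ) : LinearIndependent ℂ (J.ket ρ) := by
  rw [linearIndependent_iff]
  intro c hc
  ext N
  have := h.bra_finsupp_sum c N
  rw [Finsupp.linearCombination_apply] at hc
  rw [hc, bra_zero] at this
  rw [← this, Finsupp.zero_apply]

/-- Existence: the T for which Tr T(·) lies in the span of the bras include 1 and are stable under
right multiplication by d and d', hence by the whole ladder algebra. Uniqueness: evaluation on kets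
reads off the coefficients. -/
lemma existsUnique_bra (h : J.IsRapidVacuum Γ ρ) {P : SuperOp n} (hP : P ∈ ladderAlg n) :
    ∃! c : J.Exc →₀ ℂ, ∀ R : Op n, IsRapidlyDecreasing R →
      tr (P R) = c.sum fun N z => z * J.bra Γ N R := by
  let F : Submodule ℂ (rapid n → ℂ) := Submodule.span ℂ (Set.range (J.braFun Γ))
  have hF : ∀ {T : SuperOp n} (hT : T ∈ ladderAlg n), (∀ N, precomp T hT (J.braFun Γ N) ∈ F) →
      ∀ f ∈ F, precomp T hT f ∈ F := by
    intro T hT h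
    have : F ≤ Submodule.comap (precomp T hT) F := by
      rw [Submodule.span_le]
      rintro _ ⟨N, rfl⟩
      exact h N
    exact fun f hf => this hf
  -- Membership in the ladder algebra is recorded as well, since additivity of the trace requires
  -- rapidly decreasing arguments.
  let G : Submodule ℂ (SuperOp n) :=
    { carrier := {T | T ∈ ladderAlg n ∧ (fun R : rapid n => tr (T R)) ∈ F}
      zero_mem' := ⟨Subalgebra.zero_mem _, by
        have : (fun R : rapid n => tr ((0 : SuperOp n) R)) = 0 := by
          funext R
          simp [tr]
        rw [this]
        exact F.zero_mem⟩
      add_mem' := fun {S T} hS hT => ⟨Subalgebra.add_mem _ hS.1 hT.1, by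
        have : (fun R : rapid n => tr ((S + T) R)) =
            (fun R : rapid n => tr (S R)) + (fun R : rapid n => tr (T R)) := by
          funext R
          exact tr_add (ladderAlg_mem_rapid hS.1 R.2) (ladderAlg_mem_rapid hT.1 R.2)
        rw [this]
        exact F.add_mem hS.2 hT.2⟩
      smul_mem' := fun c {T} hT => ⟨Subalgebra.smul_mem _ hT.1 c, by
        have : (fun R : rapid n => tr ((c • T) R)) = c • (fun R : rapid n => tr (T R)) := by
          funext R
          exact tr_smul _ _
        rw [this]
        exact F.smul_mem c hT.2⟩ }
  have hle : ladderAlg n ≤ rightStabilizerAlg G := by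
    refine J.ladderAlg_le Γ (fun p S hS => ?_) fun p S hS => ?_
    · refine ⟨Subalgebra.mul_mem _ hS.1 (J.d_mem_ladderAlg p),
        hF (J.d_mem_ladderAlg p) (fun N => ?_) _ hS.2⟩
      have : precomp (J.d Γ p) (J.d_mem_ladderAlg p) (J.braFun Γ N) =
          (Real.sqrt (N p + 1 : ℕ) : ℂ) • J.braFun Γ (N + Pi.single p 1) :=
        funext fun R => J.bra_d h.symm p N R
      rw [this]
      exact Submodule.smul_mem _ _ (Submodule.subset_span ⟨_, rfl⟩)
    · refine ⟨Subalgebra.mul_mem _ hS.1 (J.d'_mem_ladderAlg p),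
        hF (J.d'_mem_ladderAlg p) (fun N => ?_) _ hS.2⟩
      have : precomp (J.d' p) (J.d'_mem_ladderAlg p) (J.braFun Γ N) =
          (Real.sqrt (N p) : ℂ) • J.braFun Γ (N - Pi.single p 1) :=
        funext fun R => J.bra_d' h.symm p N R.2
      rw [this]
      exact Submodule.smul_mem _ _ (Submodule.subset_span ⟨_, rfl⟩)
  have h1 : (1 : SuperOp n) ∈ G := by
    refine ⟨Subalgebra.one_mem _, Submodule.subset_span ⟨0, ?_⟩⟩
    funext R
    simp [braFun, bra, braOp_zero]
  have hPG := (hle hP 1 h1).2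
  rw [one_mul] at hPG
  obtain ⟨c, hc⟩ := Finsupp.mem_span_range_iff_exists_finsupp.mp hPG
  refine ⟨c, fun R hR => ?_, fun c' hc' => ?_⟩
  · have := congrFun hc ⟨R, hR⟩
    dsimp only at this
    rw [← this, Finsupp.sum, Finsupp.sum, Finset.sum_apply]
    rfl
  · ext N
    have e1 := hc' _ (J.ket_mem_rapid h.mem_rapid N)
    have e2 := congrFun hc ⟨_, J.ket_mem_rapid h.mem_rapid N⟩
    dsimp only at e2
    have key : ∀ c : J.Exc →₀ ℂ, (c.sum fun M z => z * J.bra Γ M (J.ket ρ N)) = c N := by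
      intro c
      simp only [Finsupp.sum, h.bra_ket, mul_ite, mul_one, mul_zero, Finset.sum_ite_eq']
      split_ifs with h
      · rfl
      · exact (Finsupp.notMem_support_iff.mp h).symm
    rw [← key c', ← key c, ← e1, ← e2, Finsupp.sum, Finsupp.sum, Finset.sum_apply]
    rfl

end IsRapidVacuum

lemma level_add (N M : J.Exc) : J.level (N + M) = J.level N + J.level M := by
  simp [level, mul_add, Finset.sum_add_distrib]

lemma lam_add (N M : J.Exc) : J.lam (N + M) = J.lam N + J.lam M := by
  simp [lam, mul_add, Finset.sum_add_distrib]

lemma level_single (p : J.Idx) : J.level (Pi.single p 1) = (p.2 : ℕ) + 1 := by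
  simp [level, Pi.single_apply]

lemma lam_single (p : J.Idx) : J.lam (Pi.single p 1) = J.eig p.1 := by
  simp [lam, Pi.single_apply]

end JordanForm

open JordanForm in
/-- The Liouvillian acts on the right operators as `λ_N` plus a term of lower level. -/
lemma System.liouvillian_ket (sys : System n) {Γ : Matrix (Mode n) (Mode n) ℝ}
    (hL : sys.SolvesLyapunov Γ) {J : JordanForm sys.X₀} {ρ : Op n} (h : J.IsRapidVacuum Γ ρ)
    (N : J.Exc) :
    sys.liouvillian (J.ket ρ N) - J.lam N • J.ket ρ N ∈
      Submodule.span ℂ (J.ket ρ '' {M | J.level M + 1 = J.level N ∧ J.lam M = J.lam N}) := by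
  have h1 : sys.liouvillian (J.ket ρ N) =
      ∑ p, ∑ q, (J.Sinv * sys.X₀ * J.S) p q • J.d' p (J.d Γ q (J.ket ρ N)) := by
    rw [sys.liouvillian_eq_d h.symm hL J]
    simp [bil]
  -- d'_p d_p is the number operator of mode `p`.
  have h2 : ∀ p, J.eig p.1 • J.d' p (J.d Γ p (J.ket ρ N)) = (J.eig p.1 * N p) • J.ket ρ N := by
    intro p
    rw [J.d_ket h.ann, map_smul, J.d'_ket]
    by_cases hN : N p = 0
    · simp [hN]
    · rw [sub_single_add_single hN, smul_smul, smul_smul, mul_assoc]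
      have : (N - Pi.single p 1 : J.Idx → ℕ) p + 1 = N p := by simp; lia
      rw [this, sqrt_mul_self_complex]
  have h3 : J.lam N • J.ket ρ N = ∑ p, ∑ q, if p = q then
      J.eig p.1 • J.d' p (J.d Γ q (J.ket ρ N)) else 0 := by
    simp only [Finset.sum_ite_eq, Finset.mem_univ, if_true, h2, lam, Finset.sum_smul]
  rw [h1, h3, ← Finset.sum_sub_distrib]
  refine Submodule.sum_mem _ fun p _ => ?_
  rw [← Finset.sum_sub_distrib]
  refine Submodule.sum_mem _ fun q _ => ?_
  rw [J.jordan, Matrix.of_apply]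
  by_cases hpq : p = q
  · simp [hpq]
  · rw [if_neg hpq, if_neg hpq, sub_zero]
    split_ifs with hc
    -- An off-diagonal Jordan entry moves one excitation from a rank to the next lower rank of the
    -- same block: the level drops by one and λ is unchanged.
    · rw [one_smul, J.d_ket h.ann, map_smul, J.d'_ket]
      by_cases hN : N q = 0
      · simp [hN]
      refine Submodule.smul_mem _ _ (Submodule.smul_mem _ _ (Submodule.subset_span ⟨_, ?_, rfl⟩))
      have e := sub_single_add_single hN
      have e1 : J.level N = J.level (N - Pi.single q 1) + ((q.2 : ℕ) + 1) := by
        rw [← level_single q, ← level_add, e]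
      have e2 : J.lam N = J.lam (N - Pi.single q 1) + J.eig q.1 := by
        rw [← lam_single q, ← lam_add, e]
      refine ⟨?_, ?_⟩
      · rw [level_add, level_single, e1]
        lia
      · rw [lam_add, lam_single, e2, hc.1]
    · rw [zero_smul]
      exact Submodule.zero_mem _

namespace JordanForm.IsRapidVacuum
variable {sys : System n} {Γ : Matrix (Mode n) (Mode n) ℝ} {J : JordanForm sys.X₀} {ρ : Op n}

lemma bra_eq_zero_of_mem_span (h : J.IsRapidVacuum Γ ρ) {s : Set J.Exc} {N : J.Exc} (hN : N ∉ s)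
    {R : Op n} (hR : R ∈ Submodule.span ℂ (J.ket ρ '' s)) : J.bra Γ N R = 0 := by
  have hle : Submodule.span ℂ (J.ket ρ '' s) ≤ rapid n :=
    (Submodule.span_mono (Set.image_subset_range _ _)).trans h.ketSpan_le_rapid
  refine Submodule.span_induction (p := fun R _ => J.bra Γ N R = 0) ?_ ?_ ?_ ?_ hR
  · rintro _ ⟨M, hM, rfl⟩
    rw [h.bra_ket, if_neg]
    rintro rfl
    exact hN hM
  · exact bra_zero N
  · intro x y hx hy e1 e2
    rw [J.bra_add (hle hx) (hle hy), e1, e2, add_zero]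
  · intro c x _ e
    rw [J.bra_smul, e, mul_zero]

lemma bra_liouvillian_ket (h : J.IsRapidVacuum Γ ρ) (hL : sys.SolvesLyapunov Γ) {N N' : J.Exc}
    (hN : J.level N' ≤ J.level N) :
    J.bra Γ N (sys.liouvillian (J.ket ρ N')) = if N = N' then J.lam N else 0 := by
  have h1 := sys.liouvillian_ket hL h N'
  have h2 := h.bra_eq_zero_of_mem_span (N := N) (by
    rintro ⟨h3, -⟩
    lia) h1
  have hle : Submodule.span ℂ (J.ket ρ '' {M | J.level M + 1 = J.level N' ∧
      J.lam M = J.lam N'}) ≤ rapid n :=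
    (Submodule.span_mono (Set.image_subset_range _ _)).trans h.ketSpan_le_rapid
  have h3 : sys.liouvillian (J.ket ρ N') = (sys.liouvillian (J.ket ρ N') -
      J.lam N' • J.ket ρ N') + J.lam N' • J.ket ρ N' := (sub_add_cancel _ _).symm
  rw [h3, J.bra_add (hle h1) (Submodule.smul_mem _ _ (J.ket_mem_rapid h.mem_rapid _)), h2,
    J.bra_smul, h.bra_ket]
  by_cases e : N = N'
  · simp [e]
  · simp [e]

lemma _root_.QuasiFreeBoson.System.liouvillian_mem_ladderAlg (sys : System n) : sys.liouvillian ∈ ladderAlg n := by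
  rw [sys.liouvillian_eq_bOp]
  exact Subalgebra.add_mem _
    (Subalgebra.sum_mem _ fun _ _ => Subalgebra.sum_mem _ fun _ _ => Subalgebra.smul_mem _
      (Subalgebra.mul_mem _ (bOp'_mem_ladderAlg _) (bOp_mem_ladderAlg _)) _)
    (Subalgebra.sum_mem _ fun _ _ => Subalgebra.sum_mem _ fun _ _ => Subalgebra.smul_mem _
      (Subalgebra.mul_mem _ (bOp'_mem_ladderAlg _) (bOp'_mem_ladderAlg _)) _)

/-- By induction on the level: L - λ sends the ket into the span of kets of lower level with the
same λ, so one further power suffices. -/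
lemma ket_mem_maxGenEigenspace (h : J.IsRapidVacuum Γ ρ) (hL : sys.SolvesLyapunov Γ) (N : J.Exc) :
    J.ket ρ N ∈ Module.End.maxGenEigenspace sys.liouvillian (J.lam N) := by
  induction hm : J.level N using Nat.strong_induction_on generalizing N with
  | _ m ih =>
    have h1 := sys.liouvillian_ket hL h N
    have h2 : Submodule.span ℂ (J.ket ρ '' {M | J.level M + 1 = J.level N ∧
        J.lam M = J.lam N}) ≤ Module.End.maxGenEigenspace sys.liouvillian (J.lam N) := by
      rw [Submodule.span_le]
      rintro _ ⟨M, ⟨hM1, hM2⟩, rfl⟩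
      rw [← hM2]
      exact ih (J.level M) (by lia) M rfl
    obtain ⟨k, hk⟩ := (Module.End.mem_maxGenEigenspace _ _ _).mp (h2 h1)
    refine (Module.End.mem_maxGenEigenspace _ _ _).mpr ⟨k + 1, ?_⟩
    rw [pow_succ, Module.End.mul_apply]
    exact hk

/-- For an eigenvector, the coefficient at an index of maximal level in its support sees only the
diagonal entry, which must be the eigenvalue. Conversely, the last non-zero vector among (L - λ_N)^m
`ket N` is an eigenvector. -/
lemma eigenvalues_eq (h : J.IsRapidVacuum Γ ρ) (hL : sys.SolvesLyapunov Γ) :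
    {z : ℂ | ∃ R ∈ J.ketSpan ρ, R ≠ 0 ∧ sys.liouvillian R = z • R} = Set.range J.lam := by
  ext z
  constructor
  · rintro ⟨R, hR, hR0, hz⟩
    obtain ⟨c, rfl⟩ := Finsupp.mem_span_range_iff_exists_finsupp.mp hR
    have hc : c.support.Nonempty := by
      rw [Finsupp.support_nonempty_iff]
      rintro rfl
      simp at hR0
    obtain ⟨N, hN, hmax⟩ := c.support.exists_max_image J.level hc
    refine ⟨N, ?_⟩
    have e1 := congrArg (J.bra Γ N) hz
    rw [J.bra_smul, h.bra_finsupp_sum, Finsupp.sum, map_sum, J.bra_sum _ fun M _ =>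
      ladderAlg_mem_rapid sys.liouvillian_mem_ladderAlg
        (Submodule.smul_mem _ _ (J.ket_mem_rapid h.mem_rapid M))] at e1
    have e2 : ∀ M ∈ c.support, J.bra Γ N (sys.liouvillian (c M • J.ket ρ M)) =
        if N = M then c M * J.lam N else 0 := by
      intro M hM
      rw [map_smul, J.bra_smul, h.bra_liouvillian_ket hL (hmax M hM)]
      simp
    rw [Finset.sum_congr rfl e2, Finset.sum_ite_eq, if_pos hN, mul_comm] at e1
    exact mul_right_cancel₀ (Finsupp.mem_support_iff.mp hN) e1
  · rintro ⟨N, rfl⟩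
    obtain ⟨k, hk⟩ := (Module.End.mem_maxGenEigenspace _ _ _).mp (h.ket_mem_maxGenEigenspace hL N)
    classical
    have hex : ∃ k, ((sys.liouvillian - J.lam N • 1 : SuperOp n) ^ k) (J.ket ρ N) = 0 := ⟨k, hk⟩
    have h0 : J.ket ρ N ≠ 0 := h.linearIndependent_ket.ne_zero N
    obtain ⟨m, hm⟩ := Nat.exists_eq_succ_of_ne_zero (n := Nat.find hex) fun h1 => by
      have := Nat.find_spec hex
      rw [h1] at this
      exact h0 this
    refine ⟨((sys.liouvillian - J.lam N • 1 : SuperOp n) ^ m) (J.ket ρ N), ?_, ?_, ?_⟩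
    · have : (sys.liouvillian - J.lam N • 1 : SuperOp n) ^ m ∈ ladderAlg n :=
        Subalgebra.pow_mem _ (Subalgebra.sub_mem _ sys.liouvillian_mem_ladderAlg
          (Subalgebra.smul_mem _ (Subalgebra.one_mem _) _)) _
      exact h.ladderAlg_le_stabilizer this _ (Submodule.subset_span ⟨N, rfl⟩)
    · exact Nat.find_min hex (by lia)
    · have := Nat.find_spec hex
      rw [hm, pow_succ', Module.End.mul_apply, LinearMap.sub_apply, sub_eq_zero] at this
      exact this

/-- On the vacuum b_ν = 2Σ Γ_νκ b'_κ, and Tr b_μ b'_κ ρ = δ_μκ by the commutator. On the other hand,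
cyclicity makes Tr b_μ b_ν ρ the symmetrized second moment. -/
lemma covariance (h : J.IsRapidVacuum Γ ρ) (μ ν : Mode n) :
    HasTrace ((1 / 2 : ℂ) • (wL μ (wL ν ρ) + wL ν (wL μ ρ))) (Γ μ ν : ℂ) := by
  have hm : ∀ {T : SuperOp n}, T ∈ ladderAlg n → T ρ ∈ rapid n :=
    fun hT => ladderAlg_mem_rapid hT h.mem_rapid
  have hw : ∀ μ ν, wL μ (wL ν ρ) ∈ rapid n := fun μ ν =>
    wL_mem_rapid μ (wL_mem_rapid ν h.mem_rapid)
  have hmem : (1 / 2 : ℂ) • (wL μ (wL ν ρ) + wL ν (wL μ ρ)) ∈ rapid n :=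
    Submodule.smul_mem _ _ (Submodule.add_mem _ (hw μ ν) (hw ν μ))
  suffices hs : tr ((1 / 2 : ℂ) • (wL μ (wL ν ρ) + wL ν (wL μ ρ))) = (Γ μ ν : ℂ) by
    rw [← hs]; exact hasTrace_tr hmem
  rw [tr_smul, tr_add (hw μ ν) (hw ν μ)]
  have hb : bOp ν ρ = (2 : ℂ) • ∑ κ, (Γ ν κ : ℂ) • bOp' κ ρ := by
    have : eOp Γ ν ρ = 0 := by
      rw [J.eOp_eq_d]
      simp [h.ann]
    rw [eOp, LinearMap.sub_apply, sub_eq_zero] at this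
    rw [this]
    simp
  have e1 : tr (bOp μ (bOp ν ρ)) = 2 * (Γ μ ν : ℂ) := by
    rw [hb, map_smul, tr_smul, map_sum, tr_sum _ fun κ _ => ?_]
    · have : ∀ κ, tr (bOp μ ((Γ ν κ : ℂ) • bOp' κ ρ)) = if μ = κ then (Γ ν κ : ℂ) else 0 := by
        intro κ
        have h1 : bOp μ (bOp' κ ρ) = bOp' κ (bOp μ ρ) + (if μ = κ then (1 : ℂ) else 0) • ρ :=
          congrArg (fun T : SuperOp n => T ρ) (bOp_mul_bOp' μ κ)
        rw [map_smul, tr_smul, h1, tr_add (ladderAlg_mem_rapid (bOp'_mem_ladderAlg κ)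
          (hm (bOp_mem_ladderAlg μ))) (Submodule.smul_mem _ _ h.mem_rapid),
          tr_bOp' κ (hm (bOp_mem_ladderAlg μ)), tr_smul, h.tr_eq]
        simp
      simp only [this, Finset.sum_ite_eq, Finset.mem_univ, if_true, h.symm.apply]
    · exact ladderAlg_mem_rapid (bOp_mem_ladderAlg μ)
        (Submodule.smul_mem _ _ (hm (bOp'_mem_ladderAlg κ)))
  have e2 : tr (bOp μ (bOp ν ρ)) = tr (wL μ (wL ν ρ)) + tr (wL ν (wL μ ρ)) := by
    rw [tr_bOp μ (hm (bOp_mem_ladderAlg ν))]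
    have h1 : wL μ (bOp ν ρ) = (1 / (Real.sqrt 2 : ℂ)) • (wL μ (wL ν ρ) + wL μ (wR ν ρ)) := by
      simp [bOp]
    have h2 : wL μ (wR ν ρ) = wR ν (wL μ ρ) :=
      congrArg (fun T : SuperOp n => T ρ) (wL_mul_wR μ ν)
    rw [h1, tr_smul, h2, tr_add (hw μ ν) (wR_mem_rapid ν (wL_mem_rapid μ h.mem_rapid)),
      ← tr_wL ν (wL_mem_rapid μ h.mem_rapid), ← mul_assoc, mul_one_div,
      div_self sqrt_two_ne_zero_complex, one_mul]
  rw [← e2, e1]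
  ring

end JordanForm.IsRapidVacuum

/-! ### Coefficients of exponentials of quadratic forms -/

section Series
open MvPolynomial
variable {ι : Type*}

/-- The truncated exponential of a polynomial. -/
def truncExp (M : ℕ) (q : MvPolynomial ι ℂ) : MvPolynomial ι ℂ :=
  ∑ m ∈ Finset.range M, C ((m.factorial : ℂ)⁻¹) * q ^ m

/-- The chain rule for the exponential, at the cost of one truncation order. -/
lemma truncExp_succ_pderiv (q : MvPolynomial ι ℂ) (M : ℕ) (i : ι) :
    pderiv i (truncExp (M + 1) q) = truncExp M q * pderiv i q := by
  rw [truncExp, Finset.sum_range_succ', map_add, map_sum, truncExp, Finset.sum_mul]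
  simp only [pow_zero, mul_one, pderiv_C, add_zero]
  refine Finset.sum_congr rfl fun m _ => ?_
  rw [pderiv_C_mul, pderiv_pow, Nat.add_sub_cancel, ← mul_assoc, ← mul_assoc]
  congr 2
  rw [← map_natCast (C (σ := ι) (R := ℂ)), ← C_mul, Nat.factorial_succ]
  congr 1
  have : ((m : ℂ) + 1) ≠ 0 := by exact_mod_cast Nat.succ_ne_zero m
  push_cast
  field_simp

variable [Fintype ι]

/-- A multi-index as a finitely supported function. -/
abbrev toFinsupp (p : ι → ℕ) : ι →₀ ℕ := Finsupp.equivFunOnFinite.symm p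

lemma coeff_eq_zero_of_deg_ne {q : MvPolynomial ι ℂ} {m : ℕ} (hq : q.IsHomogeneous m)
    {p : ι → ℕ} (hp : deg p ≠ m) : coeff (toFinsupp p) q = 0 := by
  apply hq.coeff_eq_zero
  rwa [Finsupp.degree_eq_sum]

/-- q^m is homogeneous of degree 2m, so only m = deg p / 2 can contribute and the coefficient no
longer depends on the truncation. -/
lemma coeff_truncExp {q : MvPolynomial ι ℂ} (hq : q.IsHomogeneous 2) {p : ι → ℕ} {M : ℕ}
    (hM : deg p < M) :
    coeff (toFinsupp p) (truncExp M q) = coeff (toFinsupp p) (truncExp (deg p + 1) q) := by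
  simp only [truncExp, coeff_sum, coeff_C_mul]
  symm
  refine Finset.sum_subset (Finset.range_subset_range.mpr hM) fun m _ hm => ?_
  rw [coeff_eq_zero_of_deg_ne (hq.pow m), mul_zero]
  rw [Finset.mem_range, not_lt] at hm
  lia

/-- The quadratic form with matrix `A / 2`. -/
def quadPoly (A : Matrix ι ι ℂ) : MvPolynomial ι ℂ := ∑ i, ∑ j, C (A i j / 2) * (X i * X j)

lemma quadPoly_isHomogeneous (A : Matrix ι ι ℂ) : (quadPoly A).IsHomogeneous 2 := by
  refine IsHomogeneous.sum _ _ _ fun i _ => IsHomogeneous.sum _ _ _ fun j _ => ?_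
  exact ((isHomogeneous_X ℂ i).mul (isHomogeneous_X ℂ j)).C_mul _

lemma pderiv_quadPoly [DecidableEq ι] {A : Matrix ι ι ℂ} (hA : A.IsSymm) (i : ι) :
    pderiv i (quadPoly A) = ∑ j, C (A i j) * X j := by
  have h0 : ∀ k j, pderiv i (C (A k j / 2) * (X k * X j)) =
      C (A k j / 2) * ((if k = i then (1 : MvPolynomial ι ℂ) else 0) * X j) +
      C (A k j / 2) * (X k * (if j = i then (1 : MvPolynomial ι ℂ) else 0)) := by
    intro k j
    rw [pderiv_C_mul, pderiv_mul, pderiv_X, pderiv_X, mul_add, Pi.single_apply, Pi.single_apply]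
  simp only [quadPoly, map_sum, h0, Finset.sum_add_distrib]
  have h1 : ∑ k, ∑ j, C (A k j / 2) * ((if k = i then (1 : MvPolynomial ι ℂ) else 0) * X j) =
      ∑ j, C (A i j / 2) * X j := by
    rw [Finset.sum_comm]
    refine Finset.sum_congr rfl fun j _ => ?_
    rw [Finset.sum_eq_single i]
    · simp
    · intro k _ hk; simp [hk]
    · simp
  have h2 : ∑ k, ∑ j, C (A k j / 2) * (X k * (if j = i then (1 : MvPolynomial ι ℂ) else 0)) =
      ∑ j, C (A i j / 2) * X j := by
    refine Finset.sum_congr rfl fun j _ => ?_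
    rw [Finset.sum_eq_single i]
    · simp [hA.apply]
    · intro k _ hk; simp [hk]
    · simp
  rw [h1, h2, ← Finset.sum_add_distrib]
  refine Finset.sum_congr rfl fun j _ => ?_
  rw [← add_mul, ← C_add, add_halves]

/-- The coefficients of `exp (zᵀ A z / 2)`. -/
def gaussCoeff (A : Matrix ι ι ℂ) (p : ι → ℕ) : ℂ :=
  coeff (toFinsupp p) (truncExp (deg p + 1) (quadPoly A))

lemma gaussCoeff_eq (A : Matrix ι ι ℂ) {p : ι → ℕ} {M : ℕ} (hM : deg p < M) :
    gaussCoeff A p = coeff (toFinsupp p) (truncExp M (quadPoly A)) :=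
  (coeff_truncExp (quadPoly_isHomogeneous A) hM).symm

lemma gaussCoeff_zero (A : Matrix ι ι ℂ) : gaussCoeff A 0 = 1 := by
  have h : deg (0 : ι → ℕ) = 0 := by simp [deg]
  rw [gaussCoeff, h]
  have : toFinsupp (0 : ι → ℕ) = 0 := by ext; simp
  rw [this]
  simp [truncExp]

/-- This is ∂_i e^q = (Az)_i e^q, compared coefficient by coefficient. -/
lemma gaussCoeff_rec [DecidableEq ι] {A : Matrix ι ι ℂ} (hA : A.IsSymm) (i : ι) (p : ι → ℕ) :
    ((p i : ℂ) + 1) * gaussCoeff A (p + Pi.single i 1) =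
      ∑ j, A i j * if p j = 0 then 0 else gaussCoeff A (p - Pi.single j 1) := by
  have h1 : toFinsupp (p + Pi.single i 1) = toFinsupp p + Finsupp.single i 1 := by
    ext k; simp [Finsupp.single_apply, Pi.single_apply, eq_comm]
  -- Order deg p + 2 is large enough on the left, and differentiation lowers it to deg p + 1, which
  -- is still large enough on the right.
  rw [gaussCoeff_eq A (M := deg p + 1 + 1) (by rw [deg_add_single]; lia), h1, mul_comm]
  have h2 := coeff_pderiv (i := i) (truncExp (deg p + 1 + 1) (quadPoly A)) (toFinsupp p)
  rw [truncExp_succ_pderiv, pderiv_quadPoly hA, Finset.mul_sum, coeff_sum] at h2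
  have h3 : ((toFinsupp p) i : ℂ) = p i := by simp
  rw [← h3, ← h2]
  refine Finset.sum_congr rfl fun j _ => ?_
  rw [mul_left_comm, coeff_C_mul, coeff_mul_X']
  congr 1
  by_cases hj : p j = 0
  · simp [hj]
  · have hj' : j ∈ (toFinsupp p).support := by simp [hj]
    have h4 : toFinsupp p - Finsupp.single j 1 = toFinsupp (p - Pi.single j 1) := by
      ext k; simp [Finsupp.single_apply, Pi.single_apply, eq_comm]
    have h5 := deg_add_single (p - Pi.single j 1) j
    rw [sub_single_add_single hj] at h5
    rw [if_pos hj', if_neg hj, h4, ← gaussCoeff_eq A (by lia)]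

end Series

/-! ### Gaussian operators -/

/-- The operator with generating function `exp (zᵀ A z / 2)`. -/
def gaussOp (A : Matrix (Mode n) (Mode n) ℂ) : Op n := Matrix.of fun α β =>
  (Real.sqrt (∏ i, (Sum.elim α β i).factorial : ℕ) : ℂ) * gaussCoeff A (Sum.elim α β)

lemma entry_gaussOp (A : Matrix (Mode n) (Mode n) ℂ) (p : Mode n → ℕ) :
    entry (gaussOp A) p = (Real.sqrt (∏ i, (p i).factorial : ℕ) : ℂ) * gaussCoeff A p := by
  have : Sum.elim (fun j => p (Sum.inl j)) (fun j => p (Sum.inr j)) = p := by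
    ext (i | i) <;> rfl
  rw [entry, gaussOp, Matrix.of_apply, this]

lemma prod_factorial_add_single {ι : Type*} [Fintype ι] [DecidableEq ι] (p : ι → ℕ) (i : ι) :
    ∏ k, ((p + Pi.single i 1 : ι → ℕ) k).factorial = (p i + 1) * ∏ k, (p k).factorial := by
  rw [← Finset.mul_prod_erase _ _ (Finset.mem_univ i),
    ← Finset.mul_prod_erase _ (fun k => (p k).factorial) (Finset.mem_univ i), ← mul_assoc]
  congr 1
  · simp [Nat.factorial_succ]
  · refine Finset.prod_congr rfl fun k hk => ?_
    simp [Finset.ne_of_mem_erase hk]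

/-- The operator solves `∂_i R = ∑ A_ij z_j R`. -/
def SolvesGauss (A : Matrix (Mode n) (Mode n) ℂ) (R : Op n) : Prop :=
  ∀ i, dz i R = ∑ j, A i j • zz j R

/-- The factor √(∏ p_i!) passes from coefficients of z^p to coefficients of z^p/√(p!), and the
recursion becomes the differential equation. -/
lemma gaussOp_solves {A : Matrix (Mode n) (Mode n) ℂ} (hA : A.IsSymm) :
    SolvesGauss A (gaussOp A) := by
  intro i
  apply entry_ext
  intro p
  rw [entry_dz, entry_gaussOp, entry_sum, prod_factorial_add_single]
  have h1 : ∀ j, entry (A i j • zz j (gaussOp A)) p =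
      (Real.sqrt (∏ i, (p i).factorial : ℕ) : ℂ) *
        (A i j * if p j = 0 then 0 else gaussCoeff A (p - Pi.single j 1)) := by
    intro j
    rw [entry_smul, entry_zz, entry_gaussOp]
    by_cases hj : p j = 0
    · simp [hj]
    · have h := prod_factorial_add_single (p - Pi.single j 1) j
      rw [sub_single_add_single hj] at h
      have h2 : (p - Pi.single j 1 : Mode n → ℕ) j + 1 = p j := by simp; lia
      rw [h, h2, if_neg hj, Nat.cast_mul, Real.sqrt_mul (by positivity), Complex.ofReal_mul]
      ring
  rw [Finset.sum_congr rfl fun j _ => h1 j, ← Finset.mul_sum, ← gaussCoeff_rec hA, Nat.cast_mul,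
    Real.sqrt_mul (by positivity), Complex.ofReal_mul]
  have := sqrt_mul_self_complex (p i + 1)
  push_cast at this ⊢
  linear_combination (Real.sqrt (∏ i, ((p i).factorial : ℝ)) : ℂ) *
    gaussCoeff A (p + Pi.single i 1) * this

/-- The equation expresses an entry of degree m + 1 through entries of degree m - 1, so everything
is determined by the entry at 0. -/
lemma SolvesGauss.eq_zero {A : Matrix (Mode n) (Mode n) ℂ} {R : Op n} (hR : SolvesGauss A R)
    (h0 : entry R 0 = 0) : R = 0 := by
  apply entry_ext
  intro p
  rw [entry_zero]
  induction hm : deg p using Nat.strong_induction_on generalizing p with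
  | _ m ih =>
    by_cases hp : p = 0
    · rw [hp, h0]
    · obtain ⟨q, i, rfl⟩ := exists_eq_add_single hp
      rw [deg_add_single] at hm
      have h1 := congrArg (fun T => entry T q) (hR i)
      simp only [entry_dz, entry_sum, entry_smul, entry_zz] at h1
      rw [Finset.sum_eq_zero] at h1
      · have h2 := sqrt_succ_ne_zero_complex (q i)
        push_cast at h2
        exact (mul_eq_zero.mp h1).resolve_left h2
      · intro j _
        by_cases hj : q j = 0
        · simp [hj]
        · have h5 := deg_add_single (q - Pi.single j 1) j
          rw [sub_single_add_single hj] at h5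
          rw [ih (deg (q - Pi.single j 1)) (by lia) _ rfl, mul_zero, mul_zero]

lemma SolvesGauss.sub_smul {A : Matrix (Mode n) (Mode n) ℂ} {R R' : Op n} (hR : SolvesGauss A R)
    (hR' : SolvesGauss A R') (c : ℂ) : SolvesGauss A (R - c • R') := by
  intro i
  simp only [map_sub, map_smul, hR i, hR' i, smul_sub, Finset.sum_sub_distrib, Finset.smul_sum,
    smul_comm c]

lemma SolvesGauss.eq_smul {A : Matrix (Mode n) (Mode n) ℂ} {R R' : Op n} (hR : SolvesGauss A R)
    (hR' : SolvesGauss A R') (h1 : entry R' 0 = 1) : R = entry R 0 • R' := by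
  rw [← sub_eq_zero]
  apply (hR.sub_smul hR' _).eq_zero
  simp [h1]

lemma entry_gaussOp_zero (A : Matrix (Mode n) (Mode n) ℂ) : entry (gaussOp A) 0 = 1 := by
  rw [entry_gaussOp, gaussCoeff_zero]
  simp

/-! ### Rapid decrease of Gaussian operators -/

/-- The square sum of the matrix elements of total degree `K`. -/
def levelSum (R : Op n) (K : ℕ) : ℝ :=
  ∑ p ∈ Finset.piAntidiag (Finset.univ : Finset (Mode n)) K, ‖entry R p‖ ^ 2

lemma mem_piAntidiag_univ {K : ℕ} {p : Mode n → ℕ} :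
    p ∈ Finset.piAntidiag (Finset.univ : Finset (Mode n)) K ↔ deg p = K := by
  simp [Finset.mem_piAntidiag, deg]

lemma norm_sqrt_mul_sq (m : ℕ) (z : ℂ) : ‖(Real.sqrt m : ℂ) * z‖ ^ 2 = m * ‖z‖ ^ 2 := by
  rw [norm_mul, mul_pow, Complex.norm_real, Real.norm_of_nonneg (Real.sqrt_nonneg _),
    Real.sq_sqrt (by positivity)]

lemma sum_shift (f : (Mode n → ℕ) → Mode n → ℝ) (hf : ∀ p i, p i = 0 → f p i = 0) (K : ℕ) :
    ∑ p ∈ Finset.piAntidiag (Finset.univ : Finset (Mode n)) K, ∑ i, f (p + Pi.single i 1) i =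
      ∑ p ∈ Finset.piAntidiag (Finset.univ : Finset (Mode n)) (K + 1), ∑ i, f p i := by
  rw [Finset.sum_comm, Finset.sum_comm (s := Finset.piAntidiag _ (K + 1))]
  refine Finset.sum_congr rfl fun i _ => ?_
  refine Finset.sum_bij_ne_zero (fun p _ _ => p + Pi.single i 1) ?_ ?_ ?_ ?_
  · intro p hp _
    rw [mem_piAntidiag_univ] at *
    rw [deg_add_single, hp]
  · intro p _ _ q _ _ h
    exact add_right_cancel h
  · intro p hp h
    have hi : p i ≠ 0 := fun h0 => h (hf p i h0)
    refine ⟨p - Pi.single i 1, ?_, ?_, sub_single_add_single hi⟩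
    · rw [mem_piAntidiag_univ] at *
      have := deg_add_single (p - Pi.single i 1) i
      rw [sub_single_add_single hi] at this
      lia
    · rwa [sub_single_add_single hi]
  · intro p _ _
    rfl

/-- An entry at `p` of degree K + 1 is reached once for each variable i, with weight p i; the
weights add up to K + 1. -/
lemma sum_norm_dz (R : Op n) (K : ℕ) :
    ∑ p ∈ Finset.piAntidiag (Finset.univ : Finset (Mode n)) K, ∑ i, ‖entry (dz i R) p‖ ^ 2 =
      (K + 1) * levelSum R (K + 1) := by
  have h1 : ∀ p : Mode n → ℕ, ∀ i, ‖entry (dz i R) p‖ ^ 2 =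
      ((p + Pi.single i 1 : Mode n → ℕ) i : ℝ) * ‖entry R (p + Pi.single i 1)‖ ^ 2 := by
    intro p i
    rw [entry_dz, ← norm_sqrt_mul_sq]
    simp
  simp only [h1]
  rw [sum_shift (fun p i => (p i : ℝ) * ‖entry R p‖ ^ 2) (fun p i h => by simp [h]), levelSum,
    Finset.mul_sum]
  refine Finset.sum_congr rfl fun p hp => ?_
  rw [mem_piAntidiag_univ, deg] at hp
  rw [← Finset.sum_mul]
  congr 1
  exact_mod_cast hp

/-- Here an entry of degree K receives the weights p i + 1, whose sum over the 2n variables is K +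
2n. -/
lemma sum_norm_zz (R : Op n) (K : ℕ) :
    ∑ p ∈ Finset.piAntidiag (Finset.univ : Finset (Mode n)) (K + 1), ∑ i, ‖entry (zz i R) p‖ ^ 2 =
      (K + 2 * n) * levelSum R K := by
  rw [← sum_shift (fun p i => ‖entry (zz i R) p‖ ^ 2) (fun p i h => by simp [entry_zz, h]),
    levelSum, Finset.mul_sum]
  refine Finset.sum_congr rfl fun p hp => ?_
  rw [mem_piAntidiag_univ, deg] at hp
  have h1 : ∀ i, ‖entry (zz i R) (p + Pi.single i 1)‖ ^ 2 = ((p i : ℝ) + 1) * ‖entry R p‖ ^ 2 := by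
    intro i
    rw [entry_zz, norm_sqrt_mul_sq, add_tsub_cancel_right]
    simp
  simp only [h1]
  rw [← Finset.sum_mul, Finset.sum_add_distrib]
  congr 1
  have : (∑ i, (p i : ℝ)) = K := by exact_mod_cast hp
  rw [this]
  simp
  ring

lemma levelSum_nonneg (R : Op n) (K : ℕ) : 0 ≤ levelSum R K :=
  Finset.sum_nonneg fun _ _ => by positivity

lemma bddAbove_of_eventually_le {u : ℕ → ℝ} {K₀ : ℕ} (h : ∀ K ≥ K₀, u (K + 2) ≤ u K) :
    ∃ C, ∀ K, u K ≤ C := by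
  refine ⟨∑ K ∈ Finset.range (K₀ + 2), |u K|, fun K => ?_⟩
  induction K using Nat.strong_induction_on with
  | _ K ih =>
    by_cases hK : K < K₀ + 2
    · exact (le_abs_self _).trans (Finset.single_le_sum (f := fun K => |u K|)
        (fun _ _ => abs_nonneg _) (Finset.mem_range.mpr hK))
    · obtain ⟨m, rfl⟩ : ∃ m, K = m + 2 := ⟨K - 2, by lia⟩
      exact (h m (by lia)).trans (ih m (by lia))

/-- Applying the contraction to the vectors (z_j R)_j bounds the level sum S(K + 2) by r (K + 2n)/(K
+ 2) times S(K). The ratio tends to r < 1, so S decays geometrically and beats every power. -/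
lemma SolvesGauss.mem_rapid {A : Matrix (Mode n) (Mode n) ℂ} {R : Op n} (hR : SolvesGauss A R)
    {r : ℝ} (hr : r < 1) (hA : ∀ x : Mode n → ℂ, ∑ i, ‖(A *ᵥ x) i‖ ^ 2 ≤ r * ∑ i, ‖x i‖ ^ 2) :
    R ∈ rapid n := by
  have h1 : ∀ K : ℕ, (K + 2 : ℝ) * levelSum R (K + 2) ≤ r * ((K + 2 * n) * levelSum R K) := by
    intro K
    have := sum_norm_dz R (K + 1)
    push_cast at this
    rw [add_assoc, one_add_one_eq_two] at this
    rw [← this, ← sum_norm_zz, Finset.mul_sum]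
    refine Finset.sum_le_sum fun p _ => ?_
    refine le_trans (le_of_eq ?_) (hA fun j => entry (zz j R) p)
    refine Finset.sum_congr rfl fun i _ => ?_
    rw [hR i, entry_sum]
    rfl
  rw [QuasiFreeBoson.mem_rapid, isRapidlyDecreasing_iff]
  intro k
  -- The polynomial weight grows from K to K + 2 by a ratio tending to 1, so the weighted level sums
  -- eventually decrease along each parity class.
  have hlim : Filter.Tendsto (fun K : ℕ => ((3 + K : ℝ) / (1 + K)) ^ (2 * k) *
      (r * ((2 * n + K) / (2 + K)))) Filter.atTop (nhds r) := by
    have e1 := tendsto_add_mul_div_add_mul_atTop_nhds (3 : ℝ) 1 1 (one_ne_zero)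
    have e2 := tendsto_add_mul_div_add_mul_atTop_nhds (2 * n : ℝ) 2 1 (one_ne_zero)
    have := (e1.pow (2 * k)).mul (e2.const_mul r)
    simpa using this
  obtain ⟨K₀, hK₀⟩ := Filter.eventually_atTop.mp (hlim.eventually_lt_const hr)
  obtain ⟨C, hC⟩ := bddAbove_of_eventually_le (u := fun K => (1 + (K : ℝ)) ^ (2 * k) * levelSum R K)
    (K₀ := K₀) fun K hK => by
      have h2 := hK₀ K hK
      have h3 := h1 K
      have h4 := levelSum_nonneg R K
      have e : levelSum R (K + 2) ≤ r * ((2 * n + K) / (2 + K)) * levelSum R K := by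
        have : (0 : ℝ) < 2 + K := by positivity
        rw [← mul_le_mul_iff_right₀ this]
        calc (2 + K : ℝ) * levelSum R (K + 2) = (K + 2 : ℝ) * levelSum R (K + 2) := by ring
          _ ≤ _ := h3
          _ = _ := by field_simp; ring
      calc (1 + ((K + 2 : ℕ) : ℝ)) ^ (2 * k) * levelSum R (K + 2)
          ≤ (1 + ((K + 2 : ℕ) : ℝ)) ^ (2 * k) *
            (r * ((2 * n + K) / (2 + K)) * levelSum R K) := by gcongr
        _ = (((3 + K : ℝ) / (1 + K)) ^ (2 * k) * (r * ((2 * n + K) / (2 + K)))) *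
              ((1 + (K : ℝ)) ^ (2 * k) * levelSum R K) := by
            rw [div_pow]
            have : (1 + (K : ℝ)) ^ (2 * k) ≠ 0 := by positivity
            push_cast
            field_simp
            ring
        _ ≤ 1 * ((1 + (K : ℝ)) ^ (2 * k) * levelSum R K) := by gcongr
        _ = _ := one_mul _
  refine ⟨Real.sqrt C, fun p => Real.le_sqrt_of_sq_le ?_⟩
  refine le_trans ?_ (hC (deg p))
  rw [mul_pow, ← pow_mul, mul_comm k 2]
  gcongr
  exact Finset.single_le_sum (f := fun p => ‖entry R p‖ ^ 2) (fun _ _ => by positivity)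
    (mem_piAntidiag_univ.mpr rfl)

/-! ### Positivity of Gaussian operators -/

section Positivity
open MvPolynomial

section General
variable {ι : Type*} [Fintype ι]

/-- Truncated exponentials multiply exactly up to high degrees: in degree deg p only pairs of
exponents with sum deg p / 2 contribute, and both truncations contain all of them. -/
lemma coeff_mul_truncExp {a b : MvPolynomial ι ℂ} (ha : a.IsHomogeneous 2) (hb : b.IsHomogeneous 2)
    {p : ι → ℕ} {M : ℕ} (hM : deg p < M) :
    coeff (toFinsupp p) (truncExp M (a + b)) =
      coeff (toFinsupp p) (truncExp M a * truncExp M b) := by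
  classical
  let f : ℕ × ℕ → ℂ := fun x => ((x.1.factorial : ℂ)⁻¹ * (x.2.factorial : ℂ)⁻¹) *
    coeff (toFinsupp p) (a ^ x.1 * b ^ x.2)
  have hf : ∀ x : ℕ × ℕ, deg p ≠ 2 * (x.1 + x.2) → f x = 0 := by
    intro x hx
    have : (a ^ x.1 * b ^ x.2).IsHomogeneous (2 * (x.1 + x.2)) := by
      rw [mul_add]; exact (ha.pow _).mul (hb.pow _)
    simp only [f, coeff_eq_zero_of_deg_ne this hx, mul_zero]
  have h1 : coeff (toFinsupp p) (truncExp M (a + b)) =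
      ∑ m ∈ Finset.range M, ∑ x ∈ Finset.HasAntidiagonal.antidiagonal m, f x := by
    simp only [truncExp, coeff_sum, coeff_C_mul]
    refine Finset.sum_congr rfl fun m _ => ?_
    rw [(Commute.all a b).add_pow', coeff_sum, Finset.mul_sum]
    refine Finset.sum_congr rfl fun x hx => ?_
    rw [Finset.HasAntidiagonal.mem_antidiagonal] at hx
    rw [← hx, nsmul_eq_mul, ← map_natCast (C (σ := ι) (R := ℂ)), coeff_C_mul, ← mul_assoc]
    simp only [f]
    congr 1
    rw [Nat.cast_add_choose]
    have h0 : ((x.1 + x.2).factorial : ℂ) ≠ 0 := by exact_mod_cast Nat.factorial_ne_zero _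
    field_simp
  have h2 : coeff (toFinsupp p) (truncExp M a * truncExp M b) =
      ∑ x ∈ Finset.range M ×ˢ Finset.range M, f x := by
    simp only [truncExp, Finset.sum_mul_sum, coeff_sum]
    rw [Finset.sum_product]
    refine Finset.sum_congr rfl fun i _ => Finset.sum_congr rfl fun j _ => ?_
    rw [mul_mul_mul_comm, ← C_mul, coeff_C_mul]
  rw [h1, h2]
  have h3 : ∀ m, m ≠ deg p / 2 → ∑ x ∈ Finset.HasAntidiagonal.antidiagonal m, f x = 0 := by
    intro m hm
    refine Finset.sum_eq_zero fun x hx => hf x ?_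
    rw [Finset.HasAntidiagonal.mem_antidiagonal] at hx
    lia
  rw [Finset.sum_eq_single (deg p / 2) (fun m _ hm => h3 m hm)
    fun h => absurd (Finset.mem_range.mpr (by lia)) h]
  refine Finset.sum_subset ?_ fun x _ hx => hf x ?_
  · intro x hx
    rw [Finset.HasAntidiagonal.mem_antidiagonal] at hx
    rw [Finset.mem_product, Finset.mem_range, Finset.mem_range]
    lia
  · rw [Finset.HasAntidiagonal.mem_antidiagonal] at hx
    lia

end General

lemma rename_truncExp {σ τ : Type*} (f : σ → τ) (M : ℕ) (q : MvPolynomial σ ℂ) :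
    truncExp M (rename f q) = rename f (truncExp M q) := by
  simp [truncExp, map_sum]

lemma map_truncExp {σ : Type*} (M : ℕ) (q : MvPolynomial σ ℂ) :
    map (starRingEnd ℂ) (truncExp M q) = truncExp M (map (starRingEnd ℂ) q) := by
  simp [truncExp, map_sum, map_C]

lemma coeff_rename_mul_rename (P Q : MvPolynomial (Fin n) ℂ) (α β : Occ n) :
    coeff (toFinsupp (Sum.elim α β)) (rename Sum.inl P * rename Sum.inr Q) =
      coeff (toFinsupp α) P * coeff (toFinsupp β) Q := by
  induction P using MvPolynomial.induction_on' with
  | add P P' h h' => rw [map_add, add_mul, coeff_add, h, h', coeff_add, add_mul]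
  | monomial a x =>
    induction Q using MvPolynomial.induction_on' with
    | add Q Q' h h' => rw [map_add, mul_add, coeff_add, h, h', coeff_add, mul_add]
    | monomial b y =>
      rw [rename_monomial, rename_monomial, monomial_mul, coeff_monomial, coeff_monomial,
        coeff_monomial]
      have : Finsupp.mapDomain Sum.inl a + Finsupp.mapDomain Sum.inr b =
          toFinsupp (Sum.elim α β) ↔ a = toFinsupp α ∧ b = toFinsupp β := by
        simp only [DFunLike.ext_iff, Sum.forall, Finsupp.add_apply,
          Finsupp.mapDomain_apply Sum.inl_injective, Finsupp.mapDomain_apply Sum.inr_injective,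
          Finsupp.equivFunOnFinite_symm_apply_apply, Sum.elim_inl, Sum.elim_inr]
        have h1 : ∀ i, (Finsupp.mapDomain Sum.inr b) (Sum.inl i : Mode n) = 0 := fun i =>
          Finsupp.mapDomain_of_notMem_range _ _ (by simp)
        have h2 : ∀ i, (Finsupp.mapDomain Sum.inl a) (Sum.inr i : Mode n) = 0 := fun i =>
          Finsupp.mapDomain_of_notMem_range _ _ (by simp)
        simp only [h1, h2, add_zero, zero_add]
      simp only [this]
      by_cases h : a = toFinsupp α <;> by_cases h' : b = toFinsupp β <;> simp [h, h']

open scoped ComplexOrder in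
/-- A Gaussian operator is positive semidefinite if its cross block is a Gram matrix and its
diagonal blocks are conjugate to each other. -/
lemma gaussOp_posSemidef {A : Matrix (Mode n) (Mode n) ℂ} (hA : A.IsSymm)
    (hconj : ∀ i j, A (Sum.inr i) (Sum.inr j) = star (A (Sum.inl i) (Sum.inl j)))
    (Lc : Matrix (Fin n) (Fin n) ℂ)
    (hL : ∀ i j, A (Sum.inl i) (Sum.inr j) = ∑ l, Lc i l * star (Lc j l)) :
    (gaussOp A).PosSemidef := by
  let qu : MvPolynomial (Fin n) ℂ := quadPoly (Matrix.of fun i j => A (Sum.inl i) (Sum.inl j))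
  let ell : Fin n → MvPolynomial (Fin n) ℂ := fun l => ∑ i, C (Lc i l) * X i
  let conj := map (σ := Fin n) (starRingEnd ℂ)
  let qc : MvPolynomial (Mode n) ℂ := ∑ l, rename Sum.inl (ell l) * rename Sum.inr (conj (ell l))
  have hq : quadPoly A = (rename Sum.inl qu + rename Sum.inr (conj qu)) + qc := by
    have e1 : rename Sum.inl qu = ∑ i, ∑ j, C (A (Sum.inl i) (Sum.inl j) / 2) *
        (X (Sum.inl i : Mode n) * X (Sum.inl j)) := by
      simp [qu, quadPoly, map_sum]
    have e2 : rename Sum.inr (conj qu) = ∑ i, ∑ j, C (A (Sum.inr i) (Sum.inr j) / 2) *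
        (X (Sum.inr i : Mode n) * X (Sum.inr j)) := by
      simp [qu, conj, quadPoly, map_sum, map_C, hconj, map_ofNat]
    have e3 : qc = ∑ i, ∑ j, C (A (Sum.inl i) (Sum.inr j)) *
        (X (Sum.inl i : Mode n) * X (Sum.inr j)) := by
      simp only [qc, conj, ell, map_sum, map_mul, map_C, map_X, rename_C, rename_X,
        Finset.sum_mul_sum]
      simp only [hL, map_sum, map_mul, Finset.sum_mul]
      rw [Finset.sum_comm]
      refine Finset.sum_congr rfl fun i _ => ?_
      rw [Finset.sum_comm]
      refine Finset.sum_congr rfl fun j _ => Finset.sum_congr rfl fun l _ => ?_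
      simp only [Complex.star_def]
      ring
    -- The two off-diagonal blocks of `A` agree by symmetry, and each contributes one half of the
    -- cross term.
    have e4 : ∑ i, ∑ j, C (A (Sum.inr i) (Sum.inl j) / 2) *
        (X (Sum.inr i : Mode n) * X (Sum.inl j)) = ∑ i, ∑ j, C (A (Sum.inl i) (Sum.inr j) / 2) *
        (X (Sum.inl i : Mode n) * X (Sum.inr j)) := by
      rw [Finset.sum_comm]
      refine Finset.sum_congr rfl fun i _ => Finset.sum_congr rfl fun j _ => ?_
      rw [hA.apply, mul_comm (X _) (X _)]
    have e5 : qc = (∑ i, ∑ j, C (A (Sum.inl i) (Sum.inr j) / 2) *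
        (X (Sum.inl i : Mode n) * X (Sum.inr j))) + ∑ i, ∑ j, C (A (Sum.inl i) (Sum.inr j) / 2) *
        (X (Sum.inl i : Mode n) * X (Sum.inr j)) := by
      rw [e3, ← Finset.sum_add_distrib]
      refine Finset.sum_congr rfl fun i _ => ?_
      rw [← Finset.sum_add_distrib]
      refine Finset.sum_congr rfl fun j _ => ?_
      rw [← add_mul, ← C_add, add_halves]
    rw [e1, e2, e5, quadPoly]
    simp only [Fintype.sum_sum_type, Finset.sum_add_distrib]
    rw [e4]
    ring
  have hqu : qu.IsHomogeneous 2 := quadPoly_isHomogeneous _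
  have hqu' : (conj qu).IsHomogeneous 2 := hqu.map _
  have hell : ∀ l, (ell l).IsHomogeneous 1 := fun l =>
    IsHomogeneous.sum _ _ _ fun i _ => isHomogeneous_C_mul_X _ _
  have hqc : qc.IsHomogeneous 2 := IsHomogeneous.sum _ _ _ fun l _ =>
    ((hell l).rename_isHomogeneous).mul (((hell l).map _).rename_isHomogeneous)
  -- the vectors of the Gram representation
  let g : ℕ → (k : ℕ) → (Fin k → Fin n) → Occ n → ℂ := fun M k s α =>
    (Real.sqrt (∏ i, (α i).factorial : ℕ) : ℂ) *
      coeff (toFinsupp α) (truncExp M qu * ∏ m, ell (s m))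
  have hR : ∀ (α β : Occ n) (M : ℕ), deg (Sum.elim α β) < M → gaussOp A α β =
      ∑ k ∈ Finset.range M, ∑ s : Fin k → Fin n, ((k.factorial : ℂ)⁻¹) *
        (g M k s α * star (g M k s β)) := by
    intro α β M hM
    -- The power (Σ_l ℓ_l ℓ̄_l)^k expands over words s of length k. Each word contributes a
    -- polynomial in the row variables times its conjugate in the column variables, hence a rank-one
    -- positive term.
    have e0 : truncExp M (rename Sum.inl qu) * truncExp M (rename Sum.inr (conj qu)) *
        truncExp M qc = ∑ k ∈ Finset.range M, ∑ s : Fin k → Fin n, C ((k.factorial : ℂ)⁻¹) *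
          (rename Sum.inl (truncExp M qu * ∏ m, ell (s m)) *
            rename Sum.inr (conj (truncExp M qu * ∏ m, ell (s m)))) := by
      rw [truncExp.eq_1 M qc, Finset.mul_sum]
      refine Finset.sum_congr rfl fun k _ => ?_
      have : qc ^ k = ∑ s : Fin k → Fin n, ∏ m,
          (rename Sum.inl (ell (s m)) * rename Sum.inr (conj (ell (s m)))) := by
        exact Fintype.sum_pow (fun l => rename Sum.inl (ell l) * rename Sum.inr (conj (ell l))) k
      rw [this, Finset.mul_sum, Finset.mul_sum]
      refine Finset.sum_congr rfl fun s _ => ?_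
      simp only [rename_truncExp, map_mul, map_prod, conj, map_truncExp, Finset.prod_mul_distrib]
      ring
    have e1 : coeff (toFinsupp (Sum.elim α β)) (truncExp M (quadPoly A)) =
        coeff (toFinsupp (Sum.elim α β)) (truncExp M (rename Sum.inl qu) *
          truncExp M (rename Sum.inr (conj qu)) * truncExp M qc) := by
      have hab := hqu.rename_isHomogeneous (f := (Sum.inl : Fin n → Mode n))
      have hab' := hqu'.rename_isHomogeneous (f := (Sum.inr : Fin n → Mode n))
      rw [hq, coeff_mul_truncExp (hab.add hab') hqc hM, coeff_mul, coeff_mul]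
      refine Finset.sum_congr rfl fun x hx => ?_
      congr 1
      have hx1 : x.1 = toFinsupp (x.1 : Mode n → ℕ) := by ext; simp
      rw [hx1]
      refine coeff_mul_truncExp hab hab' (lt_of_le_of_lt ?_ hM)
      rw [Finset.HasAntidiagonal.mem_antidiagonal] at hx
      refine Finset.sum_le_sum fun i _ => ?_
      have := DFunLike.congr_fun hx i
      simp only [Finsupp.add_apply, Finsupp.equivFunOnFinite_symm_apply_apply] at this
      lia
    rw [gaussOp, Matrix.of_apply, gaussCoeff_eq A hM, e1, e0, coeff_sum, Finset.mul_sum]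
    refine Finset.sum_congr rfl fun k _ => ?_
    rw [coeff_sum, Finset.mul_sum]
    refine Finset.sum_congr rfl fun s _ => ?_
    rw [coeff_C_mul, coeff_rename_mul_rename]
    have e2 : (Real.sqrt (∏ i, (Sum.elim α β i).factorial : ℕ) : ℂ) =
        (Real.sqrt (∏ i, (α i).factorial : ℕ) : ℂ) * (Real.sqrt (∏ i, (β i).factorial : ℕ) : ℂ) := by
      rw [← Complex.ofReal_mul, ← Real.sqrt_mul (by positivity), ← Nat.cast_mul,
        Fintype.prod_sum_type]
      simp
    simp only [g, conj, coeff_map, e2, star_mul', Complex.star_def, Complex.conj_ofReal]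
    ring
  refine ⟨?_, fun x => ?_⟩
  · ext α β
    rw [Matrix.conjTranspose_apply, hR β α (deg (Sum.elim β α) + deg (Sum.elim α β) + 1) (by lia),
      hR α β (deg (Sum.elim β α) + deg (Sum.elim α β) + 1) (by lia), star_sum]
    refine Finset.sum_congr rfl fun k _ => ?_
    rw [star_sum]
    refine Finset.sum_congr rfl fun s _ => ?_
    simp [mul_comm]
  -- One truncation order that exceeds all degrees occurring in the finite support.
  · let M := ∑ α ∈ x.support, ∑ β ∈ x.support, deg (Sum.elim α β) + 1
    have hM : ∀ α ∈ x.support, ∀ β ∈ x.support, deg (Sum.elim α β) < M := by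
      intro α hα β hβ
      have h1 := Finset.single_le_sum (f := fun β => deg (Sum.elim α β))
        (fun _ _ => Nat.zero_le _) hβ
      have h2 := Finset.single_le_sum (f := fun α => ∑ β ∈ x.support, deg (Sum.elim α β))
        (fun _ _ => Nat.zero_le _) hα
      simp only [M]
      lia
    have key : (x.sum fun i xi => x.sum fun j xj => star xi * gaussOp A i j * xj) =
        ∑ k ∈ Finset.range M, ∑ s : Fin k → Fin n, ((k.factorial : ℂ)⁻¹) *
          (star (∑ α ∈ x.support, star (g M k s α) * x α) *
            ∑ β ∈ x.support, star (g M k s β) * x β) := by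
      simp only [Finsupp.sum]
      have e : ∀ α ∈ x.support, ∀ β ∈ x.support, star (x α) * gaussOp A α β * x β =
          ∑ k ∈ Finset.range M, ∑ s : Fin k → Fin n, ((k.factorial : ℂ)⁻¹) *
            ((g M k s α * star (x α)) * (star (g M k s β) * x β)) := by
        intro α hα β hβ
        rw [hR α β M (hM α hα β hβ), Finset.mul_sum, Finset.sum_mul]
        refine Finset.sum_congr rfl fun k _ => ?_
        rw [Finset.mul_sum, Finset.sum_mul]
        refine Finset.sum_congr rfl fun s _ => ?_
        ring
      rw [Finset.sum_congr rfl fun α hα => Finset.sum_congr rfl fun β hβ => e α hα β hβ]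
      rw [Finset.sum_congr rfl fun α _ => Finset.sum_comm, Finset.sum_comm]
      refine Finset.sum_congr rfl fun k _ => ?_
      rw [Finset.sum_congr rfl fun α _ => Finset.sum_comm, Finset.sum_comm]
      refine Finset.sum_congr rfl fun s _ => ?_
      simp only [star_sum, star_mul', star_star]
      rw [Finset.sum_mul_sum, Finset.mul_sum]
      simp only [Finset.mul_sum]
    rw [key]
    refine Finset.sum_nonneg fun k _ => Finset.sum_nonneg fun s _ => mul_nonneg ?_ ?_
    · rw [← Complex.ofReal_natCast, ← Complex.ofReal_inv]
      exact Complex.zero_le_real.mpr (by positivity)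
    · exact star_mul_self_nonneg _

end Positivity

/-! ### The Gaussian right vacuum -/

section ToC
variable {ι κ l : Type*}

lemma toC_mul [Fintype κ] (A : Matrix ι κ ℝ) (B : Matrix κ l ℝ) : toC (A * B) = toC A * toC B := by
  ext i j; simp [toC, Matrix.mul_apply]

lemma toC_one [DecidableEq ι] : toC (1 : Matrix ι ι ℝ) = 1 := by
  ext i j; simp [toC, Matrix.one_apply, apply_ite]

lemma toC_add (A B : Matrix ι κ ℝ) : toC (A + B) = toC A + toC B := by
  ext i j; simp [toC]

lemma toC_sub (A B : Matrix ι κ ℝ) : toC (A - B) = toC A - toC B := by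
  ext i j; simp [toC]

lemma toC_smul (c : ℝ) (A : Matrix ι κ ℝ) : toC (c • A) = (c : ℂ) • toC A := by
  ext i j; simp [toC]

lemma toC_transpose (A : Matrix ι κ ℝ) : toC Aᵀ = (toC A)ᵀ := by
  ext i j; simp [toC]

lemma toC_conjTranspose (A : Matrix ι κ ℝ) : (toC A)ᴴ = toC Aᵀ := by
  ext i j; simp [toC]

end ToC

open scoped MatrixOrder in
lemma PosDef.exists_transpose_mul_self {ι : Type*} [Fintype ι] [DecidableEq ι] {Γ : Matrix ι ι ℝ}
    (hΓ : Γ.PosDef) : ∃ B B' : Matrix ι ι ℝ, B' * B = 1 ∧ B * B' = 1 ∧ Γ = Bᵀ * B := by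
  obtain ⟨B, hB⟩ := CStarAlgebra.nonneg_iff_eq_star_mul_self.mp hΓ.posSemidef.nonneg
  rw [Matrix.star_eq_conjTranspose, Matrix.conjTranspose_eq_transpose_of_trivial] at hB
  have hu : IsUnit B.det := by
    have := (Matrix.isUnit_iff_isUnit_det _).mp hΓ.isUnit
    rw [hB, Matrix.det_mul] at this
    exact isUnit_of_mul_isUnit_right this
  exact ⟨B, B⁻¹, Matrix.nonsing_inv_mul _ hu, Matrix.mul_nonsing_inv _ hu, hB⟩

lemma sum_norm_sq_mulVec_le {ι κ : Type*} [Fintype ι] [Fintype κ] (M : Matrix ι κ ℂ) (x : κ → ℂ) :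
    ∑ i, ‖(M *ᵥ x) i‖ ^ 2 ≤ (∑ i, ∑ j, ‖M i j‖ ^ 2) * ∑ j, ‖x j‖ ^ 2 := by
  rw [Finset.sum_mul]
  refine Finset.sum_le_sum fun i _ => ?_
  calc ‖(M *ᵥ x) i‖ ^ 2 ≤ (∑ j, ‖M i j‖ * ‖x j‖) ^ 2 := by
        gcongr
        refine (norm_sum_le _ _).trans_eq ?_
        simp
    _ ≤ _ := Finset.sum_mul_sq_le_sq_mul_sq _ _ _

/-- If C is the square sum of the left inverse, then ‖x‖² ≤ C ‖Fx‖². Using 1 + C keeps the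
denominator positive. -/
lemma exists_le_sum_norm_sq_mulVec {ι κ : Type*} [Fintype ι] [Fintype κ] [DecidableEq κ]
    {F : Matrix ι κ ℂ} {F' : Matrix κ ι ℂ} (h : F' * F = 1) :
    ∃ c : ℝ, 0 < c ∧ ∀ x, c * ∑ i, ‖x i‖ ^ 2 ≤ ∑ i, ‖(F *ᵥ x) i‖ ^ 2 := by
  set C := ∑ i, ∑ j, ‖F' i j‖ ^ 2
  have hC : 0 ≤ C := by positivity
  refine ⟨1 / (1 + C), by positivity, fun x => ?_⟩
  have := sum_norm_sq_mulVec_le F' (F *ᵥ x)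
  rw [Matrix.mulVec_mulVec, h, Matrix.one_mulVec] at this
  rw [one_div, inv_mul_le_iff₀ (by positivity)]
  have h0 : 0 ≤ ∑ i, ‖(F *ᵥ x) i‖ ^ 2 := by positivity
  nlinarith

lemma sum_norm_sq_eq {ι : Type*} [Fintype ι] (x : ι → ℂ) :
    ((∑ i, ‖x i‖ ^ 2 : ℝ) : ℂ) = star x ⬝ᵥ x := by
  push_cast
  refine Finset.sum_congr rfl fun i _ => ?_
  simp [Complex.conj_mul']

open scoped ComplexOrder in
/-- The uncertainty relation in terms of the symplectic eigenvalues. -/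
lemma IsPhysical.posSemidef_sub_tau {Γ : Matrix (Mode n) (Mode n) ℝ} (hΓ : IsPhysical Γ) :
    ((2 : ℂ) • toC Γ - tau n).PosSemidef := by
  obtain ⟨B, B', h1, h2, hB⟩ := PosDef.exists_transpose_mul_self hΓ.1
  replace h1 : toC B' * toC B = 1 := by rw [← toC_mul, h1, toC_one]
  replace h2 : toC B * toC B' = 1 := by rw [← toC_mul, h2, toC_one]
  have hG : toC Γ = (toC B)ᴴ * toC B := by rw [hB, toC_mul, toC_conjTranspose]
  have h1' : (toC B)ᴴ * (toC B')ᴴ = 1 := by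
    rw [← Matrix.conjTranspose_mul, h1, Matrix.conjTranspose_one]
  have hτ : (tau n)ᴴ = tau n := by
    simp [tau, Matrix.fromBlocks_conjTranspose]
  set N : Matrix (Mode n) (Mode n) ℂ := (toC B')ᴴ * tau n * toC B' with hN
  have hH : (((2 : ℂ) • 1 : Matrix (Mode n) (Mode n) ℂ) - N).IsHermitian := by
    simp [Matrix.IsHermitian, hN, Matrix.conjTranspose_mul, hτ, Matrix.mul_assoc]
  have e : (2 : ℂ) • toC Γ - tau n = (toC B)ᴴ * ((2 : ℂ) • 1 - N) * toC B := by
    have : (toC B)ᴴ * N * toC B = tau n := by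
      calc (toC B)ᴴ * N * toC B = ((toC B)ᴴ * (toC B')ᴴ) * tau n * (toC B' * toC B) := by
            simp only [hN, Matrix.mul_assoc]
        _ = _ := by rw [h1', h1, Matrix.one_mul, Matrix.mul_one]
    rw [Matrix.mul_sub, Matrix.sub_mul, this, hG]
    simp
  rw [e]
  refine Matrix.PosSemidef.conjTranspose_mul_mul_same ?_ _
  rw [hH.posSemidef_iff_eigenvalues_nonneg]
  intro i
  -- A negative eigenvalue ev of 2 - N makes 2 - ev > 2 an eigenvalue of N with eigenvector v. As τ²
  -- = 1, B'v is then an eigenvector of τΓ with eigenvalue 1/(2 - ev) < 1/2, which is excluded.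
  by_contra! hneg
  simp only [Pi.zero_apply] at hneg
  set ev := hH.eigenvalues i
  set v : Mode n → ℂ := (hH.eigenvectorBasis i).ofLp with hv
  have hv0 : v ≠ 0 := by
    intro h
    apply hH.eigenvectorBasis.orthonormal.ne_zero i
    ext k
    exact congrFun h k
  have hev := hH.mulVec_eigenvectorBasis i
  have hNv : N *ᵥ v = ((2 - ev : ℝ) : ℂ) • v := by
    have : ((2 : ℂ) • 1 - N) *ᵥ v = (ev : ℂ) • v := by
      rw [hv, hev]; ext k; simp [ev]
    rw [Matrix.sub_mulVec, Matrix.smul_mulVec, Matrix.one_mulVec] at this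
    rw [← sub_eq_iff_eq_add'.mpr (sub_eq_iff_eq_add.mp this)]
    push_cast
    rw [sub_smul]
  have hpos : (0 : ℝ) < 2 - ev := by linarith
  have hne : ((2 - ev : ℝ) : ℂ) ≠ 0 := by exact_mod_cast hpos.ne'
  have hτB : tau n *ᵥ (toC B' *ᵥ v) = ((2 - ev : ℝ) : ℂ) • ((toC B)ᴴ *ᵥ v) := by
    rw [← Matrix.mulVec_smul, ← hNv, Matrix.mulVec_mulVec, Matrix.mulVec_mulVec, hN,
      ← Matrix.mul_assoc, ← Matrix.mul_assoc, h1', Matrix.one_mul]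
  have hw0 : toC B' *ᵥ v ≠ 0 := by
    intro h
    apply hv0
    rw [← Matrix.one_mulVec v, ← h2, ← Matrix.mulVec_mulVec, h, Matrix.mulVec_zero]
  have heig : (tau n * toC Γ) *ᵥ (toC B' *ᵥ v) =
      (((2 - ev : ℝ)⁻¹ : ℝ) : ℂ) • (toC B' *ᵥ v) := by
    have : toC B' *ᵥ v = ((2 - ev : ℝ) : ℂ) • tau n *ᵥ ((toC B)ᴴ *ᵥ v) := by
      rw [← Matrix.mulVec_smul, ← hτB, Matrix.mulVec_mulVec (v := toC B' *ᵥ v), tau_mul_tau, Matrix.one_mulVec]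
    have h3 : (tau n * toC Γ) *ᵥ (toC B' *ᵥ v) = tau n *ᵥ ((toC B)ᴴ *ᵥ v) := by
      rw [hG, Matrix.mulVec_mulVec, Matrix.mul_assoc, Matrix.mul_assoc, h2, Matrix.mul_one,
        Matrix.mulVec_mulVec]
    rw [Complex.ofReal_inv, eq_inv_smul_iff₀ hne, h3, ← this]
  have hmem : (2 - ev)⁻¹ ∈ symplecticEigenvalues Γ := by
    refine ⟨by positivity, ?_⟩
    refine Module.End.hasEigenvalue_of_hasEigenvector (x := toC B' *ᵥ v) ⟨?_, hw0⟩
    rw [Module.End.mem_eigenspace_iff, Matrix.toLin'_apply, heig]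
  have := hΓ.2 hmem
  rw [Set.mem_Ici, one_div, inv_le_inv₀ (by norm_num) hpos] at this
  linarith

/-- The change of basis from the complex to the real phase-space coordinates. -/
def phaseBasis (n : ℕ) : Matrix (Mode n) (Mode n) ℂ :=
  (1 / (Real.sqrt 2 : ℂ)) •
    Matrix.fromBlocks 1 1 (-Complex.I • (1 : Matrix (Fin n) (Fin n) ℂ)) (Complex.I • 1)

lemma phaseBasis_conj_mul : (phaseBasis n)ᴴ * phaseBasis n = 1 := by
  have h : star (1 / (Real.sqrt 2 : ℂ)) = 1 / (Real.sqrt 2 : ℂ) := by simp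
  rw [phaseBasis, Matrix.conjTranspose_smul, h, Matrix.smul_mul, Matrix.mul_smul, smul_smul,
    one_div_sqrt_two_mul_self, Matrix.fromBlocks_conjTranspose, Matrix.fromBlocks_multiply]
  simp only [Matrix.conjTranspose_one, Matrix.mul_one, Matrix.conjTranspose_smul]
  rw [Matrix.fromBlocks_smul, ← Matrix.fromBlocks_one]
  congr 1 <;> simp [smul_smul, ← two_smul ℂ]

lemma XX_eq (μ : Mode n) : XX μ = ∑ i, phaseBasis n μ i • zz i := by
  rcases μ with j | j
  · simp [XX, phaseBasis, Matrix.one_apply, smul_add]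
  · simp [XX, phaseBasis, Matrix.one_apply, SuperOp.smul_sub, div_eq_inv_mul]
    rw [Finset.sum_eq_single j (fun b _ hb => by simp [Ne.symm hb]) (by simp), if_pos rfl]
    module

lemma DD_eq (μ : Mode n) : DD μ = ∑ i, star (phaseBasis n μ i) • dz i := by
  rcases μ with j | j
  · simp [DD, phaseBasis, Matrix.one_apply, smul_add, apply_ite]
  · simp [DD, phaseBasis, Matrix.one_apply, SuperOp.smul_sub, div_eq_inv_mul, apply_ite]
    module

/-- A matrix acting on a family of operators. -/
def opMulVec {ι κ : Type*} [Fintype κ] (M : Matrix ι κ ℂ) (f : κ → Op n) : ι → Op n :=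
  fun i => ∑ j, M i j • f j

lemma opMulVec_mul {ι κ l : Type*} [Fintype κ] [Fintype l] (M : Matrix ι κ ℂ) (M' : Matrix κ l ℂ)
    (f : l → Op n) : opMulVec (M * M') f = opMulVec M (opMulVec M' f) := by
  funext i
  simp only [opMulVec, Matrix.mul_apply, Finset.sum_smul, Finset.smul_sum, smul_smul]
  exact Finset.sum_comm

lemma opMulVec_one {ι : Type*} [Fintype ι] [DecidableEq ι] (f : ι → Op n) :
    opMulVec (1 : Matrix ι ι ℂ) f = f := by
  funext i
  simp [opMulVec, Matrix.one_apply]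

/-- The vacuum condition thus reads (2Γ + 1) D R = (2Γ - 1) X R, a first-order system that can be
solved for D R. -/
lemma eOp_apply_eq (Γ : Matrix (Mode n) (Mode n) ℝ) (R : Op n) :
    (fun μ => eOp Γ μ R) = (1 / (Real.sqrt 2 : ℂ)) •
      (opMulVec ((2 : ℂ) • toC Γ + 1) (fun μ => DD μ R)
        - opMulVec ((2 : ℂ) • toC Γ - 1) (fun μ => XX μ R)) := by
  funext μ
  simp only [eOp, bOp_eq, bOp'_eq, opMulVec, LinearMap.sub_apply, LinearMap.smul_apply,
    LinearMap.add_apply, LinearMap.sum_apply, Pi.smul_apply, Pi.sub_apply, Matrix.add_apply,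
    Matrix.sub_apply, add_smul, sub_smul, Finset.sum_add_distrib, Finset.sum_sub_distrib,
    Matrix.one_apply, ite_smul, one_smul, zero_smul, Finset.sum_ite_eq, Finset.mem_univ, if_true,
    smul_sub, Finset.smul_sum, toC, Matrix.smul_apply, Matrix.map_apply, smul_eq_mul, smul_smul,
    smul_add]
  have h (f : Mode n → Op n) : ∑ x, (2 * ((Γ μ x : ℂ) * (1 / (Real.sqrt 2 : ℂ)))) • f x =
      ∑ x, (1 / (Real.sqrt 2 : ℂ) * (2 * (Γ μ x : ℂ))) • f x :=
    Finset.sum_congr rfl fun x _ => by congr 1; ring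
  rw [h, h]
  abel

lemma IsPhysical.exists_factor {Γ : Matrix (Mode n) (Mode n) ℝ} (hΓ : IsPhysical Γ) :
    ∃ P' : Matrix (Mode n) (Mode n) ℝ, P' * ((2 : ℝ) • Γ + 1) = 1 ∧ ((2 : ℝ) • Γ + 1) * P' = 1 ∧
      P'ᵀ = P' := by
  have hP : ((2 : ℝ) • Γ + 1).PosDef := (hΓ.1.smul (by norm_num)).add Matrix.PosDef.one
  have hu : IsUnit ((2 : ℝ) • Γ + 1).det := (Matrix.isUnit_iff_isUnit_det _).mp hP.isUnit
  refine ⟨((2 : ℝ) • Γ + 1)⁻¹, Matrix.nonsing_inv_mul _ hu, Matrix.mul_nonsing_inv _ hu, ?_⟩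
  have := hP.inv.isHermitian.eq
  rwa [Matrix.conjTranspose_eq_transpose_of_trivial] at this

lemma IsPhysical.isSymm {Γ : Matrix (Mode n) (Mode n) ℝ} (hΓ : IsPhysical Γ) : Γ.IsSymm := by
  have := hΓ.1.isHermitian.eq
  rwa [Matrix.conjTranspose_eq_transpose_of_trivial] at this

/-- The quadratic form of the right vacuum, in complex phase-space coordinates; `P'` is the
inverse of `2 Γ + 1`. -/
def vacuumForm (P' : Matrix (Mode n) (Mode n) ℝ) : Matrix (Mode n) (Mode n) ℂ :=
  (phaseBasis n)ᵀ * (1 - (2 : ℂ) • toC P') * phaseBasis n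

section VacuumForm

variable {Γ P' : Matrix (Mode n) (Mode n) ℝ}

lemma toC_two_smul_add_one (Γ : Matrix (Mode n) (Mode n) ℝ) :
    toC ((2 : ℝ) • Γ + 1) = (2 : ℂ) • toC Γ + 1 := by
  rw [toC_add, toC_smul, toC_one]; norm_num

lemma phaseBasis_mul_conj : phaseBasis n * (phaseBasis n)ᴴ = 1 :=
  mul_eq_one_comm.mp phaseBasis_conj_mul

lemma phaseBasis_conj_transpose : ((phaseBasis n)ᴴ)ᵀ * (phaseBasis n)ᵀ = 1 := by
  rw [← Matrix.transpose_mul, phaseBasis_mul_conj, Matrix.transpose_one]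

lemma phaseBasis_transpose_mul : (phaseBasis n)ᵀ * ((phaseBasis n)ᴴ)ᵀ = 1 := by
  rw [← Matrix.transpose_mul, phaseBasis_conj_mul, Matrix.transpose_one]

lemma vacuumForm_isSymm (hP : P'ᵀ = P') : (vacuumForm P').IsSymm := by
  simp [Matrix.IsSymm, vacuumForm, Matrix.transpose_mul, ← toC_transpose, hP, Matrix.mul_assoc]

/-- Multiplication by P' solves for the derivatives, because P'(2Γ - 1) = 1 - 2P'; the unitary
`phaseBasis` then passes to the complex variables. -/
lemma solvesGauss_iff (h1 : P' * ((2 : ℝ) • Γ + 1) = 1) (h2 : ((2 : ℝ) • Γ + 1) * P' = 1)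
    (R : Op n) : SolvesGauss (vacuumForm P') R ↔ ∀ μ, eOp Γ μ R = 0 := by
  have hDD : (fun μ => DD μ R) = opMulVec ((phaseBasis n)ᴴ)ᵀ (fun i => dz i R) := by
    funext μ; simp [DD_eq, opMulVec]
  have hXX : (fun μ => XX μ R) = opMulVec (phaseBasis n) (fun i => zz i R) := by
    funext μ; simp [XX_eq, opMulVec]
  replace h1 : toC P' * ((2 : ℂ) • toC Γ + 1) = 1 := by
    rw [← toC_two_smul_add_one, ← toC_mul, h1, toC_one]
  replace h2 : ((2 : ℂ) • toC Γ + 1) * toC P' = 1 := by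
    rw [← toC_two_smul_add_one, ← toC_mul, h2, toC_one]
  have hK : ((2 : ℂ) • toC Γ + 1) * (1 - (2 : ℂ) • toC P') = (2 : ℂ) • toC Γ - 1 := by
    rw [Matrix.mul_sub, Matrix.mul_smul, h2, Matrix.mul_one]; module
  have hK' : toC P' * ((2 : ℂ) • toC Γ - 1) = 1 - (2 : ℂ) • toC P' := by
    rw [← hK, ← Matrix.mul_assoc, h1, Matrix.one_mul]
  have hs : (1 / (Real.sqrt 2 : ℂ)) ≠ 0 := one_div_ne_zero sqrt_two_ne_zero_complex
  have he := eOp_apply_eq Γ R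
  constructor
  · intro h μ
    have h' : (fun i => dz i R) = opMulVec (vacuumForm P') (fun i => zz i R) := funext h
    refine congrFun (f := fun μ => eOp Γ μ R) (g := 0) ?_ μ
    rw [he, hDD, hXX, h', ← opMulVec_mul, ← opMulVec_mul, ← opMulVec_mul, vacuumForm]
    simp only [← Matrix.mul_assoc]
    rw [Matrix.mul_assoc ((2 : ℂ) • toC Γ + 1), phaseBasis_conj_transpose, Matrix.mul_one, hK,
      sub_self, smul_zero]
  · intro h
    have h0 : (fun μ => eOp Γ μ R) = 0 := funext h
    rw [he, smul_eq_zero_iff_right hs, sub_eq_zero] at h0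
    have h3 := congrArg (fun f => opMulVec ((phaseBasis n)ᵀ * toC P') f) h0
    simp only [hDD, hXX, ← opMulVec_mul] at h3
    rw [Matrix.mul_assoc _ (toC P'), ← Matrix.mul_assoc (toC P'), h1, Matrix.one_mul,
      phaseBasis_transpose_mul, opMulVec_one, Matrix.mul_assoc _ (toC P'),
      ← Matrix.mul_assoc (toC P'), hK', ← Matrix.mul_assoc] at h3
    exact fun i => congrFun h3 i

/-- With K = 1 - 2P' one finds 1 - K² = 8 P'ΓP', which is strictly positive. Conjugation by the
unitary `phaseBasis` writes 1 - A†A, for A = `vacuumForm P'`, as F†F with F invertible. -/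
lemma vacuumForm_contraction (hΓ : IsPhysical Γ) (hP : P'ᵀ = P')
    (h1 : P' * ((2 : ℝ) • Γ + 1) = 1) (h2 : ((2 : ℝ) • Γ + 1) * P' = 1) :
    ∃ r : ℝ, r < 1 ∧
      ∀ x : Mode n → ℂ, ∑ i, ‖(vacuumForm P' *ᵥ x) i‖ ^ 2 ≤ r * ∑ i, ‖x i‖ ^ 2 := by
  obtain ⟨B, B', hB1, hB2, hB⟩ := PosDef.exists_transpose_mul_self hΓ.1
  set K : Matrix (Mode n) (Mode n) ℝ := 1 - (2 : ℝ) • P' with hKdef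
  have hK : 1 - K * K = (8 : ℝ) • (P' * Γ * P') := by
    have h3 : K = P' * ((2 : ℝ) • Γ - 1) := by
      have : (2 : ℝ) • Γ - 1 = ((2 : ℝ) • Γ + 1) - (2 : ℝ) • 1 := by module
      rw [this, Matrix.mul_sub, h1, hKdef]; simp
    have h4 : K = ((2 : ℝ) • Γ - 1) * P' := by
      have : (2 : ℝ) • Γ - 1 = ((2 : ℝ) • Γ + 1) - (2 : ℝ) • 1 := by module
      rw [this, Matrix.sub_mul, h2, hKdef]; simp
    have h5 : K * K = P' * (((2 : ℝ) • Γ - 1) * ((2 : ℝ) • Γ - 1)) * P' := by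
      nth_rw 1 [h3]; rw [h4]; simp only [Matrix.mul_assoc]
    have h6 : (1 : Matrix (Mode n) (Mode n) ℝ) =
        P' * (((2 : ℝ) • Γ + 1) * ((2 : ℝ) • Γ + 1)) * P' := by
      rw [Matrix.mul_assoc, Matrix.mul_assoc ((2 : ℝ) • Γ + 1), h2, Matrix.mul_one, h1]
    have h7 : ((2 : ℝ) • Γ + 1) * ((2 : ℝ) • Γ + 1) - ((2 : ℝ) • Γ - 1) * ((2 : ℝ) • Γ - 1) =
        (8 : ℝ) • Γ := by
      simp only [Matrix.mul_add, Matrix.add_mul, Matrix.mul_sub, Matrix.sub_mul, Matrix.mul_one,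
        Matrix.one_mul]
      module
    rw [h5]
    nth_rw 1 [h6]
    rw [← Matrix.sub_mul, ← Matrix.mul_sub, h7, Matrix.mul_smul, Matrix.smul_mul]
  set W := phaseBasis n
  set F : Matrix (Mode n) (Mode n) ℂ := ((Real.sqrt 8 : ℝ) : ℂ) • (toC B * toC P' * W)
  have hs8 : ((Real.sqrt 8 : ℝ) : ℂ) * ((Real.sqrt 8 : ℝ) : ℂ) = 8 := by
    rw [← Complex.ofReal_mul, Real.mul_self_sqrt (by norm_num)]; norm_num
  have hFF : Fᴴ * F = 1 - (vacuumForm P')ᴴ * vacuumForm P' := by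
    have e1 : vacuumForm P' = Wᵀ * toC K * W := by
      rw [vacuumForm, hKdef, toC_sub, toC_smul, toC_one]; norm_num; rfl
    have e2 : (Wᵀ)ᴴ * Wᵀ = 1 := phaseBasis_conj_transpose
    have e3 : (vacuumForm P')ᴴ * vacuumForm P' = Wᴴ * (toC K * toC K) * W := by
      have hKT : Kᵀ = K := by simp [hKdef, hP]
      rw [e1, Matrix.conjTranspose_mul, Matrix.conjTranspose_mul, toC_conjTranspose, hKT]
      calc _ = Wᴴ * (toC K * ((Wᵀ)ᴴ * Wᵀ) * toC K) * W := by simp only [Matrix.mul_assoc]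
        _ = _ := by rw [e2, Matrix.mul_one]
    have e4 : (1 : Matrix (Mode n) (Mode n) ℂ) = Wᴴ * 1 * W := by
      rw [Matrix.mul_one, phaseBasis_conj_mul]
    rw [e3, e4, ← Matrix.sub_mul, ← Matrix.mul_sub, ← toC_one, ← toC_mul, ← toC_sub, hK, hB,
      toC_smul, toC_mul, toC_mul, toC_mul, toC_transpose]
    simp only [F, Matrix.conjTranspose_smul, Matrix.conjTranspose_mul, toC_conjTranspose, hP,
      Matrix.smul_mul, Matrix.mul_smul, smul_smul, toC_transpose]
    simp only [RCLike.star_def, Complex.conj_ofReal, hs8, Matrix.mul_assoc]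
    norm_num
  have hinv : (((Real.sqrt 8 : ℝ) : ℂ)⁻¹ • (Wᴴ * toC ((2 : ℝ) • Γ + 1) * toC B')) * F = 1 := by
    have hne : ((Real.sqrt 8 : ℝ) : ℂ) ≠ 0 := fun h => by simp [h] at hs8
    simp only [F, Matrix.smul_mul, Matrix.mul_smul, smul_smul, mul_inv_cancel₀ hne, one_smul]
    calc _ = Wᴴ * (toC ((2 : ℝ) • Γ + 1) * (toC B' * toC B) * toC P') * W := by
          simp only [Matrix.mul_assoc]
      _ = 1 := by
          rw [← toC_mul B', hB1, toC_one, Matrix.mul_one, ← toC_mul, h2, toC_one, Matrix.mul_one,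
            phaseBasis_conj_mul]
  obtain ⟨c, hc, hcF⟩ := exists_le_sum_norm_sq_mulVec hinv
  refine ⟨1 - c, by linarith, fun x => ?_⟩
  have key : ∑ i, ‖(F *ᵥ x) i‖ ^ 2 = ∑ i, ‖x i‖ ^ 2 - ∑ i, ‖(vacuumForm P' *ᵥ x) i‖ ^ 2 := by
    have : ∀ M : Matrix (Mode n) (Mode n) ℂ,
        ((∑ i, ‖(M *ᵥ x) i‖ ^ 2 : ℝ) : ℂ) = star x ⬝ᵥ ((Mᴴ * M) *ᵥ x) := by
      intro M
      rw [sum_norm_sq_eq, Matrix.star_mulVec, ← Matrix.dotProduct_mulVec, Matrix.mulVec_mulVec]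
    apply Complex.ofReal_injective
    rw [this, Complex.ofReal_sub, this, hFF, sum_norm_sq_eq, Matrix.sub_mulVec, Matrix.one_mulVec,
      dotProduct_sub]
  have := hcF x
  linarith

lemma phaseBasis_inr (μ : Mode n) (i : Fin n) :
    phaseBasis n μ (Sum.inr i) = star (phaseBasis n μ (Sum.inl i)) := by
  rcases μ with j | j <;> by_cases h : j = i <;> simp [phaseBasis, h]

lemma vacuumForm_apply (i j : Mode n) : vacuumForm P' i j = ∑ μ, ∑ ν,
    phaseBasis n μ i * (((1 - (2 : ℝ) • P') μ ν : ℝ) : ℂ) * phaseBasis n ν j := by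
  have : (1 : Matrix (Mode n) (Mode n) ℂ) - (2 : ℂ) • toC P' = toC (1 - (2 : ℝ) • P') := by
    rw [toC_sub, toC_smul, toC_one]; norm_num
  rw [vacuumForm, this]
  simp only [Matrix.mul_apply, Finset.sum_mul, Matrix.transpose_apply, toC, Matrix.map_apply]
  exact Finset.sum_comm

lemma vacuumForm_conj (i j : Fin n) : vacuumForm P' (Sum.inr i) (Sum.inr j) =
    star (vacuumForm P' (Sum.inl i) (Sum.inl j)) := by
  simp only [vacuumForm_apply, phaseBasis_inr, star_sum, star_mul']
  simp

-- Let Z be the second half of the columns of `phaseBasis`, so that 2ZZ† = 1 + τ. The cross block is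
-- C = 1 - 2Z†P'Z, and C = C†C + 2 (P'Z)†(2Γ - τ)(P'Z). The uncertainty relation makes the last
-- term, and hence C, positive semidefinite.
open scoped ComplexOrder MatrixOrder in
lemma vacuumForm_cross (hΓ : IsPhysical Γ) (hP : P'ᵀ = P')
    (h1 : P' * ((2 : ℝ) • Γ + 1) = 1) :
    ∃ Lc : Matrix (Fin n) (Fin n) ℂ, ∀ i j,
      vacuumForm P' (Sum.inl i) (Sum.inr j) = ∑ l, Lc i l * star (Lc j l) := by
  set Z : Matrix (Mode n) (Fin n) ℂ := (phaseBasis n).submatrix id Sum.inr with hZdef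
  have hZ : Zᴴ * Z = 1 := by
    ext i j
    have := congrFun (congrFun (phaseBasis_conj_mul (n := n)) (Sum.inr i)) (Sum.inr j)
    simpa [Matrix.mul_apply, Z, Matrix.one_apply] using this
  have hZZ : (2 : ℂ) • (Z * Zᴴ) = 1 + tau n := by
    have hs : (Real.sqrt 2 : ℂ)⁻¹ * (Real.sqrt 2 : ℂ)⁻¹ = 1 / 2 := by
      simpa using one_div_sqrt_two_mul_self
    ext μ ν
    rcases μ with i | i <;> rcases ν with j | j <;>
      by_cases h : i = j <;>
      simp [Matrix.mul_apply, Z, phaseBasis, tau, Matrix.one_apply, apply_ite, h, hs] <;>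
      first
        | linear_combination 2 * Complex.I * hs
        | linear_combination -2 * Complex.I * hs
        | linear_combination 2 * hs - 2 * (Real.sqrt 2 : ℂ)⁻¹ ^ 2 * Complex.I_sq
  set U := Zᴴ * toC P' * Z
  have hPh : (toC P')ᴴ = toC P' := by rw [toC_conjTranspose, hP]
  have hU : Uᴴ = U := by
    simp [U, Matrix.conjTranspose_mul, hPh, Matrix.mul_assoc]
  have hC : ∀ i j, vacuumForm P' (Sum.inl i) (Sum.inr j) = (1 - (2 : ℂ) • U) i j := by
    intro i j
    have : 1 - (2 : ℂ) • U = Zᴴ * (1 - (2 : ℂ) • toC P') * Z := by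
      simp [U, Matrix.mul_sub, Matrix.sub_mul, hZ]
    rw [this, vacuumForm]
    simp only [Matrix.mul_apply, Z, Matrix.conjTranspose_apply, Matrix.submatrix_apply, id,
      phaseBasis_inr, star_star, Matrix.transpose_apply]
  have hpsd : (1 - (2 : ℂ) • U).PosSemidef := by
    have e : 1 - (2 : ℂ) • U = (1 - (2 : ℂ) • U)ᴴ * (1 - (2 : ℂ) • U)
        + (2 : ℂ) • ((toC P' * Z)ᴴ * ((2 : ℂ) • toC Γ - tau n) * (toC P' * Z)) := by
      have e1 : (2 : ℂ) • toC Γ - tau n = ((2 : ℂ) • toC Γ + 1) - (2 : ℂ) • (Z * Zᴴ) := by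
        rw [hZZ]; module
      have e2 : (toC P' * Z)ᴴ * ((2 : ℂ) • toC Γ - tau n) * (toC P' * Z) =
          U - (2 : ℂ) • (U * U) := by
        rw [e1, ← toC_two_smul_add_one, Matrix.mul_sub, Matrix.sub_mul, Matrix.conjTranspose_mul,
          hPh, Matrix.mul_assoc Zᴴ, ← toC_mul, h1, toC_one]
        simp only [U, Matrix.mul_one, Matrix.mul_smul, Matrix.smul_mul, Matrix.mul_assoc]
      rw [e2, Matrix.conjTranspose_sub, Matrix.conjTranspose_smul, hU]
      simp only [Matrix.conjTranspose_one, Matrix.mul_sub, Matrix.sub_mul, Matrix.mul_one,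
        Matrix.one_mul, Matrix.mul_smul, Matrix.smul_mul, star_ofNat]
      module
    rw [e]
    refine (Matrix.posSemidef_conjTranspose_mul_self _).add (Matrix.PosSemidef.smul ?_ (by norm_num))
    exact hΓ.posSemidef_sub_tau.conjTranspose_mul_mul_same _
  obtain ⟨B, hB⟩ := CStarAlgebra.nonneg_iff_eq_star_mul_self.mp hpsd.nonneg
  refine ⟨Bᴴ, fun i j => ?_⟩
  rw [hC, hB]
  simp [Matrix.mul_apply, Matrix.star_eq_conjTranspose]

end VacuumForm

lemma JordanForm.ann_iff {X : Matrix (Mode n) (Mode n) ℂ} (J : JordanForm X)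
    (Γ : Matrix (Mode n) (Mode n) ℝ) (R : Op n) :
    (∀ p, J.d Γ p R = 0) ↔ ∀ μ, eOp Γ μ R = 0 := by
  constructor
  · intro h μ
    rw [J.eOp_eq_d]
    simp [LinearMap.sum_apply, h]
  · intro h p
    rw [J.d_eq]
    simp [LinearMap.sum_apply, h]

open scoped ComplexOrder in
/-- A density operator annihilated by `b - 2 Γ b'`; it spans the space of such operators. -/
lemma IsPhysical.exists_vacuum {Γ : Matrix (Mode n) (Mode n) ℝ} (hΓ : IsPhysical Γ) :
    ∃ ρ : Op n, IsDensityOperator ρ ∧ ρ ∈ rapid n ∧ (∀ μ, eOp Γ μ ρ = 0) ∧ tr ρ = 1 ∧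
      ∀ R, (∀ μ, eOp Γ μ R = 0) → ∃ c : ℂ, R = c • ρ := by
  obtain ⟨P', h1, h2, hP⟩ := hΓ.exists_factor
  obtain ⟨r, hr, hcontr⟩ := vacuumForm_contraction hΓ hP h1 h2
  obtain ⟨Lc, hLc⟩ := vacuumForm_cross hΓ hP h1
  set G := gaussOp (vacuumForm P')
  have hsolv : SolvesGauss (vacuumForm P') G := gaussOp_solves (vacuumForm_isSymm hP)
  have hrap : G ∈ rapid n := hsolv.mem_rapid hr hcontr
  have hpsd := gaussOp_posSemidef (vacuumForm_isSymm hP) vacuumForm_conj Lc hLc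
  have hdiag : ∀ α, 0 ≤ (G α α).re ∧ (G α α).im = 0 := fun α => by
    have := Complex.le_def.mp (hpsd.diag_nonneg (i := α))
    simpa [eq_comm] using this
  have h00 : G 0 0 = 1 := entry_gaussOp_zero _
  -- The diagonal entries are non-negative and the vacuum entry is 1, so the trace is positive and
  -- can be normalized.
  obtain ⟨t, ht, htr⟩ : ∃ t : ℝ, 0 < t ∧ tr G = t := by
    have hs := summable_diag hrap
    refine ⟨∑' α, (G α α).re, ?_, ?_⟩
    · refine (Complex.reCLM.summable hs).tsum_pos (fun α => (hdiag α).1) 0 ?_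
      simp [h00]
    · rw [tr, Complex.ofReal_tsum]
      refine tsum_congr fun α => ?_
      apply Complex.ext <;> simp [hdiag α]
  have htne : (t : ℂ) ≠ 0 := by exact_mod_cast ht.ne'
  have htr1 : tr ((t : ℂ)⁻¹ • G) = 1 := by rw [tr_smul, htr, inv_mul_cancel₀ htne]
  have hmem : (t : ℂ)⁻¹ • G ∈ rapid n := (rapid n).smul_mem _ hrap
  refine ⟨(t : ℂ)⁻¹ • G, ⟨?_, htr1 ▸ hasTrace_tr hmem⟩, hmem, ?_, htr1, ?_⟩
  · have : (0 : ℂ) ≤ (t : ℂ)⁻¹ := by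
      rw [← Complex.ofReal_inv]; exact_mod_cast (inv_pos.mpr ht).le
    exact hpsd.smul this
  · intro μ
    rw [map_smul, (solvesGauss_iff h1 h2 G).mp hsolv μ, smul_zero]
  · intro R hR
    refine ⟨entry R 0 * t, ?_⟩
    rw [smul_smul, mul_assoc, mul_inv_cancel₀ htne, mul_one]
    exact ((solvesGauss_iff h1 h2 R).mpr hR).eq_smul hsolv (entry_gaussOp_zero _)

/-! ### Stability and relaxation of the covariance matrix -/

section Decay
variable {ι κ : Type*} [Fintype ι] [Fintype κ]

/-- M acts on the columns of E in the first term and on its rows in the second; each contributes a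
rate c. -/
lemma re_dotProduct_smul_le {M : Matrix ι ι ℂ} {c : ℝ}
    (hM : ∀ x : ι → ℂ, (star x ⬝ᵥ M *ᵥ x).re ≤ -c * ∑ i, ‖x i‖ ^ 2) (E : Matrix ι ι ℂ) :
    ∑ i, ∑ j, (star (E i j) * (M * E + E * Mᵀ) i j).re ≤ -(2 * c) * ∑ i, ∑ j, ‖E i j‖ ^ 2 := by
  have h1 : ∑ i, ∑ j, (star (E i j) * (M * E) i j).re ≤ -c * ∑ i, ∑ j, ‖E i j‖ ^ 2 := by
    rw [Finset.sum_comm (f := fun i j => ‖E i j‖ ^ 2), Finset.sum_comm, Finset.mul_sum]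
    refine Finset.sum_le_sum fun j _ => ?_
    refine le_trans (le_of_eq ?_) (hM fun i => E i j)
    rw [← Complex.re_sum]
    rfl
  have h2 : ∑ i, ∑ j, (star (E i j) * (E * Mᵀ) i j).re ≤ -c * ∑ i, ∑ j, ‖E i j‖ ^ 2 := by
    rw [Finset.mul_sum]
    refine Finset.sum_le_sum fun i _ => ?_
    refine le_trans (le_of_eq ?_) (hM (E i))
    rw [← Complex.re_sum]
    congr 1
    refine Finset.sum_congr rfl fun j _ => ?_
    simp [Matrix.mul_apply, Matrix.mulVec, dotProduct, mul_comm]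
  simp only [Matrix.add_apply, mul_add, Complex.add_re, Finset.sum_add_distrib]
  linarith

/-- Solutions of `E' = M E + E Mᵀ` decay if the Hermitian part of `M` is negative. -/
lemma sum_norm_sq_le_exp {M : Matrix ι ι ℂ} {c : ℝ}
    (hM : ∀ x : ι → ℂ, (star x ⬝ᵥ M *ᵥ x).re ≤ -c * ∑ i, ‖x i‖ ^ 2) {E : ℝ → Matrix ι ι ℂ}
    (hE : ∀ t, 0 ≤ t → ∀ i j, HasDerivWithinAt (fun s => E s i j)
      ((M * E t + E t * Mᵀ) i j) (Set.Ici 0) t) {t : ℝ} (ht : 0 ≤ t) :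
    ∑ i, ∑ j, ‖E t i j‖ ^ 2 ≤ Real.exp (-(4 * c) * t) * ∑ i, ∑ j, ‖E 0 i j‖ ^ 2 := by
  set f : ℝ → ℝ := fun t => ∑ i, ∑ j, ‖E t i j‖ ^ 2 with hf
  set f' : ℝ → ℝ := fun t => ∑ i, ∑ j, 2 * (star (E t i j) * (M * E t + E t * Mᵀ) i j).re with hf'
  have hd : ∀ t, 0 ≤ t → HasDerivWithinAt f (f' t) (Set.Ici 0) t := by
    intro t ht
    refine HasDerivWithinAt.fun_sum fun i _ => HasDerivWithinAt.fun_sum fun j _ => ?_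
    have h := (hE t ht i j).norm_sq
    refine h.congr_deriv ?_
    rw [Complex.inner]
    simp [mul_comm]
  have hle : ∀ t, f' t ≤ -(4 * c) * f t := by
    intro t
    have := re_dotProduct_smul_le hM (E t)
    simp only [hf', hf, ← Finset.mul_sum]
    linarith
  have hanti : AntitoneOn (fun t => Real.exp (4 * c * t) * f t) (Set.Ici 0) := by
    have hd2 : ∀ t, 0 ≤ t → HasDerivWithinAt (fun t => Real.exp (4 * c * t) * f t)
        (Real.exp (4 * c * t) * (4 * c) * f t + Real.exp (4 * c * t) * f' t) (Set.Ici 0) t := by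
      intro t ht
      have h1 : HasDerivAt (fun t : ℝ => Real.exp (4 * c * t)) (Real.exp (4 * c * t) * (4 * c)) t := by
        simpa using ((hasDerivAt_id t).const_mul (4 * c)).exp
      exact h1.hasDerivWithinAt.mul (hd t ht)
    refine antitoneOn_of_hasDerivWithinAt_nonpos (convex_Ici 0)
      (fun t ht => (hd2 t ht).continuousWithinAt)
      (fun t ht => (hd2 t (interior_subset ht)).mono interior_subset) fun t ht => ?_
    have := hle t
    have h3 := Real.exp_pos (4 * c * t)
    nlinarith
  have h := hanti (Set.mem_Ici.mpr le_rfl) (Set.mem_Ici.mpr ht) ht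
  simp only [mul_zero, Real.exp_zero, one_mul] at h
  calc f t = Real.exp (-(4 * c) * t) * (Real.exp (4 * c * t) * f t) := by
        rw [← mul_assoc, ← Real.exp_add]; simp
    _ ≤ _ := by gcongr

/-- F = T E Tᵀ solves the same equation with M in place of X. The transpose, not the adjoint,
matches the term E Xᵀ. Returning to E costs two factors of the square sum of T'. -/
lemma exists_norm_le_exp [DecidableEq ι] {X : Matrix ι ι ℂ} {T : Matrix κ ι ℂ} {T' : Matrix ι κ ℂ}
    {M : Matrix κ κ ℂ} (hT : T' * T = 1) (hX : T * X = M * T) {c : ℝ}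
    (hM : ∀ x : κ → ℂ, (star x ⬝ᵥ M *ᵥ x).re ≤ -c * ∑ i, ‖x i‖ ^ 2) {E : ℝ → Matrix ι ι ℂ}
    (hE : ∀ t, 0 ≤ t → ∀ i j, HasDerivWithinAt (fun s => E s i j)
      ((X * E t + E t * Xᵀ) i j) (Set.Ici 0) t) :
    ∃ C : ℝ, ∀ t, 0 ≤ t → ∀ i j, ‖E t i j‖ ^ 2 ≤ C * Real.exp (-(4 * c) * t) := by
  set F : ℝ → Matrix κ κ ℂ := fun t => T * E t * Tᵀ with hF
  have hFE : ∀ t, E t = T' * F t * T'ᵀ := by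
    intro t
    have hT2 : Tᵀ * T'ᵀ = 1 := by rw [← Matrix.transpose_mul, hT, Matrix.transpose_one]
    calc E t = (T' * T) * E t * (Tᵀ * T'ᵀ) := by rw [hT, hT2]; simp
      _ = _ := by simp only [hF, Matrix.mul_assoc]
  have hFd : ∀ t, 0 ≤ t → ∀ p q, HasDerivWithinAt (fun s => F s p q)
      ((M * F t + F t * Mᵀ) p q) (Set.Ici 0) t := by
    intro t ht p q
    have e : M * F t + F t * Mᵀ = T * (X * E t + E t * Xᵀ) * Tᵀ := by
      have hX2 : Xᵀ * Tᵀ = Tᵀ * Mᵀ := by rw [← Matrix.transpose_mul, hX, Matrix.transpose_mul]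
      rw [Matrix.mul_add, Matrix.add_mul, ← Matrix.mul_assoc T X, hX, ← Matrix.mul_assoc T (E t),
        Matrix.mul_assoc _ Xᵀ, hX2]
      simp only [hF, Matrix.mul_assoc]
    rw [e]
    simp only [hF, Matrix.mul_apply (N := Tᵀ), Matrix.mul_apply (M := T)]
    refine HasDerivWithinAt.fun_sum fun j _ => HasDerivWithinAt.mul_const ?_ _
    refine HasDerivWithinAt.fun_sum fun i _ => HasDerivWithinAt.const_mul _ (hE t ht i j)
  set A : ℝ := ∑ i, ∑ j, ‖T' i j‖ ^ 2
  refine ⟨A * A * ∑ p, ∑ q, ‖F 0 p q‖ ^ 2, fun t ht i j => ?_⟩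
  have h1 := sum_norm_sq_le_exp hM hFd ht
  have hrow : ∀ i, ∑ p, ‖T' i p‖ ^ 2 ≤ A := fun i =>
    Finset.single_le_sum (f := fun i => ∑ p, ‖T' i p‖ ^ 2) (fun _ _ => by positivity)
      (Finset.mem_univ i)
  have hcs : ∀ (a b : κ → ℂ), ‖∑ p, a p * b p‖ ^ 2 ≤ (∑ p, ‖a p‖ ^ 2) * ∑ p, ‖b p‖ ^ 2 := by
    intro a b
    calc ‖∑ p, a p * b p‖ ^ 2 ≤ (∑ p, ‖a p‖ * ‖b p‖) ^ 2 := by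
          gcongr
          exact (norm_sum_le _ _).trans_eq (by simp)
      _ ≤ _ := Finset.sum_mul_sq_le_sq_mul_sq _ _ _
  calc ‖E t i j‖ ^ 2 ≤ (∑ q, ‖(T' * F t) i q‖ ^ 2) * ∑ q, ‖T' j q‖ ^ 2 := by
        rw [hFE t, Matrix.mul_apply]
        exact hcs _ _
    _ ≤ (∑ q, A * ∑ p, ‖F t p q‖ ^ 2) * A := by
        gcongr with q
        · rw [Matrix.mul_apply]
          refine (hcs _ _).trans ?_
          gcongr
          exact hrow i
        · exact hrow j
    _ = A * A * ∑ p, ∑ q, ‖F t p q‖ ^ 2 := by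
        rw [← Finset.mul_sum, Finset.sum_comm]; ring
    _ ≤ A * A * (Real.exp (-(4 * c) * t) * ∑ p, ∑ q, ‖F 0 p q‖ ^ 2) := by gcongr
    _ = _ := by ring

end Decay

/-- In a rescaled Jordan basis the Hermitian part is negative. -/
lemma JordanForm.exists_dissipative {X : Matrix (Mode n) (Mode n) ℂ} (J : JordanForm X)
    (h : ∀ k, (J.eig k).re < 0) :
    ∃ (c : ℝ) (T : Matrix J.Idx (Mode n) ℂ) (T' : Matrix (Mode n) J.Idx ℂ)
      (M : Matrix J.Idx J.Idx ℂ), 0 < c ∧ T' * T = 1 ∧ T * T' = 1 ∧ T * X = M * T ∧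
      ∀ x : J.Idx → ℂ, (star x ⬝ᵥ M *ᵥ x).re ≤ -c * ∑ i, ‖x i‖ ^ 2 := by
  -- Half of the spectral gap becomes the decay rate; the other half will absorb the off-diagonal
  -- part of the Jordan blocks.
  obtain ⟨c, hc, hce⟩ : ∃ c : ℝ, 0 < c ∧ ∀ k, (J.eig k).re ≤ -(2 * c) := by
    rcases isEmpty_or_nonempty (Fin J.numBlocks) with he | he
    · exact ⟨1, one_pos, fun k => (he.false k).elim⟩
    · obtain ⟨k, hk⟩ := Finite.exists_max fun k => (J.eig k).re
      exact ⟨-(J.eig k).re / 2, by linarith [h k], fun k' => by linarith [hk k']⟩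
  set m : ℝ := ((Fintype.card J.Idx : ℕ) : ℝ)
  have hm0 : 0 ≤ m := Nat.cast_nonneg _
  -- Conjugation with diag(ε^ℓ) turns the superdiagonal ones into ε, and this ε satisfies ε m ≤ c.
  set ε : ℝ := c / (m + 1)
  have hε : 0 < ε := by positivity
  have hεm : ε * m ≤ c := by
    rw [div_mul_eq_mul_div, div_le_iff₀ (by positivity)]; nlinarith
  have hεC : (ε : ℂ) ≠ 0 := by exact_mod_cast hε.ne'
  let D : Matrix J.Idx J.Idx ℂ := Matrix.diagonal fun p => (ε : ℂ) ^ (p.2 : ℕ)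
  let D' : Matrix J.Idx J.Idx ℂ := Matrix.diagonal fun p => ((ε : ℂ) ^ (p.2 : ℕ))⁻¹
  have hD : D * D' = 1 := by
    simp only [D, D', Matrix.diagonal_mul_diagonal]
    rw [← Matrix.diagonal_one]
    congr 1; funext p
    exact mul_inv_cancel₀ (pow_ne_zero _ hεC)
  have hD' : D' * D = 1 := mul_eq_one_comm.mp hD
  refine ⟨c, D' * J.Sinv, J.S * D, D' * (J.Sinv * X * J.S) * D, hc, ?_, ?_, ?_, fun x => ?_⟩
  · rw [Matrix.mul_assoc, ← Matrix.mul_assoc D, hD, Matrix.one_mul, J.S_mul_Sinv]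
  · rw [Matrix.mul_assoc, ← Matrix.mul_assoc J.Sinv, J.Sinv_mul_S, Matrix.one_mul, hD']
  · calc D' * J.Sinv * X = D' * J.Sinv * X * (J.S * J.Sinv) := by rw [J.S_mul_Sinv, Matrix.mul_one]
      _ = D' * (J.Sinv * X * J.S) * (D * D') * J.Sinv := by
        rw [hD, Matrix.mul_one]; simp only [Matrix.mul_assoc]
      _ = _ := by simp only [Matrix.mul_assoc]
  · have hM : ∀ p q, (D' * (J.Sinv * X * J.S) * D) p q =
        if p = q then J.eig p.1 else if p.1 = q.1 ∧ (p.2 : ℕ) + 1 = (q.2 : ℕ) then (ε : ℂ) else 0 := by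
      intro p q
      simp only [D, D', Matrix.mul_diagonal, Matrix.diagonal_mul, J.jordan, Matrix.of_apply]
      split_ifs with h1 h2
      · subst h1
        field_simp
      · rw [← h2.2, pow_succ]
        field_simp
      · simp
    simp only [dotProduct, Matrix.mulVec, Complex.re_sum, Pi.star_apply, hM, Finset.mul_sum]
    -- The bound |x_p||x_q| ≤ (|x_p|² + |x_q|²)/2 is granted to all pairs, not only to neighbours,
    -- so that the double sum is explicitly ε m times the square norm.
    have hpt : ∀ p q, (star (x p) * ((if p = q then J.eig p.1 else
        if p.1 = q.1 ∧ (p.2 : ℕ) + 1 = (q.2 : ℕ) then (ε : ℂ) else 0) * x q)).re ≤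
        (if p = q then -(2 * c) * ‖x p‖ ^ 2 else 0) + ε * ((‖x p‖ ^ 2 + ‖x q‖ ^ 2) / 2) := by
      intro p q
      have hpos : 0 ≤ ε * ((‖x p‖ ^ 2 + ‖x q‖ ^ 2) / 2) := by positivity
      split_ifs with h1 h2
      · subst h1
        have : (star (x p) * (J.eig p.1 * x p)).re = (J.eig p.1).re * ‖x p‖ ^ 2 := by
          rw [mul_left_comm, RCLike.star_def, Complex.conj_mul']
          rw [← Complex.ofReal_pow, Complex.re_mul_ofReal]
        rw [this]
        have := mul_le_mul_of_nonneg_right (hce p.1) (sq_nonneg ‖x p‖)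
        linarith
      · rw [zero_add, mul_left_comm, Complex.re_ofReal_mul]
        gcongr
        calc (star (x p) * x q).re ≤ ‖star (x p) * x q‖ := Complex.re_le_norm _
          _ = ‖x p‖ * ‖x q‖ := by simp
          _ ≤ _ := by nlinarith [sq_nonneg (‖x p‖ - ‖x q‖)]
      · simpa using hpos
    refine (Finset.sum_le_sum fun p _ => Finset.sum_le_sum fun q _ => hpt p q).trans ?_
    set Q := ∑ p, ‖x p‖ ^ 2
    have hQ : 0 ≤ Q := by positivity
    have e : ∑ p : J.Idx, ∑ q : J.Idx, ((if p = q then -(2 * c) * ‖x p‖ ^ 2 else 0)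
        + ε * ((‖x p‖ ^ 2 + ‖x q‖ ^ 2) / 2)) = -(2 * c) * Q + ε * m * Q := by
      simp only [Finset.sum_add_distrib, Finset.sum_ite_eq, Finset.mem_univ, if_true,
        ← Finset.mul_sum, ← Finset.sum_div, Finset.sum_const, Finset.card_univ, nsmul_eq_mul]
      simp only [Q, m]
      ring
    rw [e, ← Finset.mul_sum]
    nlinarith

/-- When T' T'† = Γ, the Hermitian part of the transformed X is congruent to the Lyapunov expression
XΓ + ΓX†. -/
lemma congr_add_conjTranspose {ι : Type*} [Fintype ι] [DecidableEq ι] {T T' : Matrix ι ι ℂ}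
    (h : T * T' = 1) (X : Matrix ι ι ℂ) :
    T * X * T' + (T * X * T')ᴴ = T * (X * (T' * T'ᴴ) + T' * T'ᴴ * Xᴴ) * Tᴴ := by
  have e2 : T'ᴴ * Tᴴ = 1 := by rw [← Matrix.conjTranspose_mul, h, Matrix.conjTranspose_one]
  rw [Matrix.conjTranspose_mul, Matrix.conjTranspose_mul, Matrix.mul_add, Matrix.add_mul]
  congr 1
  · calc _ = T * X * T' * 1 := (Matrix.mul_one _).symm
      _ = _ := by rw [← e2]; simp only [Matrix.mul_assoc]
  · calc _ = 1 * (T'ᴴ * (Xᴴ * Tᴴ)) := (Matrix.one_mul _).symm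
      _ = _ := by rw [← h]; simp only [Matrix.mul_assoc]

/-- The real symplectic form `i τ`. -/
def symplecticForm (n : ℕ) : Matrix (Mode n) (Mode n) ℝ := Matrix.fromBlocks 0 1 (-1) 0

lemma toC_symplecticForm : toC (symplecticForm n) = Complex.I • tau n := by
  ext i j
  rcases i with i | i <;> rcases j with j | j <;>
    by_cases h : i = j <;> simp [symplecticForm, tau, toC, h]

namespace System

variable (sys : System n)

/-- The real matrix `X₀`. -/
def Xr : Matrix (Mode n) (Mode n) ℝ :=
  (-2 : ℝ) • (symplecticForm n * sys.H) + symplecticForm n * sys.Bi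

lemma X₀_eq : sys.X₀ = toC sys.Xr := by
  rw [Xr, toC_add, toC_smul, toC_mul, toC_mul, toC_symplecticForm, X₀]
  simp only [Matrix.smul_mul, smul_smul]
  norm_num

-- The real part of B is (B + Bᵀ)/2, a sum of positive semidefinite matrices, and Y is congruent to
-- it through the Hermitian τ.
open scoped ComplexOrder in
lemma Y_posSemidef : sys.Y.PosSemidef := by
  have hB : sys.B.PosSemidef := by
    rw [B]
    exact Matrix.posSemidef_sum _ fun r _ => Matrix.posSemidef_vecMulVec_self_star _
  have hBr : toC sys.Br = (1 / 2 : ℂ) • (sys.B + sys.Bᵀ) := by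
    ext μ ν
    simp only [toC, Br, Matrix.map_apply, Matrix.smul_apply, Matrix.add_apply,
      Matrix.transpose_apply, ← sys.B_star μ ν, smul_eq_mul, RCLike.star_def, Complex.add_conj]
    push_cast; ring
  have hτ : (tau n)ᴴ = tau n := by simp [tau, Matrix.fromBlocks_conjTranspose]
  have h : (toC sys.Br).PosSemidef := by
    rw [hBr]
    exact (hB.add hB.transpose).smul (by rw [Complex.le_def]; norm_num)
  rw [Y]
  nth_rw 1 [← hτ]
  exact h.conjTranspose_mul_mul_same _

variable {sys}

lemma IsCovarianceEvolution.sub {G : ℝ → Matrix (Mode n) (Mode n) ℝ}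
    (hG : sys.IsCovarianceEvolution G) {Γ : Matrix (Mode n) (Mode n) ℝ}
    (hΓ : sys.SolvesLyapunov Γ) : ∀ t, 0 ≤ t → ∀ i j,
      HasDerivWithinAt (fun s => (toC (G s) - toC Γ) i j)
        ((sys.X₀ * (toC (G t) - toC Γ) + (toC (G t) - toC Γ) * sys.X₀ᵀ) i j) (Set.Ici 0) t := by
  intro t ht i j
  have := (hG t ht i j).sub_const (toC Γ i j)
  refine this.congr_deriv ?_
  rw [Matrix.mul_sub, Matrix.sub_mul]
  rw [← neg_eq_iff_eq_neg.mpr hΓ]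
  simp only [Matrix.add_apply, Matrix.sub_apply, Matrix.neg_apply]
  ring

-- Γ = BᵀB supplies the norm. In the coordinates given by T = (B⁻¹)ᵀ, the Lyapunov equation says
-- that M + M† = -T Y T† ≤ 0, so deviations from Γ cannot grow.
open scoped ComplexOrder in
lemma isStable {Γ : Matrix (Mode n) (Mode n) ℝ} (hΓ : IsPhysical Γ)
    (hL : sys.SolvesLyapunov Γ) : sys.IsStable := by
  intro G hG
  obtain ⟨B, B', h1, h2, hB⟩ := PosDef.exists_transpose_mul_self hΓ.1
  have hT : toC Bᵀ * toC B'ᵀ = 1 := by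
    rw [← toC_mul, ← Matrix.transpose_mul, h1, Matrix.transpose_one, toC_one]
  have hT' : toC B'ᵀ * toC Bᵀ = 1 := mul_eq_one_comm.mp hT
  set M := toC B'ᵀ * sys.X₀ * toC Bᵀ with hM
  have hX : toC B'ᵀ * sys.X₀ = M * toC B'ᵀ := by
    rw [hM, Matrix.mul_assoc _ (toC Bᵀ), hT, Matrix.mul_one]
  have hMM : M + Mᴴ = -((toC B'ᵀ) * sys.Y * (toC B'ᵀ)ᴴ) := by
    have hXH : sys.X₀ᴴ = sys.X₀ᵀ := by rw [X₀_eq, toC_conjTranspose, toC_transpose]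
    have hG : toC Γ = toC Bᵀ * (toC Bᵀ)ᴴ := by
      rw [hB, toC_mul, toC_conjTranspose, Matrix.transpose_transpose]
    have := congr_add_conjTranspose hT' sys.X₀
    rw [hXH, ← hG] at this
    rw [this, hL, Matrix.mul_neg, Matrix.neg_mul]
  obtain ⟨C, hC⟩ := exists_norm_le_exp (c := 0) hT hX (fun x => by
    have hpsd := (sys.Y_posSemidef.mul_mul_conjTranspose_same (toC B'ᵀ)).dotProduct_mulVec_nonneg x
    rw [← neg_eq_iff_eq_neg.mpr hMM, Matrix.neg_mulVec, dotProduct_neg, Matrix.add_mulVec,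
      dotProduct_add] at hpsd
    have hstar : star x ⬝ᵥ Mᴴ *ᵥ x = star (star x ⬝ᵥ M *ᵥ x) := by
      rw [Matrix.star_dotProduct, Matrix.star_mulVec, Matrix.conjTranspose_conjTranspose,
        Matrix.dotProduct_mulVec]
    rw [hstar] at hpsd
    have := (Complex.le_def.mp hpsd).1
    simp at this
    simp
    linarith) (hG.sub hL)
  simp only [mul_zero, neg_zero, zero_mul, Real.exp_zero, mul_one] at hC
  refine ⟨(C + 1) + ∑ μ, ∑ ν, |Γ μ ν|, fun t ht μ ν => ?_⟩
  have h3 := hC t ht μ ν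
  have h4 : ‖(toC (G t) - toC Γ) μ ν‖ = |G t μ ν - Γ μ ν| := by
    rw [Matrix.sub_apply, toC, toC, Matrix.map_apply, Matrix.map_apply, ← Complex.ofReal_sub,
      Complex.norm_real, Real.norm_eq_abs]
  rw [h4] at h3
  have h5 : |Γ μ ν| ≤ ∑ μ, ∑ ν, |Γ μ ν| :=
    (Finset.single_le_sum (f := fun ν => |Γ μ ν|) (fun _ _ => abs_nonneg _)
      (Finset.mem_univ ν)).trans (Finset.single_le_sum (f := fun μ => ∑ ν, |Γ μ ν|)
        (fun _ _ => by positivity) (Finset.mem_univ μ))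
  have h6 : |G t μ ν| ≤ |G t μ ν - Γ μ ν| + |Γ μ ν| := by
    simpa using abs_add_le (G t μ ν - Γ μ ν) (Γ μ ν)
  nlinarith [sq_nonneg (|G t μ ν - Γ μ ν| - 1)]

lemma isRelaxingTo {Γ : Matrix (Mode n) (Mode n) ℝ} (hL : sys.SolvesLyapunov Γ)
    (J : JordanForm sys.X₀) (h : ∀ k, (J.eig k).re < 0) : sys.IsRelaxingTo Γ := by
  intro G hG μ ν
  obtain ⟨c, T, T', M, hc, hT, -, hX, hM⟩ := J.exists_dissipative h
  obtain ⟨C, hC⟩ := exists_norm_le_exp hT hX hM (hG.sub hL)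
  have hexp : Filter.Tendsto (fun t : ℝ => C * Real.exp (-(4 * c) * t)) Filter.atTop (nhds 0) := by
    rw [← mul_zero C]
    refine Filter.Tendsto.const_mul C (Real.tendsto_exp_atBot.comp ?_)
    exact Filter.Tendsto.const_mul_atTop_of_neg (by linarith) Filter.tendsto_id
  have h0 : Filter.Tendsto (fun t => (G t μ ν - Γ μ ν) ^ 2) Filter.atTop (nhds 0) := by
    refine squeeze_zero' (Filter.Eventually.of_forall fun _ => sq_nonneg _) ?_ hexp
    filter_upwards [Filter.eventually_ge_atTop 0] with t ht
    have := hC t ht μ ν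
    rwa [Matrix.sub_apply, toC, toC, Matrix.map_apply, Matrix.map_apply, ← Complex.ofReal_sub,
      Complex.norm_real, Real.norm_eq_abs, sq_abs] at this
  have h1 := (Real.continuous_sqrt.tendsto 0).comp h0
  simp only [Real.sqrt_zero, Function.comp_def, Real.sqrt_sq_eq_abs] at h1
  rw [tendsto_iff_norm_sub_tendsto_zero]
  exact h1

end System

/-! ### Decaying linear flow of the wave vector. -/

section Flow

attribute [local instance] Matrix.linftyOpNormedRing Matrix.linftyOpNormedAlgebra

/-- The linear flow `k' = A k`. -/
lemma exists_linear_flow {ι : Type*} [Fintype ι] [DecidableEq ι] (A : Matrix ι ι ℝ) (k₀ : ι → ℝ) :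
    ∃ k : ℝ → ι → ℝ, k 0 = k₀ ∧ ∀ t i, HasDerivAt (fun s => k s i) ((A *ᵥ k t) i) t := by
  refine ⟨fun t => NormedSpace.exp (t • A) *ᵥ k₀, by simp, fun t i => ?_⟩
  have h := hasDerivAt_exp_smul_const' (𝕂 := ℝ) A t
  have h2 : ∀ i j, HasDerivAt (fun s : ℝ => NormedSpace.exp (s • A) i j)
      ((A * NormedSpace.exp (t • A)) i j) t := by
    intro i j
    let ev : Matrix ι ι ℝ →L[ℝ] ℝ := LinearMap.toContinuousLinearMap
      { toFun := fun M => M i j, map_add' := fun _ _ => rfl, map_smul' := fun _ _ => rfl }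
    exact ev.hasFDerivAt.comp_hasDerivAt t h
  rw [Matrix.mulVec_mulVec]
  exact HasDerivAt.fun_sum fun j _ => (h2 i j).mul_const _

end Flow

/-- The flow `k' = X₀ᵀ k` of a relaxing system decays. -/
lemma System.exists_decaying_flow (sys : System n) (J : JordanForm sys.X₀)
    (h : ∀ k, (J.eig k).re < 0) (k₀ : Mode n → ℝ) :
    ∃ k : ℝ → Mode n → ℝ, k 0 = k₀ ∧
      (∀ t i, HasDerivAt (fun s => k s i) ((sys.Xrᵀ *ᵥ k t) i) t) ∧
      ∀ i, Filter.Tendsto (fun t => k t i) Filter.atTop (nhds 0) := by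
  obtain ⟨k, hk0, hk⟩ := exists_linear_flow sys.Xrᵀ k₀
  refine ⟨k, hk0, hk, fun i => ?_⟩
  obtain ⟨c, T, T', M, hc, hT, hT2, hX, hM⟩ := J.exists_dissipative h
  have hX' : T'ᵀ * sys.X₀ᵀ = Mᵀ * T'ᵀ := by
    rw [← Matrix.transpose_mul, ← Matrix.transpose_mul]
    congr 1
    calc sys.X₀ * T' = (T' * T) * sys.X₀ * T' := by rw [hT, Matrix.one_mul]
      _ = T' * (T * sys.X₀) * T' := by simp only [Matrix.mul_assoc]
      _ = T' * M * (T * T') := by rw [hX]; simp only [Matrix.mul_assoc]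
      _ = _ := by rw [hT2, Matrix.mul_one]
  -- The rank-one matrix k kᵀ obeys the matrix equation with generator X₀ᵀ, so the decay of matrix
  -- solutions applies. Its squared diagonal entries are k_i⁴.
  obtain ⟨C, hC⟩ := exists_norm_le_exp (T := T'ᵀ) (T' := Tᵀ) (M := Mᵀ) (c := c)
    (E := fun t => Matrix.of fun i j => (k t i : ℂ) * (k t j : ℂ))
    (by rw [← Matrix.transpose_mul, hT, Matrix.transpose_one]) hX' (fun x => by
      have := hM (star x)
      have e : star (star x) ⬝ᵥ M *ᵥ star x = star x ⬝ᵥ Mᵀ *ᵥ x := by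
        rw [star_star, Matrix.mulVec_transpose, Matrix.dotProduct_mulVec, dotProduct_comm]
      rw [e] at this
      simpa using this) (by
      intro t _ i j
      have h1 := ((hk t i).ofReal_comp.mul (hk t j).ofReal_comp).hasDerivWithinAt (s := Set.Ici 0)
      refine h1.congr_deriv ?_
      simp only [System.X₀_eq, toC, Matrix.add_apply, Matrix.mul_apply, Matrix.of_apply,
        Matrix.transpose_apply, Matrix.mulVec, dotProduct, Matrix.map_apply, Complex.ofReal_sum,
        Complex.ofReal_mul, Finset.sum_mul, Finset.mul_sum]
      congr 1 <;> exact Finset.sum_congr rfl fun _ _ => by ring)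
  have hexp : Filter.Tendsto (fun t : ℝ => C * Real.exp (-(4 * c) * t)) Filter.atTop (nhds 0) := by
    rw [← mul_zero C]
    refine Filter.Tendsto.const_mul C (Real.tendsto_exp_atBot.comp ?_)
    exact Filter.Tendsto.const_mul_atTop_of_neg (by linarith) Filter.tendsto_id
  have h0 : Filter.Tendsto (fun t => (k t i) ^ 4) Filter.atTop (nhds 0) := by
    refine squeeze_zero' (Filter.Eventually.of_forall fun _ => by positivity) ?_ hexp
    filter_upwards [Filter.eventually_ge_atTop 0] with t ht
    have := hC t ht i i
    simp only [Matrix.of_apply, ← Complex.ofReal_mul, Complex.norm_real, Real.norm_eq_abs,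
      sq_abs] at this
    linarith [this, (by ring : (k t i * k t i) ^ 2 = k t i ^ 4)]
  have hs : Filter.Tendsto Real.sqrt (nhds 0) (nhds 0) := by
    simpa using Real.continuous_sqrt.tendsto 0
  have h1 := hs.comp (hs.comp h0)
  have e : ∀ x : ℝ, √√(x ^ 4) = |x| := by
    intro x
    rw [show x ^ 4 = (x ^ 2) ^ 2 by ring, Real.sqrt_sq (sq_nonneg x), Real.sqrt_sq_eq_abs]
  rw [tendsto_zero_iff_abs_tendsto_zero]
  simpa only [Function.comp_def, e] using h1

/-! ### The generating function of an operator -/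

/-- Operators whose matrix elements are `O(A ^ deg)` for all `A > a`. -/
def growth (n : ℕ) (a : ℝ) : Submodule ℂ (Op n) where
  carrier := {R | ∀ A, a < A → ∃ C, ∀ p, ‖entry R p‖ ≤ C * A ^ deg p}
  zero_mem' := fun A _ => ⟨0, by simp⟩
  add_mem' := by
    intro R R' h h' A hA
    obtain ⟨C, hC⟩ := h A hA
    obtain ⟨C', hC'⟩ := h' A hA
    refine ⟨C + C', fun p => ?_⟩
    rw [entry_add, add_mul]
    exact (norm_add_le _ _).trans (add_le_add (hC p) (hC' p))
  smul_mem' := by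
    intro c R h A hA
    obtain ⟨C, hC⟩ := h A hA
    refine ⟨‖c‖ * C, fun p => ?_⟩
    rw [entry_smul, norm_mul, mul_assoc]
    gcongr
    exact hC p

/-- Bernoulli's inequality: r^m grows at least linearly. -/
lemma exists_sqrt_succ_le_pow {r : ℝ} (hr : 1 < r) :
    ∃ C : ℝ, 0 ≤ C ∧ ∀ m : ℕ, Real.sqrt (m + 1) ≤ C * r ^ m := by
  refine ⟨1 + 1 / (r - 1), by have := sub_pos.mpr hr; positivity, fun m => ?_⟩
  have h0 : 0 < r - 1 := sub_pos.mpr hr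
  have h1 : 1 + m * (r - 1) ≤ r ^ m := by
    simpa using one_add_mul_le_pow (a := r - 1) (by linarith) m
  have h2 : Real.sqrt (m + 1) ≤ m + 1 := Real.sqrt_le_iff.mpr ⟨by positivity, by nlinarith [m.cast_nonneg (α := ℝ)]⟩
  have h3 : (1 : ℝ) ≤ r ^ m := one_le_pow₀ hr.le
  have h4 : (m : ℝ) ≤ 1 / (r - 1) * r ^ m := by
    rw [one_div, ← div_eq_inv_mul, le_div_iff₀ h0]; linarith
  linarith

/-- The factor √(p i + 1) is absorbed by enlarging the base from A₁ to A. For this reason `growth`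
asks for a bound for every A > a instead of one at a. -/
lemma growth_dz {a : ℝ} (ha : 0 ≤ a) {R : Op n} (hR : R ∈ growth n a) (i : Mode n) :
    dz i R ∈ growth n a := by
  intro A hA
  obtain ⟨A₁, h1, h2⟩ := exists_between hA
  have hA1 : 0 < A₁ := ha.trans_lt h1
  have hA0 : 0 < A := hA1.trans h2
  obtain ⟨C, hC⟩ := hR A₁ h1
  obtain ⟨C', hC'0, hC'⟩ := exists_sqrt_succ_le_pow (r := A / A₁) (by rwa [one_lt_div hA1])
  have hC0 : 0 ≤ C := by
    have := (norm_nonneg _).trans (hC 0)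
    simpa [deg] using this
  refine ⟨C' * (C * A₁), fun p => ?_⟩
  rw [entry_dz, norm_mul, Complex.norm_real, Real.norm_of_nonneg (Real.sqrt_nonneg _)]
  calc Real.sqrt (p i + 1) * ‖entry R (p + Pi.single i 1)‖
      ≤ (C' * (A / A₁) ^ deg p) * (C * A₁ ^ (deg p + 1)) := by
        refine mul_le_mul ((hC' _).trans ?_) ?_ (norm_nonneg _) (by positivity)
        · gcongr
          · exact (one_le_div hA1).mpr h2.le
          · exact le_deg p i
        · rw [← deg_add_single p i]; exact hC _
    _ = C' * (C * A₁) * A ^ deg p := by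
        rw [div_pow, pow_succ]
        field_simp

lemma growth_zz {a : ℝ} (ha : 0 ≤ a) {R : Op n} (hR : R ∈ growth n a) (i : Mode n) :
    zz i R ∈ growth n a := by
  intro A hA
  obtain ⟨A₁, h1, h2⟩ := exists_between hA
  have hA1 : 0 < A₁ := ha.trans_lt h1
  have hA0 : 0 < A := hA1.trans h2
  obtain ⟨C, hC⟩ := hR A₁ h1
  obtain ⟨C', hC'0, hC'⟩ := exists_sqrt_succ_le_pow (r := A / A₁) (by rwa [one_lt_div hA1])
  have hC0 : 0 ≤ C := by
    have := (norm_nonneg _).trans (hC 0)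
    simpa [deg] using this
  refine ⟨C' * C / A, fun p => ?_⟩
  rw [entry_zz]
  by_cases hp : p i = 0
  · simp only [hp, Nat.cast_zero, Real.sqrt_zero, Complex.ofReal_zero, zero_mul, norm_zero]
    positivity
  obtain ⟨q, rfl⟩ : ∃ q : Mode n → ℕ, p = q + Pi.single i 1 := ⟨_, (sub_single_add_single hp).symm⟩
  rw [norm_mul, Complex.norm_real, Real.norm_of_nonneg (Real.sqrt_nonneg _), deg_add_single,
    add_tsub_cancel_right]
  have e : ((q + Pi.single i 1 : Mode n → ℕ) i : ℝ) = q i + 1 := by simp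
  rw [e]
  calc Real.sqrt (q i + 1) * ‖entry R q‖
      ≤ (C' * (A / A₁) ^ deg q) * (C * A₁ ^ deg q) := by
        refine mul_le_mul ((hC' _).trans ?_) ?_ (norm_nonneg _) (by positivity)
        · gcongr
          · exact (one_le_div hA1).mpr h2.le
          · exact le_deg q i
        · exact hC _
    _ = C' * C / A * A ^ (deg q + 1) := by
        rw [div_pow, pow_succ]
        field_simp

/-- Shift of a family indexed by multi-indices. -/
def shiftFun {ι E : Type*} [Zero E] [DecidableEq ι] (i : ι) (f : (ι → ℕ) → E) (p : ι → ℕ) : E :=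
  if p i = 0 then 0 else f (p - Pi.single i 1)

lemma shiftFun_add_single {ι E : Type*} [Zero E] [DecidableEq ι] (i : ι) (f : (ι → ℕ) → E)
    (p : ι → ℕ) : shiftFun i f (p + Pi.single i 1) = f p := by
  simp [shiftFun]

lemma hasSum_shiftFun {ι E : Type*} [AddCommMonoid E] [TopologicalSpace E] [DecidableEq ι] {i : ι}
    {f : (ι → ℕ) → E} {s : E} (h : HasSum f s) : HasSum (shiftFun i f) s := by
  have hinj : Function.Injective fun p : ι → ℕ => p + Pi.single i 1 := add_left_injective _
  rw [← hinj.hasSum_iff]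
  · convert h using 1
    funext p
    exact shiftFun_add_single i f p
  · intro p hp
    by_contra h0
    apply hp
    have hpi : p i ≠ 0 := fun h => h0 (by simp [shiftFun, h])
    exact ⟨p - Pi.single i 1, sub_single_add_single hpi⟩

section Monomials
variable {ι : Type*} [Fintype ι]

/-- Normalized monomials. -/
def nmono (p : ι → ℕ) (z : ι → ℂ) : ℂ := ∏ i, z i ^ p i / (Real.sqrt (p i).factorial : ℂ)

lemma pow_div_sqrt_factorial_succ (m : ℕ) (w : ℂ) :
    w ^ (m + 1) / (Real.sqrt (m + 1).factorial : ℂ) =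
      w / (Real.sqrt (m + 1) : ℂ) * (w ^ m / (Real.sqrt m.factorial : ℂ)) := by
  rw [Nat.factorial_succ, Nat.cast_mul, Real.sqrt_mul (by positivity), Complex.ofReal_mul, pow_succ]
  push_cast
  rw [div_mul_div_comm, mul_comm w]

lemma nmono_add_single [DecidableEq ι] (p : ι → ℕ) (i : ι) (z : ι → ℂ) :
    nmono (p + Pi.single i 1) z = z i / (Real.sqrt (p i + 1) : ℂ) * nmono p z := by
  rw [nmono, nmono, ← Finset.mul_prod_erase _ _ (Finset.mem_univ i),
    ← Finset.mul_prod_erase Finset.univ (fun i => z i ^ p i / (Real.sqrt (p i).factorial : ℂ))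
      (Finset.mem_univ i), ← mul_assoc]
  congr 1
  · simpa using pow_div_sqrt_factorial_succ (p i) (z i)
  · refine Finset.prod_congr rfl fun j hj => ?_
    simp [Finset.ne_of_mem_erase hj]

lemma nmono_zero_right [DecidableEq ι] (p : ι → ℕ) :
    nmono p (0 : ι → ℂ) = if p = 0 then 1 else 0 := by
  split_ifs with h
  · subst h; simp [nmono]
  · obtain ⟨i, hi⟩ := Function.ne_iff.mp h
    refine Finset.prod_eq_zero (Finset.mem_univ i) ?_
    have hi' : p i ≠ 0 := hi
    simp [hi']

/-- In each variable this is the square root of x^m/m! ≤ exp x at x = B²‖z_i‖². -/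
lemma norm_nmono_le {B : ℝ} (hB : 0 ≤ B) (p : ι → ℕ) (z : ι → ℂ) :
    B ^ deg p * ‖nmono p z‖ ≤ Real.exp (B ^ 2 / 2 * ∑ i, ‖z i‖ ^ 2) := by
  rw [nmono, norm_prod, deg, ← Finset.prod_pow_eq_pow_sum, ← Finset.prod_mul_distrib,
    Finset.mul_sum, Real.exp_sum]
  refine Finset.prod_le_prod (fun i _ => by positivity) fun i _ => ?_
  rw [norm_div, norm_pow, Complex.norm_real, Real.norm_of_nonneg (Real.sqrt_nonneg _),
    ← mul_div_assoc, ← mul_pow]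
  refine abs_le_of_sq_le_sq' ?_ (Real.exp_nonneg _) |>.2
  rw [div_pow, Real.sq_sqrt (by positivity), ← pow_mul, mul_comm _ 2, pow_mul, ← Real.exp_nat_mul]
  refine (Real.pow_div_factorial_le_exp _ (by positivity) _).trans_eq ?_
  congr 1
  push_cast; ring

lemma hasDerivAt_nmono [DecidableEq ι] (p : ι → ℕ) (z w : ι → ℂ) (s : ℝ) :
    HasDerivAt (fun s : ℝ => nmono p (z + (s : ℂ) • w))
      (∑ i, w i * ((Real.sqrt (p i) : ℂ) *
        shiftFun i (fun q => nmono q (z + (s : ℂ) • w)) p)) s := by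
  have h1 : ∀ i, HasDerivAt (fun s : ℝ => z i + (s : ℂ) * w i) (w i) s := fun i => by
    simpa using ((hasDerivAt_id s).ofReal_comp.mul_const (w i)).const_add (z i)
  have h2 : ∀ i ∈ Finset.univ, HasDerivAt (fun s : ℝ => (z i + (s : ℂ) * w i) ^ p i /
      (Real.sqrt (p i).factorial : ℂ)) _ s := fun i _ => ((h1 i).pow (p i)).div_const _
  refine (HasDerivAt.fun_finsetProd h2).congr_deriv (Finset.sum_congr rfl fun i _ => ?_)
  rw [shiftFun]
  split_ifs with hp
  · simp [hp]
  · obtain ⟨q, rfl⟩ : ∃ q : ι → ℕ, p = q + Pi.single i 1 := ⟨_, (sub_single_add_single hp).symm⟩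
    rw [add_tsub_cancel_right, nmono, ← Finset.mul_prod_erase _ _ (Finset.mem_univ i)]
    have e : ∏ j ∈ Finset.univ.erase i, (z j + (s : ℂ) * w j) ^ (q + Pi.single i 1 : ι → ℕ) j /
        (Real.sqrt ((q + Pi.single i 1 : ι → ℕ) j).factorial : ℂ) =
        ∏ j ∈ Finset.univ.erase i, (z + (s : ℂ) • w) j ^ q j / (Real.sqrt (q j).factorial : ℂ) :=
      Finset.prod_congr rfl fun j hj => by simp [Finset.ne_of_mem_erase hj]
    rw [e, smul_eq_mul]
    have e2 : (q + Pi.single i 1 : ι → ℕ) i = q i + 1 := by simp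
    rw [e2, Nat.factorial_succ, Nat.cast_mul, Real.sqrt_mul (by positivity), Complex.ofReal_mul]
    have hs : ((Real.sqrt ((q i + 1 : ℕ) : ℝ) : ℝ) : ℂ) * (Real.sqrt ((q i + 1 : ℕ) : ℝ) : ℝ) =
        ((q i + 1 : ℕ) : ℂ) := sqrt_mul_self_complex _
    have hs0 : ((Real.sqrt ((q i + 1 : ℕ) : ℝ) : ℝ) : ℂ) ≠ 0 := fun h => by
      rw [h, mul_zero] at hs
      exact Nat.cast_ne_zero.mpr (Nat.succ_ne_zero (q i)) hs.symm
    have hf0 : ((Real.sqrt ((q i).factorial : ℝ) : ℝ) : ℂ) ≠ 0 := by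
      rw [Complex.ofReal_ne_zero]
      exact (Real.sqrt_pos.mpr (by positivity)).ne'
    rw [← hs]
    simp only [Nat.add_sub_cancel, Pi.add_apply, Pi.smul_apply, smul_eq_mul]
    field_simp

end Monomials

/-- The generating function of the matrix elements. -/
def genFun (R : Op n) (z : Mode n → ℂ) : ℂ := ∑' p, entry R p * nmono p z

lemma exists_summable_bound {a B : ℝ} (ha : 0 ≤ a) (hB : a < B) {R : Op n} (hR : R ∈ growth n a) :
    ∃ u : (Mode n → ℕ) → ℝ, Summable u ∧ (∀ p, 0 ≤ u p) ∧
      ∀ p z, ‖entry R p * nmono p z‖ ≤ u p * Real.exp (B ^ 2 / 2 * ∑ i, ‖z i‖ ^ 2) := by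
  have hB0 : 0 < B := ha.trans_lt hB
  -- A ratio strictly between a/B and 1. The entries are O((qB)^deg p), and the spare factor q^deg p
  -- is summable over multi-indices.
  set q := (a / B + 1) / 2 with hq
  have haB : a / B < 1 := (div_lt_one hB0).mpr hB
  have haB0 : 0 ≤ a / B := by positivity
  have hq1 : q < 1 := by linarith
  have hq0 : 0 < q := by linarith
  have haq : a < q * B := by
    have : a / B < q := by linarith
    rwa [div_lt_iff₀ hB0] at this
  obtain ⟨C, hC⟩ := hR _ haq
  have hC0 : 0 ≤ C := by
    have := (norm_nonneg _).trans (hC 0)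
    simpa [deg] using this
  refine ⟨fun p => C * q ^ deg p, ?_, fun p => by positivity, fun p z => ?_⟩
  · refine Summable.mul_left C ?_
    simp only [deg, ← Finset.prod_pow_eq_pow_sum]
    exact (summable_pi_prod (fun _ _ => by positivity)
      fun _ => summable_geometric_of_lt_one hq0.le hq1).1
  · rw [norm_mul]
    calc ‖entry R p‖ * ‖nmono p z‖ ≤ C * (q * B) ^ deg p * ‖nmono p z‖ := by
          gcongr; exact hC p
      _ = C * q ^ deg p * (B ^ deg p * ‖nmono p z‖) := by rw [mul_pow]; ring
      _ ≤ _ := by gcongr; exact norm_nmono_le hB0.le p z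

section GenFun
variable {a : ℝ} {R R' : Op n}

lemma summable_genFun (ha : 0 ≤ a) (hR : R ∈ growth n a) (z : Mode n → ℂ) : Summable fun p => entry R p * nmono p z := by
  obtain ⟨u, hu, -, hb⟩ := exists_summable_bound ha (lt_add_one a) hR
  exact Summable.of_norm_bounded (hu.mul_right _) fun p => hb p z

lemma exists_norm_genFun_le (ha : 0 ≤ a) (hR : R ∈ growth n a) {B : ℝ} (hB : a < B) :
    ∃ C, 0 ≤ C ∧ ∀ z, ‖genFun R z‖ ≤ C * Real.exp (B ^ 2 / 2 * ∑ i, ‖z i‖ ^ 2) := by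
  obtain ⟨u, hu, hu0, hb⟩ := exists_summable_bound ha hB hR
  refine ⟨∑' p, u p, tsum_nonneg hu0, fun z => ?_⟩
  rw [← tsum_mul_right]
  exact tsum_of_norm_bounded (hu.mul_right _).hasSum fun p => hb p z

lemma genFun_add (ha : 0 ≤ a) (hR : R ∈ growth n a) (hR' : R' ∈ growth n a) (z : Mode n → ℂ) : genFun (R + R') z = genFun R z + genFun R' z := by
  simp only [genFun, entry_add, add_mul]
  exact (summable_genFun ha hR z).tsum_add (summable_genFun ha hR' z)

lemma genFun_smul (c : ℂ) (R : Op n) (z : Mode n → ℂ) : genFun (c • R) z = c * genFun R z := by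
  simp only [genFun, entry_smul, mul_assoc, tsum_mul_left]

lemma genFun_zero (z : Mode n → ℂ) : genFun (0 : Op n) z = 0 := by simp [genFun]

lemma genFun_sum (ha : 0 ≤ a) {κ : Type*} (s : Finset κ) {T : κ → Op n} (hT : ∀ k, T k ∈ growth n a)
    (z : Mode n → ℂ) : genFun (∑ k ∈ s, T k) z = ∑ k ∈ s, genFun (T k) z := by
  classical
  induction s using Finset.induction_on with
  | empty => simp [genFun_zero]
  | insert k s hk ih =>
    rw [Finset.sum_insert hk, Finset.sum_insert hk,
      genFun_add ha (hT k) ((growth n a).sum_mem fun k _ => hT k), ih]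

lemma genFun_zz (ha : 0 ≤ a) (hR : R ∈ growth n a) (i : Mode n) (z : Mode n → ℂ) : genFun (zz i R) z = z i * genFun R z := by
  have h := hasSum_shiftFun (i := i) ((summable_genFun ha hR z).hasSum.mul_left (z i))
  rw [genFun, genFun, ← h.tsum_eq]
  refine tsum_congr fun p => ?_
  rw [entry_zz, shiftFun]
  split_ifs with hp
  · simp [hp]
  · obtain ⟨q, rfl⟩ : ∃ q : Mode n → ℕ, p = q + Pi.single i 1 := ⟨_, (sub_single_add_single hp).symm⟩
    rw [add_tsub_cancel_right, nmono_add_single]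
    have e2 : (((q + Pi.single i 1 : Mode n → ℕ) i : ℕ) : ℝ) = q i + 1 := by simp
    rw [e2]
    have hs0 : ((Real.sqrt ((q i : ℝ) + 1) : ℝ) : ℂ) ≠ 0 := by
      rw [Complex.ofReal_ne_zero]; exact (Real.sqrt_pos.mpr (by positivity)).ne'
    field_simp

lemma genFun_apply_zero : genFun R 0 = entry R 0 := by
  classical
  rw [genFun, tsum_eq_single 0]
  · simp [nmono_zero_right]
  · intro p hp; simp [nmono_zero_right, hp]

lemma continuous_genFun (ha : 0 ≤ a) (hR : R ∈ growth n a) : Continuous (genFun R) := by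
  obtain ⟨u, hu, hu0, hb⟩ := exists_summable_bound ha (lt_add_one a) hR
  have hc : ∀ p, Continuous fun z : Mode n → ℂ => entry R p * nmono p z := fun p =>
    continuous_const.mul
      (continuous_finsetProd _ fun i _ => ((continuous_apply i).pow _).div_const _)
  rw [continuous_iff_continuousAt]
  intro z
  have hcont : ContinuousOn (fun z => ∑' p, entry R p * nmono p z) (Metric.ball 0 (‖z‖ + 1)) := by
    refine continuousOn_tsum (fun p => (hc p).continuousOn)
      (hu.mul_right (Real.exp ((a + 1) ^ 2 / 2 * ∑ _i : Mode n, (‖z‖ + 1) ^ 2))) ?_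
    intro p y hy
    refine (hb p y).trans (mul_le_mul_of_nonneg_left ?_ (hu0 p))
    have hy' : ‖y‖ ≤ ‖z‖ + 1 := by simpa using (Metric.mem_ball.mp hy).le
    gcongr with i
    exact (norm_le_pi_norm y i).trans hy'
  exact hcont.continuousAt (Metric.isOpen_ball.mem_nhds (by simp))

/-- Termwise differentiation along a real line. The derivatives are shifts of the series of `dz i
R`, dominated uniformly for parameters in the unit ball. -/
lemma hasDerivAt_genFun (ha : 0 ≤ a) (hR : R ∈ growth n a) (z w : Mode n → ℂ) :
    HasDerivAt (fun s : ℝ => genFun R (z + (s : ℂ) • w)) (∑ i, w i * genFun (dz i R) z) 0 := by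
  choose u hu hu0 hb using fun i : Mode n =>
    exists_summable_bound ha (lt_add_one a) (growth_dz ha hR i)
  set K : ℝ := Real.exp ((a + 1) ^ 2 / 2 * ∑ i : Mode n, (‖z i‖ + ‖w i‖) ^ 2)
  have hterm : ∀ p (y : ℝ), entry R p * (∑ i, w i * ((Real.sqrt (p i) : ℂ) *
      shiftFun i (fun q => nmono q (z + (y : ℂ) • w)) p)) =
      ∑ i, w i * shiftFun i (fun q => entry (dz i R) q * nmono q (z + (y : ℂ) • w)) p := by
    intro p y
    rw [Finset.mul_sum]
    refine Finset.sum_congr rfl fun i _ => ?_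
    unfold shiftFun
    split_ifs with hp
    · simp
    · obtain ⟨q, rfl⟩ : ∃ q : Mode n → ℕ, p = q + Pi.single i 1 :=
        ⟨_, (sub_single_add_single hp).symm⟩
      simp only [add_tsub_cancel_right, entry_dz]
      simp only [Pi.add_apply, Pi.single_eq_same, Nat.cast_add, Nat.cast_one]
      ring
  have hsum := hasDerivAt_tsum_of_isPreconnected
    (g := fun p (s : ℝ) => entry R p * nmono p (z + (s : ℂ) • w))
    (g' := fun p (s : ℝ) => entry R p * (∑ i, w i * ((Real.sqrt (p i) : ℂ) *
      shiftFun i (fun q => nmono q (z + (s : ℂ) • w)) p)))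
    (u := fun p => ∑ i, ‖w i‖ * shiftFun i (fun q => u i q * K) p)
    (t := Metric.ball 0 1) (y₀ := 0) (y := 0)
    (summable_sum fun i _ => (hasSum_shiftFun ((hu i).mul_right K).hasSum).summable.mul_left _)
    Metric.isOpen_ball (convex_ball _ _).isPreconnected
    (fun p y _ => (hasDerivAt_nmono p z w y).const_mul _)
    (fun p y hy => by
      rw [hterm]
      refine (norm_sum_le _ _).trans (Finset.sum_le_sum fun i _ => ?_)
      rw [norm_mul]
      gcongr
      unfold shiftFun
      split_ifs
      · simp
      · refine (hb i _ _).trans ?_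
        refine mul_le_mul_of_nonneg_left ?_ (hu0 i _)
        refine Real.exp_le_exp.mpr ?_
        gcongr with j
        refine (norm_add_le _ _).trans ?_
        have hy1 : |y| ≤ 1 := by simpa using (Metric.mem_ball.mp hy).le
        have : ‖((y : ℂ) • w) j‖ ≤ ‖w j‖ := by
          rw [Pi.smul_apply, norm_smul, Complex.norm_real, Real.norm_eq_abs]
          exact mul_le_of_le_one_left (norm_nonneg _) hy1
        linarith)
    (Metric.mem_ball_self one_pos) (summable_genFun ha hR _) (Metric.mem_ball_self one_pos)
  refine hsum.congr_deriv ?_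
  have h2 : HasSum (fun p => ∑ i, w i * shiftFun i (fun q => entry (dz i R) q *
      nmono q (z + ((0 : ℝ) : ℂ) • w)) p) (∑ i, w i * genFun (dz i R) (z + ((0 : ℝ) : ℂ) • w)) :=
    hasSum_sum fun i _ => (hasSum_shiftFun (summable_genFun ha (growth_dz ha hR i) _).hasSum).mul_left _
  simp only [hterm]
  rw [h2.tsum_eq]
  simp

end GenFun

/-! ### Phase-space functions -/

open MeasureTheory

/-- Classical phase space. -/
abbrev Phase (n : ℕ) := EuclideanSpace ℝ (Mode n)

/-- Complex phase-space coordinates. -/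
def zOf (x : Phase n) : Mode n → ℂ := (phaseBasis n)ᴴ *ᵥ fun μ => (x μ : ℂ)

lemma phaseBasis_mulVec_zOf (x : Phase n) (μ : Mode n) :
    ∑ i, phaseBasis n μ i * zOf x i = (x μ : ℂ) := by
  have : phaseBasis n *ᵥ zOf x = fun μ => (x μ : ℂ) := by
    rw [zOf, Matrix.mulVec_mulVec, phaseBasis_mul_conj, Matrix.one_mulVec]
  exact congrFun this μ

lemma sum_norm_sq_zOf (x : Phase n) : ∑ i, ‖zOf x i‖ ^ 2 = ‖x‖ ^ 2 := by
  apply Complex.ofReal_injective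
  rw [sum_norm_sq_eq, zOf, Matrix.star_mulVec, Matrix.conjTranspose_conjTranspose,
    ← Matrix.dotProduct_mulVec, Matrix.mulVec_mulVec, phaseBasis_mul_conj, Matrix.one_mulVec,
    ← sum_norm_sq_eq, EuclideanSpace.norm_sq_eq]
  simp

lemma zOf_add_smul (x v : Phase n) (t : ℝ) : zOf (x + t • v) = zOf x + (t : ℂ) • zOf v := by
  rw [zOf, zOf, zOf, ← Matrix.mulVec_smul, ← Matrix.mulVec_add]
  congr 1
  funext μ
  simp

lemma zOf_single (μ : Mode n) (i : Mode n) :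
    zOf (EuclideanSpace.single μ (1 : ℝ)) i = star (phaseBasis n μ i) := by
  rw [zOf, Matrix.mulVec, dotProduct, Finset.sum_eq_single μ]
  · simp
  · intro ν _ h; simp [h]
  · simp

lemma zOf_zero : zOf (0 : Phase n) = 0 := by
  rw [zOf, ← Matrix.mulVec_zero (phaseBasis n)ᴴ]
  congr 1

lemma continuous_zOf : Continuous (zOf (n := n)) := by
  refine continuous_pi fun i => ?_
  unfold zOf Matrix.mulVec dotProduct
  fun_prop

/-- Gaussian plane waves. -/
def planeWave (k : Mode n → ℝ) (s : ℝ) (x : Phase n) : ℂ :=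
  Complex.exp (Complex.I * (∑ μ, k μ * x μ : ℝ) - (s / 2 * ‖x‖ ^ 2 : ℝ))

/-- The phase-space function of an operator, multiplied by a Gaussian plane wave; `s = 1` and
`k = 0` is the Husimi function. -/
def husimi (k : Mode n → ℝ) (s : ℝ) (R : Op n) (x : Phase n) : ℂ :=
  genFun R (zOf x) * planeWave k s x

lemma norm_planeWave (k : Mode n → ℝ) (s : ℝ) (x : Phase n) :
    ‖planeWave k s x‖ = Real.exp (-(s / 2) * ‖x‖ ^ 2) := by
  rw [planeWave, Complex.norm_exp]
  simp [-Complex.ofReal_pow]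

lemma continuous_planeWave (k : Mode n → ℝ) (s : ℝ) : Continuous (planeWave k s) := by
  unfold planeWave
  fun_prop

lemma norm_add_smul_single_sq (x : Phase n) (μ : Mode n) (t : ℝ) :
    ‖x + t • EuclideanSpace.single μ (1 : ℝ)‖ ^ 2 = ‖x‖ ^ 2 + 2 * t * x μ + t ^ 2 := by
  rw [norm_add_sq_real, inner_smul_right, EuclideanSpace.inner_single_right, norm_smul]
  simp
  ring

lemma hasLineDerivAt_planeWave (k : Mode n → ℝ) (s : ℝ) (x : Phase n) (μ : Mode n) :
    HasLineDerivAt ℝ (planeWave k s) ((Complex.I * k μ - s * x μ) * planeWave k s x) x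
      (EuclideanSpace.single μ 1) := by
  have e : ∀ t : ℝ, planeWave k s (x + t • EuclideanSpace.single μ 1) =
      Complex.exp (Complex.I * (∑ μ, k μ * x μ : ℝ) - (s / 2 * ‖x‖ ^ 2 : ℝ)
        + ((t : ℂ) * (Complex.I * k μ - s * x μ) - (t : ℂ) ^ 2 * (s / 2))) := by
    intro t
    rw [planeWave, norm_add_smul_single_sq]
    congr 1
    have : ∑ ν, k ν * (x + t • EuclideanSpace.single μ (1 : ℝ)) ν = (∑ ν, k ν * x ν) + t * k μ := by
      simp [mul_add, Finset.sum_add_distrib, mul_comm]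
    rw [this]
    push_cast
    ring
  unfold HasLineDerivAt
  simp only [e]
  have h1 : HasDerivAt (fun t : ℝ => (t : ℂ)) 1 0 := (hasDerivAt_id (0 : ℝ)).ofReal_comp
  have h2 := (((h1.mul_const (Complex.I * k μ - s * x μ)).sub ((h1.pow 2).mul_const
    ((s : ℂ) / 2))).const_add
      (Complex.I * (∑ μ, k μ * x μ : ℝ) - (s / 2 * ‖x‖ ^ 2 : ℝ))).cexp
  refine h2.congr_deriv ?_
  simp [planeWave, mul_comm]

section Husimi
variable {a : ℝ} {R R' : Op n}

lemma growth_DD (ha : 0 ≤ a) (hR : R ∈ growth n a) (μ : Mode n) : DD μ R ∈ growth n a := by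
  rw [DD_eq, LinearMap.sum_apply]
  exact (growth n a).sum_mem fun i _ => (growth n a).smul_mem _ (growth_dz ha hR i)

lemma growth_XX (ha : 0 ≤ a) (hR : R ∈ growth n a) (μ : Mode n) : XX μ R ∈ growth n a := by
  rw [XX_eq, LinearMap.sum_apply]
  exact (growth n a).sum_mem fun i _ => (growth n a).smul_mem _ (growth_zz ha hR i)

lemma genFun_DD (ha : 0 ≤ a) (hR : R ∈ growth n a) (μ : Mode n) (z : Mode n → ℂ) :
    genFun (DD μ R) z = ∑ i, star (phaseBasis n μ i) * genFun (dz i R) z := by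
  rw [DD_eq, LinearMap.sum_apply]
  refine (genFun_sum ha Finset.univ (T := fun i => (star (phaseBasis n μ i) • dz i) R)
    (fun i => (growth n a).smul_mem _ (growth_dz ha hR i)) z).trans ?_
  exact Finset.sum_congr rfl fun i _ => genFun_smul _ _ _

lemma genFun_XX (ha : 0 ≤ a) (hR : R ∈ growth n a) (μ : Mode n) (x : Phase n) :
    genFun (XX μ R) (zOf x) = x μ * genFun R (zOf x) := by
  rw [XX_eq, LinearMap.sum_apply]
  refine (genFun_sum ha Finset.univ (T := fun i => (phaseBasis n μ i • zz i) R)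
    (fun i => (growth n a).smul_mem _ (growth_zz ha hR i)) _).trans ?_
  rw [← phaseBasis_mulVec_zOf, Finset.sum_mul]
  refine Finset.sum_congr rfl fun i _ => ?_
  rw [LinearMap.smul_apply, genFun_smul, genFun_zz ha hR, mul_assoc]

variable (k : Mode n → ℝ) (s : ℝ)

lemma husimi_add (ha : 0 ≤ a) (hR : R ∈ growth n a) (hR' : R' ∈ growth n a) (x : Phase n) :
    husimi k s (R + R') x = husimi k s R x + husimi k s R' x := by
  rw [husimi, genFun_add ha hR hR', add_mul]; rfl

lemma husimi_smul (c : ℂ) (R : Op n) (x : Phase n) :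
    husimi k s (c • R) x = c * husimi k s R x := by
  rw [husimi, genFun_smul, mul_assoc]; rfl

lemma husimi_XX (ha : 0 ≤ a) (hR : R ∈ growth n a) (μ : Mode n) (x : Phase n) :
    husimi k s (XX μ R) x = x μ * husimi k s R x := by
  rw [husimi, genFun_XX ha hR, mul_assoc]; rfl

lemma continuous_husimi (ha : 0 ≤ a) (hR : R ∈ growth n a) : Continuous (husimi k s R) :=
  ((continuous_genFun ha hR).comp continuous_zOf).mul (continuous_planeWave k s)

lemma hasLineDerivAt_husimi (ha : 0 ≤ a) (hR : R ∈ growth n a) (μ : Mode n) (x : Phase n) :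
    HasLineDerivAt ℝ (husimi k s R) (husimi k s (DD μ R) x +
      (Complex.I * k μ * husimi k s R x - s * husimi k s (XX μ R) x)) x
      (EuclideanSpace.single μ 1) := by
  have h1 := hasDerivAt_genFun ha hR (zOf x) (zOf (EuclideanSpace.single μ 1))
  simp only [zOf_single, ← zOf_add_smul, ← genFun_DD ha hR] at h1
  have h2 := hasLineDerivAt_planeWave k s x μ
  unfold HasLineDerivAt at h2 ⊢
  refine (h1.mul h2).congr_deriv ?_
  rw [zero_smul, add_zero, husimi_XX k s ha hR]
  simp only [husimi]
  ring

lemma integrable_exp_neg_norm_sq {b : ℝ} (hb : 0 < b) :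
    Integrable fun x : Phase n => Real.exp (-b * ‖x‖ ^ 2) := by
  have h := (GaussianFourier.integrable_cexp_neg_mul_sq_norm_add (V := Phase n) (b := (b : ℂ))
    (by simpa using hb) 0 0).norm
  refine h.congr (Filter.Eventually.of_forall fun x => ?_)
  simp [Complex.norm_exp, ← Complex.ofReal_pow]

variable {s}

/-- The generating function grows at most like exp(B²‖x‖²/2) for any B > a, and the midpoint B² =
(a² + s)/2 leaves Gaussian decay. Density operators have a = 1, so that s = 1 is the borderline
case; hence the cut-off s = 1 + ε. -/
lemma exists_norm_husimi_le (ha : 0 ≤ a) (hs : a ^ 2 < s) (hR : R ∈ growth n a) :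
    ∃ C b : ℝ, 0 < b ∧ 0 ≤ C ∧ ∀ k x, ‖husimi k s R x‖ ≤ C * Real.exp (-b * ‖x‖ ^ 2) := by
  have hs0 : 0 < s := (sq_nonneg a).trans_lt hs
  set B := Real.sqrt ((a ^ 2 + s) / 2)
  have hB2 : B ^ 2 = (a ^ 2 + s) / 2 := Real.sq_sqrt (by positivity)
  have hB : a < B := by
    rw [Real.lt_sqrt ha]; linarith
  obtain ⟨C, hC0, hC⟩ := exists_norm_genFun_le ha hR hB
  refine ⟨C, (s - a ^ 2) / 4, by linarith, hC0, fun k x => ?_⟩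
  rw [husimi, norm_mul, norm_planeWave]
  calc ‖genFun R (zOf x)‖ * Real.exp (-(s / 2) * ‖x‖ ^ 2)
      ≤ C * Real.exp (B ^ 2 / 2 * ∑ i, ‖zOf x i‖ ^ 2) * Real.exp (-(s / 2) * ‖x‖ ^ 2) := by
        gcongr; exact hC _
    _ = _ := by
        rw [sum_norm_sq_zOf, mul_assoc, ← Real.exp_add, hB2]
        congr 2
        ring

lemma integrable_husimi (ha : 0 ≤ a) (hs : a ^ 2 < s) (hR : R ∈ growth n a) :
    Integrable (husimi k s R) := by
  obtain ⟨C, b, hb, -, hC⟩ := exists_norm_husimi_le ha hs hR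
  exact ((integrable_exp_neg_norm_sq hb).const_mul C).mono'
    (continuous_husimi k s ha hR).aestronglyMeasurable (Filter.Eventually.of_forall (hC k))

/-- The Fourier transform of the phase-space function with a Gaussian cut-off. -/
def fourierHusimi (k : Mode n → ℝ) (s : ℝ) (R : Op n) : ℂ := ∫ x, husimi k s R x

lemma fourierHusimi_add (ha : 0 ≤ a) (hs : a ^ 2 < s) (hR : R ∈ growth n a)
    (hR' : R' ∈ growth n a) :
    fourierHusimi k s (R + R') = fourierHusimi k s R + fourierHusimi k s R' := by
  rw [fourierHusimi, fourierHusimi, fourierHusimi,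
    ← integral_add (integrable_husimi k ha hs hR) (integrable_husimi k ha hs hR')]
  exact integral_congr_ae (Filter.Eventually.of_forall fun x => husimi_add k s ha hR hR' x)

lemma fourierHusimi_smul (s : ℝ) (c : ℂ) (R : Op n) :
    fourierHusimi k s (c • R) = c * fourierHusimi k s R := by
  rw [fourierHusimi, fourierHusimi, ← integral_const_mul]
  exact integral_congr_ae (Filter.Eventually.of_forall fun x => husimi_smul k s c R x)

lemma fourierHusimi_sum (ha : 0 ≤ a) (hs : a ^ 2 < s) {κ : Type*} (t : Finset κ) {T : κ → Op n}
    (hT : ∀ j, T j ∈ growth n a) :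
    fourierHusimi k s (∑ j ∈ t, T j) = ∑ j ∈ t, fourierHusimi k s (T j) := by
  classical
  induction t using Finset.induction_on with
  | empty => simpa using fourierHusimi_smul k s 0 (0 : Op n)
  | insert j t hj ih =>
    rw [Finset.sum_insert hj, Finset.sum_insert hj,
      fourierHusimi_add k ha hs (hT j) ((growth n a).sum_mem fun j _ => hT j), ih]

/-- Integration by parts. -/
lemma fourierHusimi_DD (ha : 0 ≤ a) (hs : a ^ 2 < s) (hR : R ∈ growth n a) (μ : Mode n) :
    fourierHusimi k s (DD μ R) =
      s * fourierHusimi k s (XX μ R) - Complex.I * k μ * fourierHusimi k s R := by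
  have i0 := integrable_husimi k ha hs hR
  have i1 := integrable_husimi k ha hs (growth_DD ha hR μ)
  have i2 := integrable_husimi k ha hs (growth_XX ha hR μ)
  have i3 : Integrable fun x => Complex.I * k μ * husimi k s R x - s * husimi k s (XX μ R) x :=
    (i0.const_mul _).sub (i2.const_mul _)
  -- Integration by parts against the constant 1: the integral of the directional derivative is
  -- zero.
  have h := integral_bilinear_hasLineDerivAt_right_eq_neg_left_of_integrable
    (f := fun _ : Phase n => (1 : ℂ)) (f' := fun _ => 0) (g := husimi k s R)
    (g' := fun x => husimi k s (DD μ R) x +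
      (Complex.I * k μ * husimi k s R x - s * husimi k s (XX μ R) x))
    (v := EuclideanSpace.single μ (1 : ℝ)) (B := ContinuousLinearMap.mul ℝ ℂ) (μ := volume)
    (by simp) ((i1.add i3).congr (Filter.Eventually.of_forall fun x => by simp)) (by simpa using i0)
    (fun x _ => by unfold HasLineDerivAt; exact hasDerivAt_const _ _)
    (fun x _ => hasLineDerivAt_husimi k s ha hR μ x)
  simp only [ContinuousLinearMap.mul_apply', one_mul, zero_mul, integral_zero, neg_zero] at h
  rw [integral_add i1 i3, integral_sub (i0.const_mul _) (i2.const_mul _), integral_const_mul,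
    integral_const_mul] at h
  simp only [fourierHusimi]
  linear_combination h

end Husimi

/-! ### Positive operators and integrability of their Husimi functions -/

open MeasureTheory

section Density
open scoped ComplexOrder

/-- The 2×2 principal minors give |ρ_αβ|² ≤ ρ_αα ρ_ββ, and each diagonal entry is at most the trace.
-/
lemma norm_apply_le_one {ρ : Op n} (hρ : IsDensityOperator ρ) (α β : Occ n) : ‖ρ α β‖ ≤ 1 := by
  have hd : ∀ α, 0 ≤ (ρ α α).re ∧ (ρ α α).im = 0 := fun α => by
    have := Complex.le_def.mp (hρ.1.diag_nonneg (i := α))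
    simpa [eq_comm] using this
  have hsum : HasSum (fun α => (ρ α α).re) 1 := by
    simpa using Complex.hasSum_re hρ.2
  have hle : ∀ α, (ρ α α).re ≤ 1 := fun α => le_hasSum hsum α fun β _ => (hd β).1
  have h2 := Complex.le_def.mp (hρ.1.submatrix ![α, β]).det_nonneg
  rw [Matrix.det_fin_two] at h2
  have hh : ρ β α = star (ρ α β) := (hρ.1.isHermitian.apply β α).symm
  have e1 : (ρ α β * star (ρ α β)).re = ‖ρ α β‖ ^ 2 := by
    rw [RCLike.star_def, Complex.mul_conj']; norm_cast
  have h3 : 0 ≤ (ρ α α).re * (ρ β β).re - ‖ρ α β‖ ^ 2 := by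
    have := h2.1
    simp only [Matrix.submatrix_apply, Matrix.cons_val_zero, Matrix.cons_val_one, hh,
      Complex.sub_re, e1, Complex.mul_re, (hd α).2, zero_mul, Complex.zero_re, sub_zero] at this
    simpa using this
  have h4 : (ρ α α).re * (ρ β β).re ≤ 1 := mul_le_one₀ (hle α) (hd β).1 (hle β)
  nlinarith [norm_nonneg (ρ α β)]

lemma IsDensityOperator.mem_growth {ρ : Op n} (hρ : IsDensityOperator ρ) : ρ ∈ growth n 1 := by
  intro A hA
  refine ⟨1, fun p => ?_⟩
  rw [one_mul]
  exact (norm_apply_le_one hρ _ _).trans (one_le_pow₀ hA.le)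

end Density

/-- The multi-indices all of whose components are smaller than `N`. -/
def box (ι : Type*) [Fintype ι] [DecidableEq ι] (N : ℕ) : Finset (ι → ℕ) :=
  Fintype.piFinset fun _ => Finset.range N

lemma mem_box {ι : Type*} [Fintype ι] [DecidableEq ι] {N : ℕ} {p : ι → ℕ} :
    p ∈ box ι N ↔ ∀ i, p i < N := by
  simp [box]

lemma tendsto_box {ι : Type*} [Fintype ι] [DecidableEq ι] :
    Filter.Tendsto (box ι) Filter.atTop Filter.atTop := by
  refine Filter.tendsto_atTop_finset_of_monotone (fun M N h p hp => ?_) fun p => ⟨deg p + 1, ?_⟩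
  · exact mem_box.mpr fun i => (mem_box.mp hp i).trans_le h
  · exact mem_box.mpr fun i => Nat.lt_succ_of_le (le_deg p i)

/-- Truncation of an operator to finitely many occupation numbers. -/
def truncOp (N : ℕ) (R : Op n) : Op n := Matrix.of fun α β =>
  if (∀ j, α j < N) ∧ ∀ j, β j < N then R α β else 0

lemma entry_truncOp (N : ℕ) (R : Op n) (p : Mode n → ℕ) :
    entry (truncOp N R) p = if p ∈ box (Mode n) N then entry R p else 0 := by
  simp only [entry, truncOp, Matrix.of_apply, mem_box, Sum.forall]

lemma mem_growth_zero_of_finite {R : Op n} (s : Finset (Mode n → ℕ))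
    (h : ∀ p, p ∉ s → entry R p = 0) : R ∈ growth n 0 := by
  intro A hA
  refine ⟨∑ p ∈ s, ‖entry R p‖ / A ^ deg p, fun p => ?_⟩
  by_cases hp : p ∈ s
  · rw [← div_le_iff₀ (by positivity)]
    exact Finset.single_le_sum (f := fun p => ‖entry R p‖ / A ^ deg p)
      (fun _ _ => by positivity) hp
  · rw [h p hp, norm_zero]
    have : 0 ≤ ∑ p ∈ s, ‖entry R p‖ / A ^ deg p := Finset.sum_nonneg fun _ _ => by positivity
    positivity

lemma truncOp_mem_growth (N : ℕ) (R : Op n) : truncOp N R ∈ growth n 0 :=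
  mem_growth_zero_of_finite (box _ N) fun p hp => by rw [entry_truncOp, if_neg hp]

lemma genFun_truncOp (N : ℕ) (R : Op n) (z : Mode n → ℂ) :
    genFun (truncOp N R) z = ∑ p ∈ box (Mode n) N, entry R p * nmono p z := by
  rw [genFun, tsum_eq_sum (s := box (Mode n) N)]
  · exact Finset.sum_congr rfl fun p hp => by rw [entry_truncOp, if_pos hp]
  · intro p hp
    rw [entry_truncOp, if_neg hp, zero_mul]

lemma tendsto_genFun_truncOp {a : ℝ} (ha : 0 ≤ a) {R : Op n} (hR : R ∈ growth n a)
    (z : Mode n → ℂ) :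
    Filter.Tendsto (fun N => genFun (truncOp N R) z) Filter.atTop (nhds (genFun R z)) := by
  simp only [genFun_truncOp]
  exact (summable_genFun ha hR z).hasSum.comp tendsto_box

lemma sum_box_mode {M : Type*} [AddCommMonoid M] (N : ℕ) (f : (Mode n → ℕ) → M) :
    ∑ p ∈ box (Mode n) N, f p =
      ∑ α ∈ box (Fin n) N, ∑ β ∈ box (Fin n) N, f (Sum.elim α β) := by
  rw [← Finset.sum_product']
  refine Finset.sum_equiv (Equiv.sumArrowEquivProdArrow _ _ _) (fun p => ?_) (fun p _ => ?_)
  · simp [mem_box, Equiv.sumArrowEquivProdArrow]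
  · congr 1
    funext i
    rcases i with i | i <;> rfl

lemma zOf_inr (x : Phase n) (j : Fin n) : zOf x (Sum.inr j) = star (zOf x (Sum.inl j)) := by
  simp only [zOf, Matrix.mulVec, dotProduct, Matrix.conjTranspose_apply, phaseBasis_inr, star_sum,
    star_mul']
  simp

lemma nmono_zOf (α β : Occ n) (x : Phase n) : nmono (Sum.elim α β) (zOf x) =
    nmono α (fun j => zOf x (Sum.inl j)) * star (nmono β fun j => zOf x (Sum.inl j)) := by
  simp only [nmono, Fintype.prod_sum_type, Sum.elim_inl, Sum.elim_inr, zOf_inr]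
  congr 1
  rw [← starRingEnd_apply, map_prod]
  simp

section Density
open scoped ComplexOrder

/-- At `zOf x` the column variables are the conjugates of the row variables, so the truncated series
is the quadratic form of a finite principal submatrix. -/
lemma genFun_truncOp_nonneg {ρ : Op n} (hρ : ρ.PosSemidef) (N : ℕ) (x : Phase n) :
    0 ≤ genFun (truncOp N ρ) (zOf x) := by
  rw [genFun_truncOp, sum_box_mode]
  have h := (hρ.submatrix (Subtype.val : box (Fin n) N → Occ n)).dotProduct_mulVec_nonneg
    fun α => star (nmono α.1 fun j => zOf x (Sum.inl j))
  refine h.trans_eq ?_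
  rw [← Finset.sum_coe_sort]
  refine Finset.sum_congr rfl fun α _ => ?_
  rw [← Finset.sum_coe_sort, Matrix.mulVec, dotProduct, Finset.mul_sum]
  refine Finset.sum_congr rfl fun β _ => ?_
  rw [nmono_zOf, entry]
  simp only [Pi.star_apply, star_star, Sum.elim_inl, Sum.elim_inr, Matrix.submatrix_apply]
  ring

lemma husimi_zero_eq {R : Op n} (s : ℝ) (x : Phase n) :
    husimi 0 s R x = genFun R (zOf x) * (Real.exp (-(s / 2) * ‖x‖ ^ 2) : ℝ) := by
  rw [husimi, planeWave]
  simp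

end Density

/-! ### The phase-space integral as a trace -/

/-- Matrix units. -/
def unitOp (p : Mode n → ℕ) : Op n := Matrix.of fun α β => if Sum.elim α β = p then 1 else 0

lemma entry_unitOp (p q : Mode n → ℕ) : entry (unitOp p) q = if q = p then 1 else 0 := by
  have : Sum.elim (fun j => q (Sum.inl j)) (fun j => q (Sum.inr j)) = q := by
    funext i; rcases i with i | i <;> rfl
  rw [entry, unitOp, Matrix.of_apply, this]

lemma unitOp_mem_growth (p : Mode n → ℕ) : unitOp p ∈ growth n 0 :=
  mem_growth_zero_of_finite {p} fun q hq => by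
    rw [entry_unitOp, if_neg (by simpa using hq)]

lemma dz_unitOp_add_single (p : Mode n → ℕ) (i : Mode n) :
    dz i (unitOp (p + Pi.single i 1)) = (Real.sqrt (p i + 1) : ℂ) • unitOp p := by
  apply entry_ext
  intro q
  rw [entry_dz, entry_smul, entry_unitOp, entry_unitOp]
  by_cases h : q = p
  · simp [h]
  · simp [h]

lemma dz_unitOp_eq_zero {p : Mode n → ℕ} {i : Mode n} (h : p i = 0) : dz i (unitOp p) = 0 := by
  apply entry_ext
  intro q
  rw [entry_dz, entry_unitOp, if_neg, mul_zero, entry_zero]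
  rintro rfl
  simp at h

lemma zz_unitOp (p : Mode n → ℕ) (i : Mode n) :
    zz i (unitOp p) = (Real.sqrt (p i + 1) : ℂ) • unitOp (p + Pi.single i 1) := by
  apply entry_ext
  intro q
  rw [entry_zz, entry_smul, entry_unitOp, entry_unitOp]
  by_cases hq : q i = 0
  · have : q ≠ p + Pi.single i 1 := by rintro rfl; simp at hq
    simp [hq, this]
  · obtain ⟨q, rfl⟩ : ∃ r : Mode n → ℕ, q = r + Pi.single i 1 := ⟨_, (sub_single_add_single hq).symm⟩
    rw [add_tsub_cancel_right]
    by_cases h : q = p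
    · simp [h]
    · simp [h]

section Trace

lemma fourierHusimi_zero_DD {R : Op n} (hR : R ∈ growth n 0) (μ : Mode n) :
    fourierHusimi 0 1 (DD μ R) = fourierHusimi 0 1 (XX μ R) := by
  rw [fourierHusimi_DD 0 le_rfl (by norm_num) hR]
  simp

/-- These are the cyclicity relations Tr(aR) = Tr(Ra) and Tr(Ra†) = Tr(a†R), here for the
phase-space integral. -/
lemma fourierHusimi_dz {R : Op n} (hR : R ∈ growth n 0) (j : Fin n) :
    fourierHusimi 0 1 (dz (Sum.inl j) R) = fourierHusimi 0 1 (zz (Sum.inr j) R) ∧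
      fourierHusimi 0 1 (dz (Sum.inr j) R) = fourierHusimi 0 1 (zz (Sum.inl j) R) := by
  have h1 := fourierHusimi_zero_DD hR (Sum.inl j)
  have h2 := fourierHusimi_zero_DD hR (Sum.inr j)
  have hd := growth_dz le_rfl hR
  have hz := growth_zz le_rfl hR
  have hs : (0 : ℝ) ^ 2 < 1 := by norm_num
  have hsub : ∀ {R R' : Op n}, R ∈ growth n 0 → R' ∈ growth n 0 →
      fourierHusimi 0 1 (R - R') = fourierHusimi 0 1 R - fourierHusimi 0 1 R' := by
    intro R R' hR hR'
    rw [sub_eq_add_neg, ← neg_one_smul ℂ R', fourierHusimi_add 0 le_rfl hs hR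
      ((growth n 0).smul_mem _ hR'), fourierHusimi_smul]
    ring
  simp only [DD, XX, LinearMap.smul_apply, LinearMap.add_apply, LinearMap.sub_apply,
    fourierHusimi_smul, fourierHusimi_add 0 le_rfl hs (hd _) (hd _),
    fourierHusimi_add 0 le_rfl hs (hz _) (hz _), hsub (hd _) (hd _), hsub (hz _) (hz _)] at h1 h2
  have h3 := mul_left_cancel₀ (one_div_ne_zero sqrt_two_ne_zero_complex) h1
  have h4 := mul_left_cancel₀ (div_ne_zero Complex.I_ne_zero sqrt_two_ne_zero_complex) h2
  constructor
  · linear_combination (h3 + h4) / 2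
  · linear_combination (h3 - h4) / 2

lemma elim_add_single_inl (α β : Occ n) (j : Fin n) :
    (Sum.elim (α + Pi.single j 1) β : Mode n → ℕ) = Sum.elim α β + Pi.single (Sum.inl j) 1 := by
  funext i
  rcases i with i | i <;> simp [Pi.single_apply]

lemma elim_add_single_inr (α β : Occ n) (j : Fin n) :
    (Sum.elim α (β + Pi.single j 1) : Mode n → ℕ) = Sum.elim α β + Pi.single (Sum.inr j) 1 := by
  funext i
  rcases i with i | i <;> simp [Pi.single_apply]

/-- Cyclicity reduces every matrix unit to the vacuum unit or to zero, so the integral is a constant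
times the trace and no Gaussian moment has to be computed. -/
lemma fourierHusimi_unitOp (α β : Occ n) : fourierHusimi 0 1 (unitOp (Sum.elim α β)) =
    if α = β then fourierHusimi 0 1 (unitOp (0 : Mode n → ℕ)) else 0 := by
  have hs0 : ∀ m : ℕ, (Real.sqrt ((m : ℝ) + 1) : ℂ) ≠ 0 := fun m => by
    rw [Complex.ofReal_ne_zero]; exact (Real.sqrt_pos.mpr (by positivity)).ne'
  induction α using multiIndex_induction generalizing β with
  | zero =>
    split_ifs with h
    · subst h
      congr 2
      funext i
      rcases i with i | i <;> rfl
    · obtain ⟨β, j, rfl⟩ := exists_eq_add_single (Ne.symm h)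
      have h1 := (fourierHusimi_dz (unitOp_mem_growth (Sum.elim (0 : Occ n) β)) j).1
      rw [dz_unitOp_eq_zero (by simp), zz_unitOp, fourierHusimi_smul, ← elim_add_single_inr] at h1
      have h0 : fourierHusimi 0 1 (0 : Op n) = 0 := by
        simpa using fourierHusimi_smul 0 1 0 (0 : Op n)
      rw [h0] at h1
      exact (mul_eq_zero.mp h1.symm).resolve_left (hs0 _)
  | add α j ih =>
    have h1 := (fourierHusimi_dz (unitOp_mem_growth (Sum.elim α β)) j).2
    rw [zz_unitOp, fourierHusimi_smul, ← elim_add_single_inl] at h1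
    have h0 : fourierHusimi 0 1 (0 : Op n) = 0 := by
      simpa using fourierHusimi_smul 0 1 0 (0 : Op n)
    by_cases hβ : β j = 0
    · rw [dz_unitOp_eq_zero (by simpa using hβ), h0] at h1
      rw [if_neg (by rintro rfl; simp at hβ)]
      exact (mul_eq_zero.mp h1.symm).resolve_left (hs0 _)
    · obtain ⟨β, rfl⟩ : ∃ γ : Occ n, β = γ + Pi.single j 1 := ⟨_, (sub_single_add_single hβ).symm⟩
      rw [elim_add_single_inr, dz_unitOp_add_single, fourierHusimi_smul, ih,
        ← elim_add_single_inr] at h1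
      by_cases h : α = β
      · subst h
        rw [if_pos rfl] at h1 ⊢
        simp only [Sum.elim_inl, Sum.elim_inr] at h1
        exact (mul_left_cancel₀ (hs0 _) h1).symm
      · rw [if_neg h, mul_zero] at h1
        rw [if_neg (by simpa using h)]
        exact (mul_eq_zero.mp h1.symm).resolve_left (hs0 _)

lemma fourierHusimi_truncOp (N : ℕ) (R : Op n) : fourierHusimi 0 1 (truncOp N R) =
    fourierHusimi 0 1 (unitOp (0 : Mode n → ℕ)) * ∑ α ∈ box (Fin n) N, R α α := by
  have e : truncOp N R = ∑ p ∈ box (Mode n) N, entry R p • unitOp p := by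
    apply entry_ext
    intro q
    simp [entry_sum, entry_truncOp, entry_smul, entry_unitOp]
  rw [e, fourierHusimi_sum 0 le_rfl (by norm_num) _
    fun p => (growth n 0).smul_mem _ (unitOp_mem_growth p), sum_box_mode, Finset.mul_sum]
  refine Finset.sum_congr rfl fun α hα => ?_
  simp only [fourierHusimi_smul, fourierHusimi_unitOp, mul_ite, mul_zero, Finset.sum_ite_eq, hα,
    if_true]
  rw [mul_comm]; rfl

end Trace

section Density
open scoped ComplexOrder

/-- Truncations have non-negative Husimi functions whose integrals are a constant times partial
traces, hence uniformly bounded. Fatou's lemma passes to the limit. -/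
lemma IsDensityOperator.integrable_husimi {ρ : Op n} (hρ : IsDensityOperator ρ) :
    Integrable (husimi 0 1 ρ) := by
  have hg := hρ.mem_growth
  have hd : ∀ α, 0 ≤ (ρ α α).re ∧ (ρ α α).im = 0 := fun α => by
    have := Complex.le_def.mp (hρ.1.diag_nonneg (i := α))
    simpa [eq_comm] using this
  have hsum : HasSum (fun α => (ρ α α).re) 1 := by
    simpa using Complex.hasSum_re hρ.2
  set c := fourierHusimi 0 1 (unitOp (0 : Mode n → ℕ))
  have hint : ∀ N, Integrable (husimi 0 1 (truncOp N ρ)) := fun N =>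
    QuasiFreeBoson.integrable_husimi 0 le_rfl (by norm_num) (truncOp_mem_growth N ρ)
  have hnn : ∀ N x, 0 ≤ husimi 0 1 (truncOp N ρ) x := fun N x => by
    rw [husimi_zero_eq]
    refine mul_nonneg (genFun_truncOp_nonneg hρ.1 N x) ?_
    exact_mod_cast (Real.exp_pos _).le
  have hbound : ∀ N, ∫⁻ x, ‖husimi 0 1 (truncOp N ρ) x‖ₑ ≤ ENNReal.ofReal ‖c‖ := by
    intro N
    rw [← ofReal_integral_norm_eq_lintegral_enorm (hint N)]
    refine ENNReal.ofReal_le_ofReal ?_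
    have e : ((∫ x, ‖husimi 0 1 (truncOp N ρ) x‖ : ℝ) : ℂ) = fourierHusimi 0 1 (truncOp N ρ) := by
      rw [fourierHusimi, ← integral_complex_ofReal]
      refine integral_congr_ae (Filter.Eventually.of_forall fun x => ?_)
      exact Complex.norm_of_nonneg' (hnn N x)
    have e2 : (∫ x, ‖husimi 0 1 (truncOp N ρ) x‖) =
        ‖fourierHusimi 0 1 (truncOp N ρ)‖ := by
      rw [← e, Complex.norm_real, Real.norm_of_nonneg (integral_nonneg fun _ => norm_nonneg _)]
    rw [e2, fourierHusimi_truncOp, norm_mul]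
    refine mul_le_of_le_one_right (norm_nonneg _) ?_
    have e3 : ∑ α ∈ box (Fin n) N, ρ α α = ((∑ α ∈ box (Fin n) N, (ρ α α).re : ℝ) : ℂ) := by
      push_cast
      refine Finset.sum_congr rfl fun α _ => ?_
      apply Complex.ext <;> simp [hd α]
    rw [e3, Complex.norm_real, Real.norm_of_nonneg (Finset.sum_nonneg fun α _ => (hd α).1)]
    exact sum_le_hasSum _ (fun α _ => (hd α).1) hsum
  have hmeas := (continuous_husimi 0 1 zero_le_one hg).aestronglyMeasurable (μ := volume)
  refine ⟨hmeas, ?_⟩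
  refine lt_of_le_of_lt ?_ (ENNReal.ofReal_lt_top (r := ‖c‖))
  calc ∫⁻ x, ‖husimi 0 1 ρ x‖ₑ
      = ∫⁻ x, Filter.liminf (fun N => ‖husimi 0 1 (truncOp N ρ) x‖ₑ) Filter.atTop := by
        refine lintegral_congr fun x => (Filter.Tendsto.liminf_eq ?_).symm
        exact ((tendsto_genFun_truncOp zero_le_one hg (zOf x)).mul_const _).enorm
    _ ≤ Filter.liminf (fun N => ∫⁻ x, ‖husimi 0 1 (truncOp N ρ) x‖ₑ) Filter.atTop :=
        lintegral_liminf_le' fun N => (hint N).1.aemeasurable.enorm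
    _ ≤ Filter.liminf (fun _ : ℕ => ENNReal.ofReal ‖c‖) Filter.atTop :=
        Filter.liminf_le_liminf (Filter.Eventually.of_forall hbound)
    _ = ENNReal.ofReal ‖c‖ := Filter.liminf_const _

end Density

/-- An operator is determined by its Husimi function. -/
lemma eq_zero_of_husimi_eq_zero {a : ℝ} (ha : 0 ≤ a) {R : Op n} (hR : R ∈ growth n a)
    (h : ∀ x, genFun R (zOf x) = 0) : R = 0 := by
  -- Real directional derivatives on phase space determine all ∂_i, because `phaseBasis` is
  -- invertible. Vanishing thus propagates to all derivatives at 0, that is, to all entries.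
  have key : ∀ R : Op n, R ∈ growth n a → (∀ x : Phase n, genFun R (zOf x) = 0) →
      ∀ i, ∀ x : Phase n, genFun (dz i R) (zOf x) = 0 := by
    intro R hR h i x
    have hD : ∀ μ, ∑ i, star (phaseBasis n μ i) * genFun (dz i R) (zOf x) = 0 := by
      intro μ
      have h1 := hasDerivAt_genFun ha hR (zOf x) (zOf (EuclideanSpace.single μ 1))
      simp only [zOf_single, ← zOf_add_smul, h] at h1
      exact h1.unique (hasDerivAt_const _ _)
    have hv : ((phaseBasis n)ᴴ)ᵀ *ᵥ (fun i => genFun (dz i R) (zOf x)) = 0 := funext hD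
    have h2 := congrArg ((phaseBasis n)ᵀ *ᵥ ·) hv
    simp only [Matrix.mulVec_mulVec, phaseBasis_transpose_mul, Matrix.one_mulVec,
      Matrix.mulVec_zero] at h2
    exact congrFun h2 i
  apply entry_ext
  intro p
  rw [entry_zero]
  induction p using multiIndex_induction generalizing R with
  | zero =>
    rw [← genFun_apply_zero, ← zOf_zero]
    exact h 0
  | add p i ih =>
    have h1 := ih (growth_dz ha hR i) (key R hR h i)
    rw [entry_dz] at h1
    refine (mul_eq_zero.mp h1).resolve_left (Complex.ofReal_ne_zero.mpr ?_)
    exact (Real.sqrt_pos.mpr (by positivity)).ne'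

/-! ### Evolution of the characteristic function -/

open MeasureTheory

section Characteristic
variable {k : Mode n → ℝ} {ε : ℝ} {R : Op n}

lemma growth_bOp' {a : ℝ} (ha : 0 ≤ a) (hR : R ∈ growth n a) (μ : Mode n) :
    bOp' μ R ∈ growth n a := by
  rw [bOp'_eq, LinearMap.smul_apply, LinearMap.sub_apply]
  exact (growth n a).smul_mem _ ((growth n a).sub_mem (growth_XX ha hR μ) (growth_DD ha hR μ))

lemma fourierHusimi_sub {a s : ℝ} (ha : 0 ≤ a) (hs : a ^ 2 < s) {R R' : Op n}
    (hR : R ∈ growth n a) (hR' : R' ∈ growth n a) :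
    fourierHusimi k s (R - R') = fourierHusimi k s R - fourierHusimi k s R' := by
  rw [sub_eq_add_neg, ← neg_one_smul ℂ R', fourierHusimi_add k ha hs hR
    ((growth n a).smul_mem _ hR'), fourierHusimi_smul]
  ring

lemma one_sq_lt (hε : 0 < ε) : (1 : ℝ) ^ 2 < 1 + ε := by linarith [one_pow (M := ℝ) 2]

/-- Integration by parts replaces D by (1 + ε)X - ik, so X - D becomes ik up to a term of order ε.
-/
lemma fourierHusimi_bOp' (hε : 0 < ε) (hR : R ∈ growth n 1) (μ : Mode n) :
    fourierHusimi k (1 + ε) (bOp' μ R) = 1 / (Real.sqrt 2 : ℂ) *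
      (Complex.I * k μ * fourierHusimi k (1 + ε) R - ε * fourierHusimi k (1 + ε) (XX μ R)) := by
  rw [bOp'_eq, LinearMap.smul_apply, LinearMap.sub_apply, fourierHusimi_smul,
    fourierHusimi_sub zero_le_one (one_sq_lt hε) (growth_XX zero_le_one hR μ)
      (growth_DD zero_le_one hR μ), fourierHusimi_DD k zero_le_one (one_sq_lt hε) hR]
  push_cast
  ring

lemma sqrt_two_eq : (Real.sqrt 2 : ℂ) = 2 * (1 / (Real.sqrt 2 : ℂ)) := by
  rw [mul_one_div, eq_div_iff sqrt_two_ne_zero_complex, sqrt_two_mul_self_complex]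

/-- The matrix `2 Γ + 1`. -/
def doubledCov (Γ : Matrix (Mode n) (Mode n) ℝ) : Matrix (Mode n) (Mode n) ℝ := (2 : ℝ) • Γ + 1

/-- Written with b' in place of D, e contains X only once; the rest is multiplication by wave
numbers up to the cut-off. -/
lemma eOp_apply_eq_XX (Γ : Matrix (Mode n) (Mode n) ℝ) (ν : Mode n) (R : Op n) :
    eOp Γ ν R = (Real.sqrt 2 : ℂ) • XX ν R -
      ∑ σ, (doubledCov Γ ν σ : ℂ) • bOp' σ R := by
  have h1 : ∑ σ, (doubledCov Γ ν σ : ℂ) • bOp' σ R =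
      (2 : ℂ) • ∑ σ, (Γ ν σ : ℂ) • bOp' σ R + bOp' ν R := by
    have : ∀ σ, ((doubledCov Γ ν σ : ℝ) : ℂ) = 2 * (Γ ν σ : ℂ) + if ν = σ then 1 else 0 := by
      intro σ
      rw [doubledCov, Matrix.add_apply, Matrix.smul_apply, Matrix.one_apply]
      split_ifs <;> simp
    simp only [this, add_smul, Finset.sum_add_distrib, ite_smul, one_smul, zero_smul,
      Finset.sum_ite_eq, Finset.mem_univ, if_true, Finset.smul_sum, mul_smul]
  rw [h1, sqrt_two_eq]
  simp only [eOp, LinearMap.sub_apply, LinearMap.smul_apply, LinearMap.sum_apply]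
  rw [bOp_eq, LinearMap.smul_apply, LinearMap.add_apply]
  have hb : bOp' ν R = (1 / (Real.sqrt 2 : ℂ)) • (XX ν R - DD ν R) := by
    rw [bOp'_eq, LinearMap.smul_apply, LinearMap.sub_apply]
  rw [hb]
  module

lemma XX_bOp' (μ σ : Mode n) (R : Op n) : XX μ (bOp' σ R) = bOp' σ (XX μ R) +
    (1 / (Real.sqrt 2 : ℂ)) • (if μ = σ then (1 : ℂ) else 0) • R := by
  have h1 := LinearMap.congr_fun (DD_mul_XX σ μ) R
  have h2 := LinearMap.congr_fun (XX_mul_XX σ μ) R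
  simp only [Module.End.mul_apply, LinearMap.add_apply, LinearMap.smul_apply,
    Module.End.one_apply] at h1 h2
  simp only [bOp'_eq, LinearMap.smul_apply, LinearMap.sub_apply, map_smul, map_sub, h1, h2,
    eq_comm (a := σ)]
  module

/-- The moments that control the cut-off. -/
def cutoffMoment (ε : ℝ) (R : Op n) : ℝ := ∫ x, (1 + ‖x‖ ^ 2) * ‖husimi 0 (1 + ε) R x‖

lemma norm_husimi_eq (k : Mode n → ℝ) (s : ℝ) (R : Op n) (x : Phase n) :
    ‖husimi k s R x‖ = ‖husimi 0 s R x‖ := by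
  simp only [husimi, norm_mul, norm_planeWave]

lemma abs_apply_le_norm (x : Phase n) (μ : Mode n) : |x μ| ≤ ‖x‖ := by
  simpa using PiLp.norm_apply_le x μ

lemma integrable_cutoffMoment (hε : 0 < ε) (hR : R ∈ growth n 1) :
    Integrable fun x : Phase n => (1 + ‖x‖ ^ 2) * ‖husimi 0 (1 + ε) R x‖ := by
  have h0 := (integrable_husimi 0 zero_le_one (one_sq_lt hε) hR).norm
  have h1 : Integrable fun x : Phase n => ‖x‖ ^ 2 * ‖husimi 0 (1 + ε) R x‖ := by
    have : ∀ x : Phase n, ‖x‖ ^ 2 * ‖husimi 0 (1 + ε) R x‖ =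
        ∑ μ, x μ * (x μ * ‖husimi 0 (1 + ε) R x‖) := by
      intro x
      rw [EuclideanSpace.norm_sq_eq, Finset.sum_mul]
      refine Finset.sum_congr rfl fun μ _ => ?_
      rw [Real.norm_eq_abs, sq_abs]; ring
    simp only [this]
    refine integrable_finsetSum _ fun μ _ => ?_
    refine (integrable_husimi 0 zero_le_one (one_sq_lt hε)
      (growth_XX zero_le_one (growth_XX zero_le_one hR μ) μ)).norm.congr
      (Filter.Eventually.of_forall fun x => ?_)
    simp only [husimi_XX 0 (1 + ε) zero_le_one (growth_XX zero_le_one hR μ),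
      husimi_XX 0 (1 + ε) zero_le_one hR, norm_mul, Complex.norm_real, Real.norm_eq_abs]
    rw [← mul_assoc, ← mul_assoc, abs_mul_abs_self]
  refine (h0.add h1).congr (Filter.Eventually.of_forall fun x => ?_)
  simp only [Pi.add_apply]
  ring

lemma norm_fourierHusimi_le (hε : 0 < ε) (hR : R ∈ growth n 1) {T : Op n} (hT : ∀ x,
    ‖husimi k (1 + ε) T x‖ ≤ (1 + ‖x‖ ^ 2) * ‖husimi 0 (1 + ε) R x‖) :
    ‖fourierHusimi k (1 + ε) T‖ ≤ cutoffMoment ε R :=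
  norm_integral_le_of_norm_le (integrable_cutoffMoment hε hR) (Filter.Eventually.of_forall hT)

lemma norm_fourierHusimi_self_le (hε : 0 < ε) (hR : R ∈ growth n 1) :
    ‖fourierHusimi k (1 + ε) R‖ ≤ cutoffMoment ε R := by
  refine norm_fourierHusimi_le hε hR fun x => ?_
  rw [norm_husimi_eq]
  nlinarith [norm_nonneg (husimi 0 (1 + ε) R x), sq_nonneg ‖x‖]

lemma norm_fourierHusimi_XX_le (hε : 0 < ε) (hR : R ∈ growth n 1) (μ : Mode n) :
    ‖fourierHusimi k (1 + ε) (XX μ R)‖ ≤ cutoffMoment ε R := by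
  refine norm_fourierHusimi_le hε hR fun x => ?_
  rw [husimi_XX k _ zero_le_one hR, norm_mul, norm_husimi_eq, Complex.norm_real, Real.norm_eq_abs]
  gcongr
  have := abs_apply_le_norm x μ
  nlinarith [sq_nonneg (‖x‖ - 1)]

lemma norm_fourierHusimi_XX_XX_le (hε : 0 < ε) (hR : R ∈ growth n 1) (μ ν : Mode n) :
    ‖fourierHusimi k (1 + ε) (XX μ (XX ν R))‖ ≤ cutoffMoment ε R := by
  refine norm_fourierHusimi_le hε hR fun x => ?_
  rw [husimi_XX k _ zero_le_one (growth_XX zero_le_one hR ν), husimi_XX k _ zero_le_one hR,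
    norm_mul, norm_mul, norm_husimi_eq, Complex.norm_real, Complex.norm_real, ← mul_assoc,
    Real.norm_eq_abs, Real.norm_eq_abs]
  gcongr
  have h1 := abs_apply_le_norm x μ
  have h2 := abs_apply_le_norm x ν
  have := mul_le_mul h1 h2 (abs_nonneg _) (norm_nonneg _)
  nlinarith

lemma fourierHusimi_eOp (hε : 0 < ε) (hR : R ∈ growth n 1) (Γ : Matrix (Mode n) (Mode n) ℝ)
    (ν : Mode n) : fourierHusimi k (1 + ε) (eOp Γ ν R) =
      (Real.sqrt 2 : ℂ) * fourierHusimi k (1 + ε) (XX ν R) -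
        ∑ σ, (doubledCov Γ ν σ : ℂ) * fourierHusimi k (1 + ε) (bOp' σ R) := by
  have hb := fun σ => growth_bOp' zero_le_one hR σ
  rw [eOp_apply_eq_XX, fourierHusimi_sub zero_le_one (one_sq_lt hε)
    ((growth n 1).smul_mem _ (growth_XX zero_le_one hR ν))
    ((growth n 1).sum_mem fun σ _ => (growth n 1).smul_mem _ (hb σ)),
    fourierHusimi_sum k zero_le_one (one_sq_lt hε) _ fun σ => (growth n 1).smul_mem _ (hb σ)]
  simp only [fourierHusimi_smul]

lemma fourierHusimi_XX_eOp (hε : 0 < ε) (hR : R ∈ growth n 1) (Γ : Matrix (Mode n) (Mode n) ℝ)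
    (μ ν : Mode n) : fourierHusimi k (1 + ε) (XX μ (eOp Γ ν R)) =
      (Real.sqrt 2 : ℂ) * fourierHusimi k (1 + ε) (XX μ (XX ν R)) -
        ∑ σ, (doubledCov Γ ν σ : ℂ) * (fourierHusimi k (1 + ε) (bOp' σ (XX μ R)) +
          1 / (Real.sqrt 2 : ℂ) * ((if μ = σ then 1 else 0) * fourierHusimi k (1 + ε) R)) := by
  have hb := fun σ => growth_XX zero_le_one (growth_bOp' zero_le_one hR σ) μ
  have hX := growth_XX zero_le_one hR μ
  rw [eOp_apply_eq_XX, map_sub, map_sum, map_smul, fourierHusimi_sub zero_le_one (one_sq_lt hε)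
    ((growth n 1).smul_mem _ (growth_XX zero_le_one (growth_XX zero_le_one hR ν) μ))]
  · simp only [map_smul]
    rw [fourierHusimi_sum k zero_le_one (one_sq_lt hε) _ fun σ => (growth n 1).smul_mem _ (hb σ)]
    simp only [fourierHusimi_smul, XX_bOp']
    congr 1
    refine Finset.sum_congr rfl fun σ _ => ?_
    rw [fourierHusimi_add k zero_le_one (one_sq_lt hε) (growth_bOp' zero_le_one hX σ)
      ((growth n 1).smul_mem _ ((growth n 1).smul_mem _ hR)), fourierHusimi_smul,
      fourierHusimi_smul]
  · refine (growth n 1).sum_mem fun σ _ => ?_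
    rw [map_smul]
    exact (growth n 1).smul_mem _ (hb σ)

/-- The contribution of the cut-off to the evolution of the characteristic function. -/
def cutoffError (Γ : Matrix (Mode n) (Mode n) ℝ) (k : Mode n → ℝ) (ε : ℝ) (R : Op n)
    (μ ν : Mode n) : ℂ :=
  Complex.I * k μ * (1 / 2 * ∑ σ, (doubledCov Γ ν σ : ℂ) * fourierHusimi k (1 + ε) (XX σ R))
    - fourierHusimi k (1 + ε) (XX μ (XX ν R))
    + 1 / 2 * ∑ σ, (doubledCov Γ ν σ : ℂ) * (Complex.I * k σ * fourierHusimi k (1 + ε) (XX μ R)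
      - ε * fourierHusimi k (1 + ε) (XX σ (XX μ R))
      + (if μ = σ then 1 else 0) * fourierHusimi k (1 + ε) R)

/-- The first term generates transport in k, the second the Gaussian factor, and every term due to
the cut-off is collected in the third. -/
lemma fourierHusimi_bOp'_eOp (hε : 0 < ε) (hR : R ∈ growth n 1)
    (Γ : Matrix (Mode n) (Mode n) ℝ) (μ ν : Mode n) :
    fourierHusimi k (1 + ε) (bOp' μ (eOp Γ ν R)) =
      Complex.I * k μ * fourierHusimi k (1 + ε) (XX ν R)
        + k μ * (1 / 2 * ∑ σ, (doubledCov Γ ν σ : ℂ) * k σ) * fourierHusimi k (1 + ε) R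
        + ε * cutoffError Γ k ε R μ ν := by
  have hX := fun σ => growth_XX zero_le_one hR σ
  have he : eOp Γ ν R ∈ growth n 1 := by
    rw [eOp_apply_eq_XX]
    exact (growth n 1).sub_mem ((growth n 1).smul_mem _ (hX ν))
      ((growth n 1).sum_mem fun σ _ => (growth n 1).smul_mem _ (growth_bOp' zero_le_one hR σ))
  rw [fourierHusimi_bOp' hε he, fourierHusimi_eOp hε hR, fourierHusimi_XX_eOp hε hR]
  simp only [fourierHusimi_bOp' hε hR, fourierHusimi_bOp' hε (hX _)]
  set c : ℂ := 1 / (Real.sqrt 2 : ℂ) with hc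
  have hcc : c * c = 1 / 2 := one_div_sqrt_two_mul_self
  have hI := Complex.I_mul_I
  set ℓ := fourierHusimi k (1 + ε)
  set g : Mode n → ℂ := fun σ => ((doubledCov Γ ν σ : ℝ) : ℂ)
  have e1 : ∑ σ, g σ * (c * (Complex.I * k σ * ℓ R - ε * ℓ (XX σ R))) =
      c * (Complex.I * ℓ R * (∑ σ, g σ * k σ) - ε * ∑ σ, g σ * ℓ (XX σ R)) := by
    simp only [Finset.mul_sum, ← Finset.sum_sub_distrib]
    exact Finset.sum_congr rfl fun σ _ => by ring
  have e2 : ∑ σ, g σ * (c * (Complex.I * k σ * ℓ (XX μ R) - ε * ℓ (XX σ (XX μ R))) +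
      c * ((if μ = σ then 1 else 0) * ℓ R)) =
      c * ∑ σ, g σ * (Complex.I * k σ * ℓ (XX μ R) - ε * ℓ (XX σ (XX μ R))
        + (if μ = σ then 1 else 0) * ℓ R) := by
    simp only [Finset.mul_sum]
    exact Finset.sum_congr rfl fun σ _ => by ring
  rw [e1, e2, cutoffError, sqrt_two_eq, ← hc]
  linear_combination (2 * Complex.I * k μ * ℓ (XX ν R) - Complex.I ^ 2 * k μ * ℓ R *
    (∑ σ, g σ * k σ) + ε * Complex.I * k μ * (∑ σ, g σ * ℓ (XX σ R))
    - 2 * ε * ℓ (XX μ (XX ν R)) + ε * ∑ σ, g σ * (Complex.I * k σ * ℓ (XX μ R)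
      - ε * ℓ (XX σ (XX μ R)) + (if μ = σ then 1 else 0) * ℓ R)) * hcc
    - (1 / 2) * k μ * ℓ R * (∑ σ, g σ * k σ) * hI

lemma norm_cutoffError_le (hε : 0 < ε) (hε1 : ε ≤ 1) (hR : R ∈ growth n 1) {K : ℝ}
    (hK : ∀ μ, |k μ| ≤ K) (Γ : Matrix (Mode n) (Mode n) ℝ) (μ ν : Mode n) :
    ‖cutoffError Γ k ε R μ ν‖ ≤
      (1 + (∑ σ, |doubledCov Γ ν σ|) * (K + 1)) * cutoffMoment ε R := by
  set w := cutoffMoment ε R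
  have hw : 0 ≤ w := integral_nonneg fun x => by positivity
  have hK0 : 0 ≤ K := (abs_nonneg _).trans (hK μ)
  set G := ∑ σ, |doubledCov Γ ν σ|
  have hsum : ∀ (f : Mode n → ℂ) (c : ℝ), (∀ σ, ‖f σ‖ ≤ c) →
      ‖∑ σ, ((doubledCov Γ ν σ : ℝ) : ℂ) * f σ‖ ≤ G * c := by
    intro f c hf
    rw [Finset.sum_mul]
    refine (norm_sum_le _ _).trans (Finset.sum_le_sum fun σ _ => ?_)
    rw [norm_mul, Complex.norm_real, Real.norm_eq_abs]
    gcongr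
    exact hf σ
  have hk : ∀ μ, ‖Complex.I * k μ‖ ≤ K := fun μ => by
    rw [norm_mul, Complex.norm_I, one_mul, Complex.norm_real]; exact hK μ
  have h1 := hsum (fun σ => fourierHusimi k (1 + ε) (XX σ R)) w
    fun σ => norm_fourierHusimi_XX_le hε hR σ
  have h2 := hsum (fun σ => Complex.I * k σ * fourierHusimi k (1 + ε) (XX μ R)
      - ε * fourierHusimi k (1 + ε) (XX σ (XX μ R))
      + (if μ = σ then 1 else 0) * fourierHusimi k (1 + ε) R) (K * w + w + w) (by
    intro σ
    refine (norm_add_le _ _).trans (add_le_add ((norm_sub_le _ _).trans (add_le_add ?_ ?_)) ?_)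
    · rw [norm_mul]
      exact mul_le_mul (hk σ) (norm_fourierHusimi_XX_le hε hR μ) (norm_nonneg _) hK0
    · rw [norm_mul, Complex.norm_real, Real.norm_of_nonneg hε.le]
      exact (mul_le_of_le_one_left (norm_nonneg _) hε1).trans
        (norm_fourierHusimi_XX_XX_le hε hR σ μ)
    · rw [norm_mul]
      refine (mul_le_of_le_one_left (norm_nonneg _) ?_).trans (norm_fourierHusimi_self_le hε hR)
      split_ifs <;> simp)
  have h3 : ‖(1 / 2 : ℂ)‖ = 1 / 2 := by simp
  calc ‖cutoffError Γ k ε R μ ν‖ ≤ K * (1 / 2 * (G * w)) + w + 1 / 2 * (G * (K * w + w + w)) := by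
        refine (norm_add_le _ _).trans (add_le_add ((norm_sub_le _ _).trans (add_le_add ?_ ?_)) ?_)
        · rw [norm_mul, norm_mul (1 / 2 : ℂ), h3]
          exact mul_le_mul (hk μ) (mul_le_mul_of_nonneg_left h1 (by norm_num))
            (by positivity) hK0
        · exact norm_fourierHusimi_XX_XX_le hε hR μ ν
        · rw [norm_mul, h3]
          exact mul_le_mul_of_nonneg_left h2 (by norm_num)
    _ = _ := by ring

end Characteristic

/-! ### Uniqueness of the steady state -/

open MeasureTheory Filter Topology

section Evolution
variable {ε : ℝ} {R : Op n}

lemma hasDerivAt_planeWave {k k' : ℝ → Mode n → ℝ}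
    (hk : ∀ t i, HasDerivAt (fun s => k s i) (k' t i) t) (s : ℝ) (x : Phase n) (t : ℝ) :
    HasDerivAt (fun t => planeWave (k t) s x)
      (∑ i, Complex.I * k' t i * (x i * planeWave (k t) s x)) t := by
  have h1 : HasDerivAt (fun t => ∑ μ, k t μ * x μ) (∑ μ, k' t μ * x μ) t :=
    HasDerivAt.fun_sum fun i _ => (hk t i).mul_const _
  have h2 := ((h1.ofReal_comp.const_mul Complex.I).sub_const ((s / 2 * ‖x‖ ^ 2 : ℝ) : ℂ)).cexp
  refine h2.congr_deriv ?_
  rw [planeWave]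
  push_cast
  simp only [Finset.mul_sum]
  exact Finset.sum_congr rfl fun i _ => by ring

lemma hasDerivAt_fourierHusimi (hε : 0 < ε) (hR : R ∈ growth n 1) {k k' : ℝ → Mode n → ℝ}
    (hk : ∀ t i, HasDerivAt (fun s => k s i) (k' t i) t)
    (hk' : ∀ i, Continuous fun t => k' t i) (t : ℝ) :
    HasDerivAt (fun t => fourierHusimi (k t) (1 + ε) R)
      (∑ i, Complex.I * k' t i * fourierHusimi (k t) (1 + ε) (XX i R)) t := by
  have hX := fun i => growth_XX zero_le_one hR i
  have hint := fun (k : Mode n → ℝ) i => integrable_husimi k zero_le_one (one_sq_lt hε) (hX i)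
  choose K hK using fun i => (isCompact_closedBall t 1).exists_bound_of_continuousOn
    (hk' i).continuousOn
  have hF'int : Integrable fun x => ∑ i, Complex.I * k' t i * husimi (k t) (1 + ε) (XX i R) x :=
    integrable_finsetSum _ fun i _ => (hint (k t) i).const_mul _
  have h := (hasDerivAt_integral_of_dominated_loc_of_deriv_le (μ := volume)
    (F := fun t x => husimi (k t) (1 + ε) R x) (x₀ := t)
    (F' := fun t x => ∑ i, Complex.I * k' t i * husimi (k t) (1 + ε) (XX i R) x)
    (s := Metric.closedBall t 1) (bound := fun x => ∑ i, K i * ‖husimi 0 (1 + ε) (XX i R) x‖)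
    (Metric.closedBall_mem_nhds t one_pos)
    (Eventually.of_forall fun s =>
      (continuous_husimi (k s) _ zero_le_one hR).aestronglyMeasurable)
    (integrable_husimi (k t) zero_le_one (one_sq_lt hε) hR) hF'int.aestronglyMeasurable
    (Eventually.of_forall fun x s hs => by
      refine (norm_sum_le _ _).trans (Finset.sum_le_sum fun i _ => ?_)
      rw [norm_mul, norm_mul, Complex.norm_I, one_mul, Complex.norm_real, norm_husimi_eq]
      exact mul_le_mul_of_nonneg_right (hK i s hs) (norm_nonneg _))
    (integrable_finsetSum _ fun i _ => (hint 0 i).norm.const_mul _)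
    (Eventually.of_forall fun x s _ => by
      refine ((hasDerivAt_planeWave hk (1 + ε) x s).const_mul (genFun R (zOf x))).congr_deriv ?_
      rw [Finset.mul_sum]
      refine Finset.sum_congr rfl fun i _ => ?_
      rw [husimi_XX _ _ zero_le_one hR, husimi]
      ring)).2
  refine h.congr_deriv ?_
  rw [integral_finsetSum _ fun i _ => (hint (k t) i).const_mul _]
  exact Finset.sum_congr rfl fun i _ => integral_const_mul _ _

/-- The Gaussian exponent of the characteristic function of the vacuum. -/
def covExponent (Γ : Matrix (Mode n) (Mode n) ℝ) (k : Mode n → ℝ) : ℝ :=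
  1 / 4 * ∑ ν, ∑ σ, doubledCov Γ ν σ * (k ν * k σ)

lemma hasDerivAt_covExponent {Γ : Matrix (Mode n) (Mode n) ℝ} (hΓ : Γ.IsSymm)
    {k k' : ℝ → Mode n → ℝ} (hk : ∀ t i, HasDerivAt (fun s => k s i) (k' t i) t) (t : ℝ) :
    HasDerivAt (fun t => covExponent Γ (k t))
      (∑ ν, k' t ν * (1 / 2 * ∑ σ, doubledCov Γ ν σ * k t σ)) t := by
  have h : HasDerivAt (fun t => covExponent Γ (k t)) (1 / 4 * ∑ ν, ∑ σ, doubledCov Γ ν σ *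
      (k' t ν * k t σ + k t ν * k' t σ)) t :=
    HasDerivAt.const_mul _ (HasDerivAt.fun_sum fun ν _ => HasDerivAt.fun_sum fun σ _ =>
      ((hk t ν).mul (hk t σ)).const_mul _)
  refine h.congr_deriv ?_
  have hsymm : ∀ ν σ, doubledCov Γ ν σ = doubledCov Γ σ ν := fun ν σ => by
    have : (doubledCov Γ).IsSymm := by simp [Matrix.IsSymm, doubledCov, hΓ.eq]
    exact (this.apply ν σ).symm
  have e : ∑ ν, ∑ σ, doubledCov Γ ν σ * (k t ν * k' t σ) =
      ∑ ν, ∑ σ, doubledCov Γ ν σ * (k' t ν * k t σ) := by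
    rw [Finset.sum_comm]
    refine Finset.sum_congr rfl fun ν _ => Finset.sum_congr rfl fun σ _ => ?_
    rw [hsymm σ ν]; ring
  simp only [mul_add, Finset.sum_add_distrib, e]
  rw [← two_mul, ← mul_assoc, Finset.mul_sum]
  refine Finset.sum_congr rfl fun ν _ => ?_
  simp only [Finset.mul_sum]
  exact Finset.sum_congr rfl fun σ _ => by ring

lemma System.sum_fourierHusimi_eq_zero (sys : System n) {Γ : Matrix (Mode n) (Mode n) ℝ}
    (hΓ : Γ.IsSymm) (hL : sys.SolvesLyapunov Γ) (hε : 0 < ε) (hR : R ∈ growth n 1)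
    (hLR : sys.liouvillian R = 0) (k : Mode n → ℝ) :
    ∑ μ, ∑ ν, (sys.Xr μ ν : ℂ) * fourierHusimi k (1 + ε) (bOp' μ (eOp Γ ν R)) = 0 := by
  have he : ∀ ν, eOp Γ ν R ∈ growth n 1 := fun ν => by
    rw [eOp_apply_eq_XX]
    exact (growth n 1).sub_mem ((growth n 1).smul_mem _ (growth_XX zero_le_one hR ν))
      ((growth n 1).sum_mem fun σ _ => (growth n 1).smul_mem _ (growth_bOp' zero_le_one hR σ))
  have hb : ∀ μ ν, bOp' μ (eOp Γ ν R) ∈ growth n 1 := fun μ ν =>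
    growth_bOp' zero_le_one (he ν) μ
  have h1 : sys.liouvillian R = ∑ μ, ∑ ν, (sys.Xr μ ν : ℂ) • bOp' μ (eOp Γ ν R) := by
    rw [sys.liouvillian_eq_eOp hΓ hL, sys.X₀_eq]
    simp [bil, toC, LinearMap.sum_apply]
  have h2 := congrArg (fourierHusimi k (1 + ε)) (h1.symm.trans hLR)
  rw [fourierHusimi_sum k zero_le_one (one_sq_lt hε) _ fun μ => (growth n 1).sum_mem fun ν _ =>
    (growth n 1).smul_mem _ (hb μ ν)] at h2
  have h0 : fourierHusimi k (1 + ε) (0 : Op n) = 0 := by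
    simpa using fourierHusimi_smul k (1 + ε) 0 (0 : Op n)
  rw [h0] at h2
  rw [← h2]
  refine Finset.sum_congr rfl fun μ _ => ?_
  rw [fourierHusimi_sum k zero_le_one (one_sq_lt hε) _ fun ν => (growth n 1).smul_mem _ (hb μ ν)]
  exact Finset.sum_congr rfl fun ν _ => (fourierHusimi_smul _ _ _ _).symm

/-- Along k' = X₀ᵀk the transport term is the derivative of the characteristic function and the
quadratic term that of `covExponent`. Stationarity cancels both, so the derivative consists of the
cut-off error alone. `D` depends on the path but not on ε. -/
lemma System.exists_evolution_le (sys : System n) {Γ : Matrix (Mode n) (Mode n) ℝ}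
    (hΓ : Γ.IsSymm) (hL : sys.SolvesLyapunov Γ) (hR : R ∈ growth n 1)
    (hLR : sys.liouvillian R = 0) {k : ℝ → Mode n → ℝ}
    (hk : ∀ t i, HasDerivAt (fun s => k s i) ((sys.Xrᵀ *ᵥ k t) i) t) {T : ℝ} (hT : 0 ≤ T) :
    ∃ D : ℝ, ∀ ε, 0 < ε → ε ≤ 1 →
      ‖(Real.exp (covExponent Γ (k T)) : ℂ) * fourierHusimi (k T) (1 + ε) R -
        Real.exp (covExponent Γ (k 0)) * fourierHusimi (k 0) (1 + ε) R‖ ≤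
      D * (ε * cutoffMoment ε R) := by
  have hkc : ∀ i, Continuous fun t => k t i := fun i =>
    continuous_iff_continuousAt.mpr fun t => (hk t i).continuousAt
  have hk'c : ∀ i, Continuous fun t => (sys.Xrᵀ *ᵥ k t) i := fun i => by
    simp only [Matrix.mulVec, dotProduct]
    exact continuous_finsetSum _ fun j _ => continuous_const.mul (hkc j)
  have hexpd := hasDerivAt_covExponent hΓ hk
  have hcc : Continuous fun t => Real.exp (covExponent Γ (k t)) :=
    Real.continuous_exp.comp (continuous_iff_continuousAt.mpr fun t => (hexpd t).continuousAt)
  obtain ⟨H, hH⟩ := (isCompact_Icc (a := (0 : ℝ)) (b := T)).exists_bound_of_continuousOn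
    hcc.continuousOn
  choose K₁ hK₁ using fun i => (isCompact_Icc (a := (0 : ℝ)) (b := T)).exists_bound_of_continuousOn
    (hkc i).continuousOn
  have hK₁0 : ∀ i, 0 ≤ K₁ i := fun i =>
    (norm_nonneg _).trans (hK₁ i 0 (Set.left_mem_Icc.mpr hT))
  set K := ∑ i, K₁ i
  have hK : ∀ t ∈ Set.Icc 0 T, ∀ i, |k t i| ≤ K := fun t ht i => (hK₁ i t ht).trans
    (Finset.single_le_sum (f := K₁) (fun i _ => hK₁0 i) (Finset.mem_univ i))
  have hH0 : 0 ≤ H := (norm_nonneg _).trans (hH 0 (Set.left_mem_Icc.mpr hT))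
  set C := ∑ μ, ∑ ν, |sys.Xr μ ν| * (1 + (∑ σ, |doubledCov Γ ν σ|) * (K + 1))
  refine ⟨H * C * T, fun ε hε hε1 => ?_⟩
  set g : ℝ → ℂ := fun t => (Real.exp (covExponent Γ (k t)) : ℂ) * fourierHusimi (k t) (1 + ε) R
  set err : ℝ → ℂ := fun t => ∑ μ, ∑ ν, (sys.Xr μ ν : ℂ) * cutoffError Γ (k t) ε R μ ν
  have hg : ∀ t, HasDerivAt g (-((Real.exp (covExponent Γ (k t)) : ℂ) * (ε * err t))) t := by
    intro t
    have h1 := (hexpd t).exp.ofReal_comp.mul (hasDerivAt_fourierHusimi hε hR hk hk'c t)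
    refine h1.congr_deriv ?_
    have h2 := sys.sum_fourierHusimi_eq_zero hΓ hL hε hR hLR (k t)
    simp only [fourierHusimi_bOp'_eOp hε hR, mul_add, Finset.sum_add_distrib] at h2
    have e1 : ∑ μ, ∑ ν, (sys.Xr μ ν : ℂ) * (Complex.I * k t μ *
        fourierHusimi (k t) (1 + ε) (XX ν R)) =
        ∑ ν, Complex.I * ((sys.Xrᵀ *ᵥ k t) ν : ℝ) * fourierHusimi (k t) (1 + ε) (XX ν R) := by
      rw [Finset.sum_comm]
      refine Finset.sum_congr rfl fun ν _ => ?_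
      simp only [Matrix.mulVec, dotProduct, Matrix.transpose_apply]
      push_cast
      rw [Finset.mul_sum, Finset.sum_mul]
      exact Finset.sum_congr rfl fun μ _ => by ring
    have e2 : ∑ μ, ∑ ν, (sys.Xr μ ν : ℂ) * (k t μ * (1 / 2 * ∑ σ, (doubledCov Γ ν σ : ℂ) * k t σ) *
        fourierHusimi (k t) (1 + ε) R) =
        ((∑ ν, (sys.Xrᵀ *ᵥ k t) ν * (1 / 2 * ∑ σ, doubledCov Γ ν σ * k t σ) : ℝ) : ℂ) *
          fourierHusimi (k t) (1 + ε) R := by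
      rw [Finset.sum_comm]
      push_cast
      rw [Finset.sum_mul]
      refine Finset.sum_congr rfl fun ν _ => ?_
      simp only [Matrix.mulVec, dotProduct, Matrix.transpose_apply]
      push_cast
      rw [Finset.sum_mul, Finset.sum_mul]
      exact Finset.sum_congr rfl fun μ _ => by ring
    have e3 : ∑ μ, ∑ ν, (sys.Xr μ ν : ℂ) * (ε * cutoffError Γ (k t) ε R μ ν) = ε * err t := by
      simp only [err, Finset.mul_sum]
      exact Finset.sum_congr rfl fun μ _ => Finset.sum_congr rfl fun ν _ => by ring
    rw [e1, e2, e3] at h2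
    simp only [Complex.ofReal_mul] at h2 ⊢
    linear_combination (Real.exp (covExponent Γ (k t)) : ℂ) * h2
  have hw : 0 ≤ cutoffMoment ε R := integral_nonneg fun x => by positivity
  have hbound : ∀ t ∈ Set.Ico 0 T, ‖-((Real.exp (covExponent Γ (k t)) : ℂ) * (ε * err t))‖ ≤
      H * (ε * (C * cutoffMoment ε R)) := by
    intro t ht
    have ht' := Set.Ico_subset_Icc_self ht
    rw [norm_neg, norm_mul, norm_mul, Complex.norm_real, Complex.norm_real,
      Real.norm_of_nonneg hε.le]
    have herr : ‖err t‖ ≤ C * cutoffMoment ε R := by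
      simp only [err, C]
      rw [Finset.sum_mul]
      refine (norm_sum_le _ _).trans (Finset.sum_le_sum fun μ _ => (norm_sum_le _ _).trans ?_)
      rw [Finset.sum_mul]
      refine Finset.sum_le_sum fun ν _ => ?_
      rw [norm_mul, Complex.norm_real, Real.norm_eq_abs, mul_assoc]
      gcongr
      exact norm_cutoffError_le hε hε1 hR (hK t ht') Γ μ ν
    exact mul_le_mul (hH t ht') (mul_le_mul_of_nonneg_left herr hε.le) (by positivity) hH0
  have := norm_image_sub_le_of_norm_deriv_le_segment' (f := g)
    (fun t _ => (hg t).hasDerivWithinAt) hbound T (Set.right_mem_Icc.mpr hT)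
  refine this.trans_eq ?_
  ring

end Evolution

lemma norm_husimi_one_add (k : Mode n → ℝ) (ε : ℝ) (R : Op n) (x : Phase n) :
    ‖husimi k (1 + ε) R x‖ = ‖husimi 0 1 R x‖ * Real.exp (-(ε / 2) * ‖x‖ ^ 2) := by
  rw [husimi, husimi, norm_mul, norm_mul, norm_planeWave, norm_planeWave, mul_assoc,
    ← Real.exp_add]
  congr 2
  ring

/-- Second moments of the Husimi function may be infinite, but ε(1 + ‖x‖²) exp(-ε‖x‖²/2) is bounded
by 3 and tends to 0 pointwise, so dominated convergence applies. -/
lemma tendsto_cutoffMoment {R : Op n} (hR : R ∈ growth n 1) (hi : Integrable (husimi 0 1 R)) :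
    Tendsto (fun m : ℕ => 1 / ((m : ℝ) + 1) * cutoffMoment (1 / ((m : ℝ) + 1)) R) atTop (𝓝 0) := by
  have hε : ∀ m : ℕ, 0 < 1 / ((m : ℝ) + 1) := fun m => by positivity
  have hlim := tendsto_integral_of_dominated_convergence (μ := volume)
    (F := fun (m : ℕ) (x : Phase n) => 1 / ((m : ℝ) + 1) *
      ((1 + ‖x‖ ^ 2) * ‖husimi 0 (1 + 1 / ((m : ℝ) + 1)) R x‖)) (f := fun _ => 0)
    (fun x => 3 * ‖husimi 0 1 R x‖)
    (fun m => ((integrable_cutoffMoment (hε m) hR).const_mul _).aestronglyMeasurable)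
    (hi.norm.const_mul 3) (fun m => Eventually.of_forall fun x => ?_)
    (Eventually.of_forall fun x => ?_)
  · simpa [cutoffMoment, integral_const_mul] using hlim
  · have he := hε m
    have he1 : 1 / ((m : ℝ) + 1) ≤ 1 := by
      rw [div_le_one (by positivity)]; linarith [m.cast_nonneg (α := ℝ)]
    set ε := 1 / ((m : ℝ) + 1)
    rw [Real.norm_of_nonneg (by positivity), norm_husimi_one_add]
    have h1 : Real.exp (-(ε / 2) * ‖x‖ ^ 2) ≤ 1 := by
      rw [Real.exp_le_one_iff]
      have : 0 ≤ ε / 2 * ‖x‖ ^ 2 := by positivity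
      linarith
    -- u exp(-u) ≤ 1 at u = ε‖x‖²/2. This contributes 2 to the constant 3, and the remaining term
    -- contributes 1.
    have h2 : ε / 2 * ‖x‖ ^ 2 * Real.exp (-(ε / 2) * ‖x‖ ^ 2) ≤ 1 := by
      have h3 := Real.add_one_le_exp (ε / 2 * ‖x‖ ^ 2)
      rw [neg_mul, Real.exp_neg, ← div_eq_mul_inv, div_le_one (Real.exp_pos _)]
      linarith
    have h4 : ε * (1 + ‖x‖ ^ 2) * Real.exp (-(ε / 2) * ‖x‖ ^ 2) ≤ 3 := by
      have h5 : ε * Real.exp (-(ε / 2) * ‖x‖ ^ 2) ≤ 1 :=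
        mul_le_one₀ he1 (Real.exp_nonneg _) h1
      linarith
    calc ε * ((1 + ‖x‖ ^ 2) * (‖husimi 0 1 R x‖ * Real.exp (-(ε / 2) * ‖x‖ ^ 2)))
        = (ε * (1 + ‖x‖ ^ 2) * Real.exp (-(ε / 2) * ‖x‖ ^ 2)) * ‖husimi 0 1 R x‖ := by ring
      _ ≤ _ := by gcongr
  · have h0 : Tendsto (fun m : ℕ => 1 / ((m : ℝ) + 1) * ((1 + ‖x‖ ^ 2) * ‖husimi 0 1 R x‖)) atTop
        (𝓝 0) := by
      simpa using (tendsto_one_div_add_atTop_nhds_zero_nat (𝕜 := ℝ)).mul_const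
        ((1 + ‖x‖ ^ 2) * ‖husimi 0 1 R x‖)
    refine squeeze_zero (fun m => by positivity) (fun m => ?_) h0
    rw [norm_husimi_one_add]
    gcongr
    refine mul_le_of_le_one_right (norm_nonneg _) ?_
    rw [Real.exp_le_one_iff]
    have : 0 ≤ 1 / ((m : ℝ) + 1) / 2 * ‖x‖ ^ 2 := by positivity
    linarith

lemma tendsto_fourierHusimi_cutoff {R : Op n} (hR : R ∈ growth n 1)
    (hi : Integrable (husimi 0 1 R)) (k : Mode n → ℝ) :
    Tendsto (fun m : ℕ => fourierHusimi k (1 + 1 / ((m : ℝ) + 1)) R) atTop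
      (𝓝 (fourierHusimi k 1 R)) := by
  refine tendsto_integral_of_dominated_convergence (fun x => ‖husimi 0 1 R x‖)
    (fun m => (continuous_husimi k _ zero_le_one hR).aestronglyMeasurable) hi.norm
    (fun m => Eventually.of_forall fun x => ?_) (Eventually.of_forall fun x => ?_)
  · rw [norm_husimi_one_add]
    refine mul_le_of_le_one_right (norm_nonneg _) ?_
    rw [Real.exp_le_one_iff]
    have : 0 ≤ 1 / ((m : ℝ) + 1) / 2 * ‖x‖ ^ 2 := by positivity
    linarith
  · have hs : Tendsto (fun m : ℕ => 1 + 1 / ((m : ℝ) + 1)) atTop (𝓝 1) := by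
      simpa using (tendsto_one_div_add_atTop_nhds_zero_nat (𝕜 := ℝ)).const_add 1
    have hc : Continuous fun s : ℝ => husimi k s R x := by
      unfold husimi planeWave
      fun_prop
    exact (hc.tendsto 1).comp hs

lemma tendsto_fourierHusimi_flow {R : Op n} (hR : R ∈ growth n 1)
    (hi : Integrable (husimi 0 1 R)) {k : ℝ → Mode n → ℝ}
    (hk : ∀ i, Tendsto (fun t => k t i) atTop (𝓝 0)) :
    Tendsto (fun t => fourierHusimi (k t) 1 R) atTop (𝓝 (fourierHusimi 0 1 R)) := by
  refine tendsto_integral_filter_of_dominated_convergence (fun x => ‖husimi 0 1 R x‖)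
    (Eventually.of_forall fun t => (continuous_husimi _ _ zero_le_one hR).aestronglyMeasurable)
    (Eventually.of_forall fun t => Eventually.of_forall fun x => (norm_husimi_eq _ _ _ _).le)
    hi.norm (Eventually.of_forall fun x => ?_)
  have hc : Continuous fun k : Mode n → ℝ => husimi k 1 R x := by
    unfold husimi planeWave
    fun_prop
  exact (hc.tendsto 0).comp (tendsto_pi_nhds.mpr hk)

/-- The characteristic function of a steady state is Gaussian. -/
lemma System.fourierHusimi_steady (sys : System n) {Γ : Matrix (Mode n) (Mode n) ℝ}
    (hΓ : Γ.IsSymm) (hL : sys.SolvesLyapunov Γ) (J : JordanForm sys.X₀)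
    (hJ : ∀ k, (J.eig k).re < 0) {R : Op n} (hR : R ∈ growth n 1)
    (hi : Integrable (husimi 0 1 R)) (hLR : sys.liouvillian R = 0) (k₀ : Mode n → ℝ) :
    (Real.exp (covExponent Γ k₀) : ℂ) * fourierHusimi k₀ 1 R = fourierHusimi 0 1 R := by
  obtain ⟨k, hk0, hk, hlim⟩ := sys.exists_decaying_flow J hJ k₀
  have hconst : ∀ T, 0 ≤ T → (Real.exp (covExponent Γ (k T)) : ℂ) * fourierHusimi (k T) 1 R =
      Real.exp (covExponent Γ k₀) * fourierHusimi k₀ 1 R := by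
    intro T hT
    obtain ⟨D, hD⟩ := sys.exists_evolution_le hΓ hL hR hLR hk hT
    rw [hk0] at hD
    have h1 := ((tendsto_fourierHusimi_cutoff hR hi (k T)).const_mul
      (Real.exp (covExponent Γ (k T)) : ℂ)).sub ((tendsto_fourierHusimi_cutoff hR hi k₀).const_mul
      (Real.exp (covExponent Γ k₀) : ℂ))
    have h2 : Tendsto (fun m : ℕ => (Real.exp (covExponent Γ (k T)) : ℂ) *
        fourierHusimi (k T) (1 + 1 / ((m : ℝ) + 1)) R - (Real.exp (covExponent Γ k₀) : ℂ) *
        fourierHusimi k₀ (1 + 1 / ((m : ℝ) + 1)) R) atTop (𝓝 0) := by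
      refine squeeze_zero_norm (fun m => hD (1 / ((m : ℝ) + 1)) (by positivity) ?_)
        (by simpa using (tendsto_cutoffMoment hR hi).const_mul D)
      rw [div_le_one (by positivity)]; linarith [m.cast_nonneg (α := ℝ)]
    exact sub_eq_zero.mp (tendsto_nhds_unique h1 h2)
  have hexp : Tendsto (fun t => (Real.exp (covExponent Γ (k t)) : ℂ)) atTop (𝓝 1) := by
    have hc : Continuous fun k : Mode n → ℝ => (Real.exp (covExponent Γ k) : ℂ) := by
      unfold covExponent
      fun_prop
    have := (hc.tendsto 0).comp (tendsto_pi_nhds.mpr hlim)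
    simpa [covExponent, Function.comp_def] using this
  have h3 := hexp.mul (tendsto_fourierHusimi_flow hR hi hlim)
  rw [one_mul] at h3
  refine tendsto_nhds_unique (l := atTop) (f := fun _ : ℝ => (Real.exp (covExponent Γ k₀) : ℂ) *
    fourierHusimi k₀ 1 R) tendsto_const_nhds (h3.congr' ?_)
  filter_upwards [eventually_ge_atTop 0] with t ht using hconst t ht

-- The Husimi function is continuous and integrable with zero Fourier transform, so inversion makes
-- it vanish, and it determines the operator.
open scoped FourierTransform in
lemma eq_zero_of_fourierHusimi_eq_zero {R : Op n} (hR : R ∈ growth n 1)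
    (hi : Integrable (husimi 0 1 R)) (h : ∀ k, fourierHusimi k 1 R = 0) : R = 0 := by
  have hF : 𝓕 (husimi 0 1 R) = 0 := by
    funext w
    rw [Real.fourier_eq', Pi.zero_apply, ← h fun μ => -2 * Real.pi * w μ]
    refine integral_congr_ae (Eventually.of_forall fun x => ?_)
    simp only [husimi, planeWave, smul_eq_mul]
    rw [mul_left_comm, ← Complex.exp_add]
    congr 2
    have e : inner ℝ x w = ∑ μ, w μ * x μ := by
      simp [PiLp.inner_apply]
    rw [e]
    simp only [Pi.zero_apply, zero_mul, Finset.sum_const_zero, Complex.ofReal_zero, mul_zero,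
      zero_sub, mul_assoc, ← Finset.mul_sum]
    push_cast
    ring
  have h0 := (continuous_husimi 0 1 zero_le_one hR).fourierInv_fourier_eq hi
    (by rw [hF]; exact integrable_zero _ _ _)
  refine eq_zero_of_husimi_eq_zero zero_le_one hR fun x => ?_
  have h1 : husimi 0 1 R x = 0 := by
    rw [← h0, hF]
    simp [Real.fourierInv_eq]
  rw [husimi] at h1
  exact (mul_eq_zero.mp h1).resolve_right (Complex.exp_ne_zero _)

/-- A relaxing system has at most one steady state. -/
lemma System.steadyState_unique (sys : System n) {Γ : Matrix (Mode n) (Mode n) ℝ}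
    (hΓ : Γ.IsSymm) (hL : sys.SolvesLyapunov Γ) (J : JordanForm sys.X₀)
    (hJ : ∀ k, (J.eig k).re < 0) {ρ ρ' : Op n} (h : sys.IsSteadyState ρ)
    (h' : sys.IsSteadyState ρ') : ρ = ρ' := by
  have hg := h.1.mem_growth
  have hg' := h'.1.mem_growth
  have hi := h.1.integrable_husimi
  have hi' := h'.1.integrable_husimi
  have hF := sys.fourierHusimi_steady hΓ hL J hJ hg hi h.2
  have hF' := sys.fourierHusimi_steady hΓ hL J hJ hg' hi' h'.2
  set a := fourierHusimi 0 1 ρ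
  set b := fourierHusimi 0 1 ρ'
  -- Both characteristic functions are multiples of the same Gaussian, with the factors a and b, so
  -- this combination cancels.
  have hfourier : ∀ k, fourierHusimi k 1 (b • ρ + (-a) • ρ') = 0 := by
    intro k
    have hik : ∀ {R : Op n}, R ∈ growth n 1 → Integrable (husimi 0 1 R) →
        Integrable (husimi k 1 R) := fun hR hi => hi.norm.mono'
      (continuous_husimi k 1 zero_le_one hR).aestronglyMeasurable
      (Eventually.of_forall fun x => (norm_husimi_eq _ _ _ _).le)
    have e : fourierHusimi k 1 (b • ρ + (-a) • ρ') =
        b * fourierHusimi k 1 ρ + -a * fourierHusimi k 1 ρ' := by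
      rw [fourierHusimi, fourierHusimi, fourierHusimi, ← integral_const_mul, ← integral_const_mul,
        ← integral_add ((hik hg hi).const_mul _) ((hik hg' hi').const_mul _)]
      refine integral_congr_ae (Eventually.of_forall fun x => ?_)
      simp only [husimi_add k 1 zero_le_one ((growth n 1).smul_mem b hg)
        ((growth n 1).smul_mem (-a) hg'), husimi_smul]
    have hne : (Real.exp (covExponent Γ k) : ℂ) ≠ 0 :=
      Complex.ofReal_ne_zero.mpr (Real.exp_pos _).ne'
    rw [e]
    apply mul_left_cancel₀ hne
    linear_combination b * hF k - a * hF' k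
  have hzero : b • ρ + (-a) • ρ' = 0 := by
    refine eq_zero_of_fourierHusimi_eq_zero ((growth n 1).add_mem ((growth n 1).smul_mem b hg)
      ((growth n 1).smul_mem (-a) hg')) ?_ hfourier
    refine ((hi.const_mul b).add (hi'.const_mul (-a))).congr (Eventually.of_forall fun x => ?_)
    simp only [husimi_add 0 1 zero_le_one ((growth n 1).smul_mem b hg)
      ((growth n 1).smul_mem (-a) hg'), husimi_smul, Pi.add_apply]
  -- Both traces are 1, so the trace of the vanishing combination is b - a.
  have hab : b = a := by
    have h1 : HasTrace (b • ρ + (-a) • ρ') (b * 1 + -a * 1) :=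
      (h.1.2.mul_left b).add (h'.1.2.mul_left (-a))
    rw [hzero] at h1
    have h2 := h1.unique hasSum_zero
    linear_combination h2
  -- If a = 0, the characteristic function of ρ vanishes identically, which forces ρ = 0 against
  -- trace one.
  have ha : a ≠ 0 := by
    intro ha
    have : ρ = 0 := eq_zero_of_fourierHusimi_eq_zero hg hi fun k => by
      have hne : (Real.exp (covExponent Γ k) : ℂ) ≠ 0 :=
        Complex.ofReal_ne_zero.mpr (Real.exp_pos _).ne'
      have := hF k
      rw [ha] at this
      exact (mul_eq_zero.mp this).resolve_left hne
    have h1 := h.1.2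
    rw [this] at h1
    exact one_ne_zero (h1.unique hasSum_zero)
  rw [hab, neg_smul, ← sub_eq_add_neg, ← smul_sub] at hzero
  exact sub_eq_zero.mp ((smul_eq_zero.mp hzero).resolve_left ha)

/-! ### Eigenvalue sums and the dissipative gap. -/

namespace JordanForm

variable {X : Matrix (Mode n) (Mode n) ℂ} (J : JordanForm X)

lemma re_lam (N : J.Exc) : (J.lam N).re = ∑ p : J.Idx, (J.eig p.1).re * N p := by
  simp [lam, Complex.re_sum]

lemma re_lam_nonpos (h : ∀ k, (J.eig k).re ≤ 0) (N : J.Exc) : (J.lam N).re ≤ 0 := by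
  rw [re_lam]
  exact Finset.sum_nonpos fun p _ => mul_nonpos_of_nonpos_of_nonneg (h p.1) (N p).cast_nonneg

lemma nonempty_idx (hn : 0 < n) : Nonempty J.Idx := by
  by_contra hne
  rw [not_nonempty_iff] at hne
  have h := congrFun₂ J.S_mul_Sinv (Sum.inl ⟨0, hn⟩) (Sum.inl ⟨0, hn⟩)
  simp [Matrix.mul_apply] at h

/-- An occupied mode contributes at most max_k Re ξ_k, since its occupation is at least one and the
real parts are negative; all other modes contribute non-positive amounts. A single excitation of the
slowest block is therefore optimal. -/
lemma exists_gap (hn : 0 < n) (h : ∀ k, (J.eig k).re < 0) :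
    ∃ Δ : ℝ, 0 < Δ ∧
      IsGreatest {x : ℝ | ∃ N : J.Exc, N ≠ 0 ∧ x = (J.lam N).re} (-Δ) ∧
      IsGreatest (Set.range fun k => (J.eig k).re) (-Δ) ∧
      ∃ p : J.Idx, (J.lam (Pi.single p 1)).re = -Δ := by
  obtain ⟨p₀⟩ := J.nonempty_idx hn
  have : Nonempty (Fin J.numBlocks) := ⟨p₀.1⟩
  obtain ⟨k, hk⟩ := Finite.exists_max fun k => (J.eig k).re
  have hp : (J.lam (Pi.single ⟨k, ⟨0, J.size_pos k⟩⟩ 1)).re = - -(J.eig k).re := by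
    rw [lam_single, neg_neg]
  refine ⟨-(J.eig k).re, neg_pos.mpr (h k), ⟨⟨_, ?_, hp.symm⟩, ?_⟩, ⟨⟨k, (neg_neg _).symm⟩, ?_⟩,
    _, hp⟩
  · exact Pi.single_ne_zero_iff.mpr one_ne_zero
  · rintro x ⟨N, hN, rfl⟩
    obtain ⟨p, hNp⟩ := Function.ne_iff.mp hN
    have h1 : (1 : ℝ) ≤ N p := by exact_mod_cast Nat.one_le_iff_ne_zero.mpr hNp
    rw [re_lam, neg_neg, ← Finset.add_sum_erase _ _ (Finset.mem_univ p)]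
    have h2 : ∑ q ∈ Finset.univ.erase p, (J.eig q.1).re * (N q : ℝ) ≤ 0 :=
      Finset.sum_nonpos fun q _ =>
        mul_nonpos_of_nonpos_of_nonneg (h q.1).le (N q).cast_nonneg
    nlinarith [hk p.1, h p.1]
  · rintro x ⟨k', rfl⟩
    rw [neg_neg]
    exact hk k'

end JordanForm

lemma IsPhysical.exists_rapidVacuum {Γ : Matrix (Mode n) (Mode n) ℝ} (hΓ : IsPhysical Γ)
    {X : Matrix (Mode n) (Mode n) ℂ} (J : JordanForm X) :
    ∃ ρ₀ : Op n, IsDensityOperator ρ₀ ∧ J.IsRapidVacuum Γ ρ₀ ∧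
      ∀ ρ, J.IsRightVacuum Γ ρ → ρ = ρ₀ := by
  obtain ⟨ρ₀, hρ, hrap, hann, htr, huniq⟩ := hΓ.exists_vacuum
  refine ⟨ρ₀, hρ, ⟨hΓ.isSymm, (J.ann_iff Γ ρ₀).mpr hann, hrap, htr⟩, fun ρ hv => ?_⟩
  obtain ⟨c, rfl⟩ := huniq ρ ((J.ann_iff Γ ρ).mp hv.1)
  have hc : HasTrace (c • ρ₀) (c * 1) := HasSum.mul_left c hρ.2
  rw [← mul_one c, hc.unique hv.2, one_smul]

lemma JordanForm.IsRapidVacuum.liouvillian_eq_zero {sys : System n}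
    {Γ : Matrix (Mode n) (Mode n) ℝ} {J : JordanForm sys.X₀} {ρ : Op n}
    (h : J.IsRapidVacuum Γ ρ) (hL : sys.SolvesLyapunov Γ) : sys.liouvillian ρ = 0 := by
  rw [sys.liouvillian_eq_eOp h.symm hL, bil]
  simp [LinearMap.sum_apply, (J.ann_iff Γ ρ).mp h.ann]

end QuasiFreeBoson

end

/-! ### Assembly of the main theorem. -/

open QuasiFreeBoson in
theorem mainTheorem11 (n : ℕ) (hn : 0 < n) (sys : System n)
    (Γ : Matrix (Mode n) (Mode n) ℝ) (hΓ : IsPhysical Γ) (hLyap : sys.SolvesLyapunov Γ)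
    (J : JordanForm sys.X₀) :
    -- the ladder super-operators commute among each other, so that the order of products is irrelevant
    (∀ p q, Commute (J.d Γ p) (J.d Γ q)) ∧ (∀ p q, Commute (J.d' p) (J.d' q)) ∧
    -- left vacuum
    (∀ R : Op n, IsRapidlyDecreasing R → ∀ p, HasTrace (J.d' p R) 0) ∧
    -- right vacuum: existence, uniqueness, covariance matrix, and it is a steady state
    ∃ ρ₀ : Op n, J.IsRightVacuum Γ ρ₀ ∧ (∀ ρ, J.IsRightVacuum Γ ρ → ρ = ρ₀) ∧
      sys.IsSteadyState ρ₀ ∧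
      (∀ μ ν, HasTrace ((1 / 2 : ℂ) • (wL μ (wL ν ρ₀) + wL ν (wL μ ρ₀))) (Γ μ ν : ℂ)) ∧
      -- everything generated from the right vacuum is rapidly decreasing
      (∀ P ∈ Algebra.adjoin ℂ (Set.range (wL (n := n)) ∪ Set.range (wR (n := n))),
        IsRapidlyDecreasing (P ρ₀)) ∧
      -- the right operators form a basis of the space generated from the right vacuum
      LinearIndependent ℂ (J.ket ρ₀) ∧
      (Submodule.span ℂ (Set.range (J.ket ρ₀)) : Set (Op n)) =
        {R | ∃ P ∈ Algebra.adjoin ℂ (Set.range (wL (n := n)) ∪ Set.range (wR (n := n))),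
          R = P ρ₀} ∧
      -- the left operators form a basis of the polynomials in the ladder operators
      (∀ N : J.Exc, ∃ P ∈ Algebra.adjoin ℂ (Set.range (wL (n := n))),
        ∀ R : Op n, IsRapidlyDecreasing R → J.bra Γ N R = tr (P R)) ∧
      (∀ P ∈ Algebra.adjoin ℂ (Set.range (wL (n := n))), ∃! c : J.Exc →₀ ℂ,
        ∀ R : Op n, IsRapidlyDecreasing R → tr (P R) = c.sum fun N z => z * J.bra Γ N R) ∧
      -- biorthogonality
      (∀ N N' : J.Exc, HasTrace (J.braOp Γ N (J.ket ρ₀ N')) (if N = N' then 1 else 0)) ∧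
      -- the matrix of the Liouvillian is well defined, and it is upper triangular with diagonal
      -- `λ_N` in every order of the bases along which `I_N` is non-decreasing
      (∀ N N' : J.Exc, HasTrace (J.braOp Γ N (sys.liouvillian (J.ket ρ₀ N')))
        (J.bra Γ N (sys.liouvillian (J.ket ρ₀ N')))) ∧
      (∀ N N' : J.Exc, N ≠ N' → J.level N' ≤ J.level N →
        J.bra Γ N (sys.liouvillian (J.ket ρ₀ N')) = 0) ∧
      (∀ N : J.Exc, J.bra Γ N (sys.liouvillian (J.ket ρ₀ N)) = J.lam N) ∧
      -- the diagonal contains the (generalized) eigenvalues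
      (∀ N : J.Exc, J.ket ρ₀ N ∈ Module.End.maxGenEigenspace sys.liouvillian (J.lam N)) ∧
      {z : ℂ | ∃ R ∈ Submodule.span ℂ (Set.range (J.ket ρ₀)),
        R ≠ 0 ∧ sys.liouvillian R = z • R} = Set.range J.lam ∧
      -- stability
      ((∀ k, (J.eig k).re ≤ 0) → sys.IsStable ∧ ∀ N, (J.lam N).re ≤ 0) ∧
      -- relaxation, unique steady state, and dissipative gap
      ((∀ k, (J.eig k).re < 0) →
        sys.IsRelaxingTo Γ ∧
        (∀ ρ : Op n, sys.IsSteadyState ρ ↔ ρ = ρ₀) ∧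
        ∃ Δ : ℝ, 0 < Δ ∧
          IsGreatest {x : ℝ | ∃ N : J.Exc, N ≠ 0 ∧ x = (J.lam N).re} (-Δ) ∧
          IsGreatest (Set.range fun k => (J.eig k).re) (-Δ) ∧
          ∃ p : J.Idx, (J.lam (Pi.single p 1)).re = -Δ) := by
  obtain ⟨ρ₀, hρ, hv, huniq⟩ := hΓ.exists_rapidVacuum J
  have hsteady : sys.IsSteadyState ρ₀ := ⟨hρ, hv.liouvillian_eq_zero hLyap⟩
  have hket : ∀ N, J.ket ρ₀ N ∈ rapid n := fun N =>
    ladderAlg_mem_rapid (J.ketOp_mem_ladderAlg N) hv.mem_rapid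
  refine ⟨J.d_mul_d hΓ.isSymm, J.d'_mul_d', fun R hR p => ?_, ρ₀, ⟨hv.ann, hρ.2⟩, huniq, hsteady,
    hv.covariance, fun P hP => mem_rapid.mp (ladderAlg_mem_rapid hP hv.mem_rapid),
    hv.linearIndependent_ket, hv.span_ket_eq, fun N => ?_, fun P hP => ?_, fun N N' => ?_,
    fun N N' => hasTrace_tr (ladderAlg_mem_rapid (J.braOp_mem_ladderAlg N)
      (ladderAlg_mem_rapid sys.liouvillian_mem_ladderAlg (hket N'))),
    fun N N' hne hle => ?_, fun N => ?_, hv.ket_mem_maxGenEigenspace hLyap,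
    hv.eigenvalues_eq hLyap, fun h => ⟨System.isStable hΓ hLyap, J.re_lam_nonpos h⟩,
    fun h => ⟨System.isRelaxingTo hLyap J h, fun ρ => ⟨fun hs => ?_, fun e => e ▸ hsteady⟩,
      J.exists_gap hn h⟩⟩
  · rw [← mem_rapid] at hR
    have hd : J.d' p ∈ ladderAlg n := sum_mem fun μ _ =>
      Subalgebra.smul_mem _ (bOp'_mem_ladderAlg μ) _
    exact J.tr_d' p hR ▸ hasTrace_tr (ladderAlg_mem_rapid hd hR)
  · obtain ⟨P, hP, h⟩ := exists_leftAlg_tr_eq (J.braOp_mem_ladderAlg (Γ := Γ) N) 1 (one_mem _)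
    exact ⟨P, hP, fun R hR => h R (mem_rapid.mpr hR)⟩
  · exact hv.existsUnique_bra (Algebra.adjoin_mono Set.subset_union_left hP)
  · have h : tr (J.braOp Γ N (J.ket ρ₀ N')) = if N = N' then 1 else 0 := hv.bra_ket N N'
    exact h ▸ hasTrace_tr (ladderAlg_mem_rapid (J.braOp_mem_ladderAlg N) (hket N'))
  · rw [hv.bra_liouvillian_ket hLyap hle, if_neg hne]
  · rw [hv.bra_liouvillian_ket hLyap le_rfl, if_pos rfl]
  · exact sys.steadyState_unique hΓ.isSymm hLyap J h hs hsteady
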